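/- Let $d\ge 1$ and $k\ge 0$ be integers, and let $\mathbb R^d_+=[0,\infty)\times\mathbb R^{d-1}$. For an open subset $\Omega$ of $\mathbb R^d$ or of $\mathbb R^d_+$ let $W^k(\Omega)$ be the usual ($L^2$-based) Sobolev space on the interior of $\Omega$. **Setting.** Let $(X,g)$ be a complete $d$-dimensional smooth Riemannian manifold without boundary, $M\subset X$ a closed domain with smooth boundary, and let $X\setminus M$ denote the complementary domain (the closure of the complement, again with boundary $\partial M$). A domain $N$ with smooth boundary has *bounded geometry with constants* $r_0>0$, $C=(C_l)_{l\ge 0}$, $C_l>0$, if, with $n_x$ the inward unit normal, (i) the collar map $[0,r_0)\times\partial N\to N$, $(t,x)\mapsto \exp_x(t n_x)$, is a diffeomorphism onto its image; (ii) the injectivity radius of $\partial N$ is at least $r_0$; (iii) at each $x_0\in\partial N$ there are normal boundary coordinates $(t,v)\mapsto \exp_y(t n_y)$, $y=\exp^{\partial N}_{x_0}(v)$, for $0\le t<r_0$, $|v|<r_0$; (iv) the injectivity radius at points of $N$ of distance at least $2r_0/3$ from $\partial N$ is at least $r_0/3$, so that inner normal coordinates of radius $r_0/3$ exist there; (v)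 $|\nabla^l R|\le C_l$ on $N$ and $|\nabla^l\ell|\le C_l$ on $\partial N$ for all $l\ge0$, where $R$ is the curvature tensor and $\ell$ the second fundamental form of $\partial N$. An *atlas* $\mathcal A=\{\phi_\alpha,\chi_\alpha\}_\alpha$ consists of countably many charts $\phi_\alpha\colon V_\alpha\to U_\alpha$, with $V_\alpha$ open in $\mathbb R^d$ (or in $\mathbb R^d_+$ for a manifold with boundary), and of smooth functions $\chi_\alpha$ with compact support in $U_\alpha$ and $\sum_\alpha\chi_\alpha^2=1$. The local Sobolev space $W^k(M,\mathcal A)$ consists of the functions $u$ (modulo equality a.e.) with $\|u\|^2_{W^k(M,\mathcal A)}=\sum_\alpha\|\chi_\alpha\cdot (u\circ\phi_\alpha)\|^2_{W^k(V_\alpha)}<\infty$, where $\chi_\alpha$ is read in the chart $\phi_\alpha$. The atlas is *admissible with constants* $N_0$, $\hat C=(\hat C_l)_{l\ge0}$ if all partial derivatives of order at most $l$ of all coordinate changes and of all $\chi_\alpha$ (in the chart $\phi_\alpha$) are bounded by $\hat C_l$, for all $l\ge 0$, and if each $U_\alpha$ meets at most $N_0$ of the sets $U_\beta$. Let $\mathcal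 A$ be an atlas of $M$ by (restrictions to open subsets of) inner normal charts and normal boundary charts of $M$ as in (iii), (iv), and let $\widetilde{\mathcal A}=\{\widetilde\phi_\alpha,\widetilde\chi_\alpha\}$ be an *associated* atlas of $X$: it consists of the inner charts of $\mathcal A$, of extensions $\widetilde\phi_\alpha\colon\widetilde V_\alpha\to\widetilde U_\alpha$ of the boundary charts of $\mathcal A$ to two-sided collar charts (in the coordinates $(t,v)$ with $|t|<r_0$, $|v|<r_0$), and of inner normal charts of $X\setminus M$, such that $\widetilde V_\alpha\cap\mathbb R^d_+=V_\alpha$, $\widetilde U_\alpha\cap M=U_\alpha$ and $\widetilde\chi_\alpha|_M=\chi_\alpha$ for every index $\alpha$ of $\mathcal A$. Assume that $\widetilde{\mathcal A}$ is admissible with constants $N_0=N_0(r_0,C)$ and $\hat C_l=\hat C_l(r_0,C)$, where $N_0(\cdot)$ and $\hat C_l(\cdot)$ are arbitrary prescribed functions of the constants of bounded geometry. **Theorem.** For all $d\ge1$ and $k\ge0$ there is a bounded linear extension operator $\mathcal E_0\colon W^k(\mathbb R^d_+)\to W^k(\mathbb R^d)$ with the following property. For all functions $N_0(\cdot)$,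 $\hat C_l(\cdot)$ as above there is a function $K$ of $(r_0,C)$ such that, whenever $M$ and $X\setminus M$ have bounded geometry with constants $r_0$ and $C$ and $\mathcal A$, $\widetilde{\mathcal A}$ are associated atlases as above, there is a linear operator $$\mathcal E\colon W^k(M,\mathcal A)\to W^k(X,\widetilde{\mathcal A}),\qquad (\mathcal E u)|_M=u \ \text{ a.e.},\qquad \|\mathcal E\|\le K(r_0,C),$$ given by $$\mathcal E u(x)=\sum_{\alpha\in\mathcal A}\widetilde\chi_\alpha(x)\cdot\bigl(\mathcal E_0(\chi_\alpha\cdot (u\circ\phi_\alpha))\bigr)(\widetilde\phi_\alpha^{-1}x)\qquad\text{for a.e. } x\in X,$$ where $\chi_\alpha\cdot(u\circ\phi_\alpha)$ is extended by zero to $\mathbb R^d_+$. In particular, for fixed dimension $d$, $\|\mathcal E\|$ is bounded by a constant that depends only on $k$, $r_0$ and $(C_l)_l$. -/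

import Mathlib

open Set Filter Topology MeasureTheory Bundle
open scoped Manifold ContDiff ENNReal NNReal

noncomputable section

namespace BoundedGeometry

/-! ## Sobolev spaces in Euclidean space -/

/-- `ℝ^m` with its Euclidean norm. -/
abbrev Eucl (m : ℕ) : Type := EuclideanSpace ℝ (Fin m)

/-- The `i`-th standard basis vector of `ℝ^m`. -/
abbrev stdVec {m : ℕ} (i : Fin m) : Eucl m := EuclideanSpace.single i (1 : ℝ)

/-- The closed half-space `[0,∞) × ℝ^n` in `ℝ^{n+1}`. -/
def halfSpace (n : ℕ) : Set (Eucl (n + 1)) := {y | 0 ≤ y 0}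

/-- The last `n` coordinates of a point of `ℝ^{n+1}`. -/
def tail {n : ℕ} (y : Eucl (n + 1)) : Eucl n := WithLp.toLp 2 (fun i => y i.succ)

section Euclidean

variable {m : ℕ} {𝕜 : Type*} [RCLike 𝕜]

/-- The mixed partial derivative `∂_{κ 0} ⋯ ∂_{κ (j-1)} f` at `y`, taken within the set `s`. -/
def partialWithin {F : Type*} [NormedAddCommGroup F] [NormedSpace ℝ F] {j : ℕ}
    (κ : Fin j → Fin m) (f : Eucl m → F) (s : Set (Eucl m)) (y : Eucl m) : F :=
  iteratedFDerivWithin ℝ j f s y (fun i => stdVec (κ i))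

/-- `v` is the weak derivative `∂_{κ 0} ⋯ ∂_{κ (j-1)} f` on the interior of `Ω`. -/
structure HasWeakPartial (Ω : Set (Eucl m)) {j : ℕ} (κ : Fin j → Fin m)
    (f v : Eucl m → 𝕜) : Prop where
  locInt : LocallyIntegrableOn f (interior Ω)
  locInt_deriv : LocallyIntegrableOn v (interior Ω)
  integral_eq : ∀ φ : Eucl m → ℝ, ContDiff ℝ ∞ φ → HasCompactSupport φ →
    tsupport φ ⊆ interior Ω →
    ∫ y, partialWithin κ φ univ y • f y = (-1 : ℝ) ^ j • ∫ y, φ y • v y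

/-- The square of the norm of `f` in `W^k(Ω)`, namely the sum of the squares of the `L²`-norms of all
weak partial derivatives of order at most `k`; it is `∞` if `f ∉ W^k(Ω)`. (A weak derivative is
unique almost everywhere, so that the infimum only serves to give the value `∞` if there is
none.) -/
def sobolevNormSq (k : ℕ) (Ω : Set (Eucl m)) (f : Eucl m → 𝕜) : ℝ≥0∞ :=
  ∑ j ∈ Finset.range (k + 1), ∑ κ : Fin j → Fin m,
    ⨅ v : {v : Eucl m → 𝕜 // HasWeakPartial Ω κ f v},
      eLpNorm v.1 2 (volume.restrict (interior Ω)) ^ 2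

variable {k : ℕ} {Ω : Set (Eucl m)} {f g : Eucl m → 𝕜}

theorem HasWeakPartial.congr {j : ℕ} {κ : Fin j → Fin m} {v : Eucl m → 𝕜}
    (h : HasWeakPartial Ω κ f v) (hfg : f =ᵐ[volume.restrict (interior Ω)] g) :
    HasWeakPartial Ω κ g v := by
  refine ⟨?_, h.2, ?_⟩
  · intro x hx
    obtain ⟨s, hs, hs'⟩ := h.1 x hx
    refine ⟨s ∩ interior Ω, inter_mem hs self_mem_nhdsWithin, ?_⟩
    exact (hs'.mono_set inter_subset_left).congr
      (ae_mono (Measure.restrict_mono inter_subset_right le_rfl) hfg)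
  · intro φ h1 h2 h3
    rw [← h.3 φ h1 h2 h3]
    apply integral_congr_ae
    have := (ae_restrict_iff' isOpen_interior.measurableSet).1 hfg
    filter_upwards [this] with y hy
    by_cases hyΩ : y ∈ interior Ω
    · rw [hy hyΩ]
    · have h0 : iteratedFDeriv ℝ j φ y = 0 := by
        by_contra hne
        exact hyΩ (h3 (support_iteratedFDeriv_subset (𝕜 := ℝ) j hne))
      simp [partialWithin, iteratedFDerivWithin_univ, h0]

theorem integrable_smul_of_locInt {φ : Eucl m → ℝ} (hφ : Continuous φ)
    (hc : HasCompactSupport φ) (hs : tsupport φ ⊆ interior Ω)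
    (hf : LocallyIntegrableOn f (interior Ω)) : Integrable (fun y => φ y • f y) := by
  have h1 : IntegrableOn f (tsupport φ) := hf.integrableOn_compact_subset hs hc
  have h2 : IntegrableOn (fun y => φ y • f y) (tsupport φ) :=
    h1.continuousOn_smul hφ.continuousOn hc
  refine (integrableOn_iff_integrable_of_support_subset ?_).1 h2
  intro y hy
  apply subset_tsupport
  intro h0
  exact hy (by simp [h0])

theorem integrable_partial_smul {φ : Eucl m → ℝ} (hφ : ContDiff ℝ ∞ φ)
    (hc : HasCompactSupport φ) (hs : tsupport φ ⊆ interior Ω)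
    (hf : LocallyIntegrableOn f (interior Ω)) {j : ℕ} (κ : Fin j → Fin m) :
    Integrable (fun y => partialWithin κ φ univ y • f y) := by
  have hsub : tsupport (fun y => partialWithin κ φ univ y) ⊆ tsupport φ := by
    refine closure_minimal ?_ (isClosed_tsupport φ)
    intro y hy
    refine support_iteratedFDeriv_subset (𝕜 := ℝ) j ?_
    intro h0
    exact hy (by simp [partialWithin, iteratedFDerivWithin_univ, h0])
  refine integrable_smul_of_locInt ?_ ?_ (hsub.trans hs) hf
  · have : Continuous (iteratedFDeriv ℝ j φ) :=
      hφ.continuous_iteratedFDeriv (by exact_mod_cast le_top)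
    rw [← iteratedFDerivWithin_univ] at this
    exact (ContinuousMultilinearMap.apply ℝ (fun _ : Fin j => Eucl m) ℝ
      (fun i => stdVec (κ i))).continuous.comp this
  · exact hc.of_isClosed_subset (isClosed_tsupport _) hsub

theorem HasWeakPartial.add {j : ℕ} {κ : Fin j → Fin m} {v w : Eucl m → 𝕜}
    (hf : HasWeakPartial Ω κ f v) (hg : HasWeakPartial Ω κ g w) :
    HasWeakPartial Ω κ (f + g) (v + w) := by
  refine ⟨hf.1.add hg.1, hf.2.add hg.2, ?_⟩
  intro φ h1 h2 h3
  simp only [Pi.add_apply, smul_add]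
  rw [integral_add (integrable_partial_smul h1 h2 h3 hf.1 κ)
      (integrable_partial_smul h1 h2 h3 hg.1 κ),
    integral_add (integrable_smul_of_locInt h1.continuous h2 h3 hf.2)
      (integrable_smul_of_locInt h1.continuous h2 h3 hg.2),
    hf.3 φ h1 h2 h3, hg.3 φ h1 h2 h3, smul_add]

theorem HasWeakPartial.const_smul {j : ℕ} {κ : Fin j → Fin m} {v : Eucl m → 𝕜}
    (c : 𝕜) (hf : HasWeakPartial Ω κ f v) : HasWeakPartial Ω κ (c • f) (c • v) := by
  refine ⟨fun x hx => (hf.1 x hx).smul c, fun x hx => (hf.2 x hx).smul c, ?_⟩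
  intro φ h1 h2 h3
  simp only [Pi.smul_apply, smul_comm _ c]
  rw [integral_smul, integral_smul, hf.3 φ h1 h2 h3, smul_comm]

theorem hasWeakPartial_zero {j : ℕ} (κ : Fin j → Fin m) :
    HasWeakPartial Ω κ (0 : Eucl m → 𝕜) 0 := by
  refine ⟨locallyIntegrableOn_zero, locallyIntegrableOn_zero, ?_⟩
  intro φ _ _ _
  simp

theorem sobolevNormSq_congr (hfg : f =ᵐ[volume.restrict (interior Ω)] g) :
    sobolevNormSq k Ω f = sobolevNormSq k Ω g := by
  have key : ∀ {j : ℕ} (κ : Fin j → Fin m) (v : Eucl m → 𝕜),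
      HasWeakPartial Ω κ f v ↔ HasWeakPartial Ω κ g v :=
    fun κ v => ⟨fun h => h.congr hfg, fun h => h.congr hfg.symm⟩
  refine Finset.sum_congr rfl fun j _ => Finset.sum_congr rfl fun κ _ => ?_
  refine le_antisymm (le_iInf fun v => ?_) (le_iInf fun v => ?_)
  · exact iInf_le _ (⟨v.1, (key κ v.1).2 v.2⟩ : {v // HasWeakPartial Ω κ f v})
  · exact iInf_le _ (⟨v.1, (key κ v.1).1 v.2⟩ : {v // HasWeakPartial Ω κ g v})

theorem sobolevNormSq_zero : sobolevNormSq k Ω (0 : Eucl m → 𝕜) = 0 := by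
  refine Finset.sum_eq_zero fun j _ => Finset.sum_eq_zero fun κ _ => ?_
  refine le_antisymm ?_ zero_le
  refine (iInf_le _ ⟨0, hasWeakPartial_zero κ⟩).trans ?_
  simp

theorem sobolevNormSq_add_le :
    sobolevNormSq k Ω (f + g) ≤ 2 * sobolevNormSq k Ω f + 2 * sobolevNormSq k Ω g := by
  simp only [sobolevNormSq, Finset.mul_sum, ← Finset.sum_add_distrib]
  refine Finset.sum_le_sum fun j _ => Finset.sum_le_sum fun κ _ => ?_
  rw [ENNReal.mul_iInf_of_ne (by simp) (by simp), ENNReal.mul_iInf_of_ne (by simp) (by simp),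
    ENNReal.iInf_add]
  refine le_iInf fun v => ?_
  rw [ENNReal.add_iInf]
  refine le_iInf fun w => ?_
  refine (iInf_le _ ⟨v.1 + w.1, v.2.add w.2⟩).trans ?_
  have hv := v.2.locInt_deriv.aestronglyMeasurable
  have hw := w.2.locInt_deriv.aestronglyMeasurable
  refine (pow_le_pow_left' (eLpNorm_add_le hv hw (by norm_num)) 2).trans ?_
  rw [← mul_add]
  have := ENNReal.rpow_add_le_mul_rpow_add_rpow
    (eLpNorm v.1 2 (volume.restrict (interior Ω))) (eLpNorm w.1 2 (volume.restrict (interior Ω)))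
    (p := 2) (by norm_num)
  norm_num at this
  exact this

theorem sobolevNormSq_smul_le (c : 𝕜) :
    sobolevNormSq k Ω (c • f) ≤ ‖c‖ₑ ^ 2 * sobolevNormSq k Ω f := by
  by_cases hc : c = 0
  · subst hc
    rw [zero_smul, sobolevNormSq_zero]
    exact zero_le
  simp only [sobolevNormSq, Finset.mul_sum]
  refine Finset.sum_le_sum fun j _ => Finset.sum_le_sum fun κ _ => ?_
  rw [ENNReal.mul_iInf_of_ne (by simp [hc]) (by simp)]
  refine le_iInf fun v => ?_
  refine (iInf_le _ ⟨c • v.1, v.2.const_smul c⟩).trans ?_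
  rw [eLpNorm_const_smul, mul_pow]

variable (𝕜) in
/-- The Sobolev space `W^k(Ω)` of (classes of) `𝕜`-valued functions on the interior of `Ω`. -/
def SobolevSpace (k : ℕ) (Ω : Set (Eucl m)) :
    Submodule 𝕜 (Eucl m →ₘ[volume.restrict (interior Ω)] 𝕜) where
  carrier := {u | sobolevNormSq k Ω u < ⊤}
  add_mem' {u v} hu hv := by
    simp only [mem_ofPred_eq] at *
    rw [sobolevNormSq_congr (AEEqFun.coeFn_add u v)]
    refine sobolevNormSq_add_le.trans_lt ?_
    exact ENNReal.add_lt_top.2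
      ⟨ENNReal.mul_lt_top (by simp) hu, ENNReal.mul_lt_top (by simp) hv⟩
  zero_mem' := by
    simp only [mem_ofPred_eq]
    rw [sobolevNormSq_congr AEEqFun.coeFn_zero, sobolevNormSq_zero]
    simp
  smul_mem' c u hu := by
    simp only [mem_ofPred_eq] at *
    rw [sobolevNormSq_congr (AEEqFun.coeFn_smul c u)]
    exact (sobolevNormSq_smul_le c).trans_lt (ENNReal.mul_lt_top (by simp) hu)

/-- The norm of `W^k(Ω)`. -/
def sobolevNorm {k : ℕ} {Ω : Set (Eucl m)} (u : SobolevSpace 𝕜 k Ω) : ℝ≥0∞ :=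
  sobolevNormSq k Ω (u : Eucl m →ₘ[volume.restrict (interior Ω)] 𝕜) ^ (1 / 2 : ℝ)

end Euclidean

/-! ## Tensor calculus in coordinates -/

section Coordinates

variable {m : ℕ}

/-- The `i`-th partial derivative. -/
def pd (i : Fin m) (f : Eucl m → ℝ) (w : Eucl m) : ℝ := fderiv ℝ f w (stdVec i)

/-- The Christoffel symbols `Γ^l_{ij}` of a metric with components `G`. -/
def christoffel (G : Eucl m → Matrix (Fin m) (Fin m) ℝ) (l i j : Fin m) (w : Eucl m) : ℝ :=
  (1 / 2) * ∑ p, (G w)⁻¹ l p *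
    (pd i (fun z => G z j p) w + pd j (fun z => G z i p) w - pd p (fun z => G z i j) w)

/-- The components of the (0,4)-curvature tensor,
`R_{ijkl} = g_{lq} (∂_i Γ^q_{jk} - ∂_j Γ^q_{ik} + Γ^q_{ip} Γ^p_{jk} - Γ^q_{jp} Γ^p_{ik})`. -/
def riemannTensor (G : Eucl m → Matrix (Fin m) (Fin m) ℝ) (w : Eucl m) (I : Fin 4 → Fin m) : ℝ :=
  ∑ q, G w (I 3) q *
    (pd (I 0) (christoffel G q (I 1) (I 2)) w - pd (I 1) (christoffel G q (I 0) (I 2)) w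
      + ∑ p, (christoffel G q (I 0) p w * christoffel G p (I 1) (I 2) w
        - christoffel G q (I 1) p w * christoffel G p (I 0) (I 2) w))

/-- The covariant derivative of a (0,p)-tensor field with components `T`; the new index comes
first. -/
def covDeriv (G : Eucl m → Matrix (Fin m) (Fin m) ℝ) {p : ℕ}
    (T : Eucl m → (Fin p → Fin m) → ℝ) (w : Eucl m) (I : Fin (p + 1) → Fin m) : ℝ :=
  pd (I 0) (fun z => T z (Fin.tail I)) w
    - ∑ s : Fin p, ∑ q : Fin m,
        christoffel G q (I 0) (I s.succ) w * T w (Function.update (Fin.tail I) s q)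

/-- The `k`-th iterated covariant derivative of a (0,p)-tensor field. -/
def iterCovDeriv (G : Eucl m → Matrix (Fin m) (Fin m) ℝ) {p : ℕ}
    (T : Eucl m → (Fin p → Fin m) → ℝ) : (k : ℕ) → Eucl m → (Fin (p + k) → Fin m) → ℝ
  | 0 => T
  | k + 1 => covDeriv G (iterCovDeriv G T k)

/-- The pointwise norm of a (0,p)-tensor with respect to the metric `G`. -/
def tensorNorm (G : Matrix (Fin m) (Fin m) ℝ) {p : ℕ} (T : (Fin p → Fin m) → ℝ) : ℝ :=
  √(∑ I : Fin p → Fin m, ∑ J : Fin p → Fin m, (∏ s, G⁻¹ (I s) (J s)) * T I * T J)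

end Coordinates

/-! ## Riemannian geometry of `X`, of domains in `X` and of their boundaries -/

section Geometry

variable (n : ℕ) {X : Type*} [EMetricSpace X] [ChartedSpace (Eucl (n + 1)) X]

/-- `ψ` restricted to `W` is a local parametrization of the (smooth, embedded) subset `S` of `X`: `W`
is relatively open in the model `Q ⊆ ℝ^m` (in practice `ℝ^m` or a half-space), and `ψ` is a smooth
immersion on `W` and a homeomorphism of `W` onto a relatively open subset of `S`. -/
structure IsLocalParam {m : ℕ} (Q : Set (Eucl m)) (S : Set X) (ψ : Eucl m → X)
    (W : Set (Eucl m)) : Prop where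
  dom_open : ∃ O, IsOpen O ∧ W = O ∩ Q
  smooth : ContMDiffOn (𝓡 m) (𝓡 (n + 1)) ∞ ψ W
  immersion : ∀ w ∈ W, Function.Injective (mfderivWithin (𝓡 m) (𝓡 (n + 1)) ψ W w)
  injOn : InjOn ψ W
  mapsTo : MapsTo ψ W S
  openMap : ∀ O : Set (Eucl m), IsOpen O → ∃ O' : Set X, IsOpen O' ∧ ψ '' (W ∩ O) = S ∩ O'

/-- `M` is a closed domain in `X` (a submanifold of codimension zero) with smooth boundary: near each
boundary point there is a smooth chart of `X` in which `M` is a half-space. -/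
def IsSmoothDomain [IsManifold (𝓡 (n + 1)) ∞ X] (M : Set X) : Prop :=
  IsClosed M ∧ ∀ x ∈ frontier M,
    ∃ ψ ∈ IsManifold.maximalAtlas (𝓡 (n + 1)) ∞ X, x ∈ ψ.source ∧
      ∀ y ∈ ψ.source, y ∈ M ↔ 0 ≤ ψ y 0

/-- The initial point and the initial velocity of a curve. -/
def velocityAtZero (γ : ℝ → X) : TangentBundle (𝓡 (n + 1)) X :=
  tangentMap 𝓘(ℝ, ℝ) (𝓡 (n + 1)) γ ⟨0, (1 : ℝ)⟩

/-- The tangent space at `x` of the submanifold `S`: the velocities of smooth curves in `S`. -/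
def tangentVectors (S : Set X) (x : X) : Set (TangentSpace (𝓡 (n + 1)) x) :=
  {v | ∃ γ : ℝ → X, ContMDiffAt 𝓘(ℝ, ℝ) (𝓡 (n + 1)) ∞ γ 0 ∧ (∀ᶠ t in 𝓝 0, γ t ∈ S) ∧
    velocityAtZero n γ = ⟨x, v⟩}

variable [RiemannianBundle (fun x : X => TangentSpace (𝓡 (n + 1)) x)]

/-- The components in the local parametrization `ψ` of the metric induced by `X`. -/
def gram {m : ℕ} (ψ : Eucl m → X) (w : Eucl m) : Matrix (Fin m) (Fin m) ℝ :=
  Matrix.of fun i j => inner ℝ (mfderiv (𝓡 m) (𝓡 (n + 1)) ψ w (stdVec i))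
    (mfderiv (𝓡 m) (𝓡 (n + 1)) ψ w (stdVec j))

/-- `γ`, on (a neighbourhood of) `[0,1]`, is a geodesic of the `m`-dimensional submanifold `S` of `X`
with its induced metric, i.e. it solves the geodesic equation in local coordinates of `S`. -/
def IsGeodesic (m : ℕ) (S : Set X) (γ : ℝ → X) : Prop :=
  ∀ t ∈ Icc (0 : ℝ) 1, ∃ (ψ : Eucl m → X) (W : Set (Eucl m)) (c : ℝ → Eucl m),
    IsLocalParam n univ S ψ W ∧ ContDiffAt ℝ 2 c t ∧
    ∀ᶠ s in 𝓝 t, c s ∈ W ∧ γ s = ψ (c s) ∧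
      ∀ l : Fin m, deriv (deriv fun τ => c τ l) s
        + ∑ i, ∑ j, christoffel (gram n ψ) l i j (c s)
            * deriv (fun τ => c τ i) s * deriv (fun τ => c τ j) s = 0

open Classical in
/-- The exponential map `exp_x v` of the `m`-dimensional submanifold `S` (and `x` if there is no
geodesic on `[0,1]` with initial velocity `v`). -/
def expMap (m : ℕ) (S : Set X) (x : X) (v : TangentSpace (𝓡 (n + 1)) x) : X :=
  if h : ∃ γ : ℝ → X, IsGeodesic n m S γ ∧ velocityAtZero n γ = ⟨x, v⟩ then h.choose 1 else x

/-- `L` is a linear isometry of `ℝ^m` into (hence, if `S` is an `m`-dimensional submanifold, onto) the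
tangent space of `S` at `x`. -/
def IsFrame {m : ℕ} (S : Set X) (x : X) (L : Eucl m →ₗ[ℝ] TangentSpace (𝓡 (n + 1)) x) : Prop :=
  ∀ v, ‖L v‖ = ‖v‖ ∧ L v ∈ tangentVectors n S x

/-- `ν` is the inward unit normal vector of the domain `M` at its boundary point `x`. -/
def IsInwardNormal (M : Set X) (x : X) (ν : TangentSpace (𝓡 (n + 1)) x) : Prop :=
  ‖ν‖ = 1 ∧ (∀ v ∈ tangentVectors n (frontier M) x, inner ℝ ν v = 0) ∧
  ∃ γ : ℝ → X, ContMDiffAt 𝓘(ℝ, ℝ) (𝓡 (n + 1)) ∞ γ 0 ∧ (∀ᶠ t in 𝓝[≥] 0, γ t ∈ M) ∧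
    velocityAtZero n γ = ⟨x, ν⟩

open Classical in
/-- The inward unit normal vector (and `0` if there is none). -/
def inwardNormal (M : Set X) (x : X) : TangentSpace (𝓡 (n + 1)) x :=
  if h : ∃ ν, IsInwardNormal n M x ν then h.choose else 0

/-- The collar map `(t, x) ↦ exp_x (t n_x)` of the domain `M`. For `t < 0` this is the collar of the
complementary domain, the exponential map being that of `X`. -/
def collar (M : Set X) (t : ℝ) (x : X) : X :=
  expMap n (n + 1) univ x (t • inwardNormal n M x)

/-- Normal boundary coordinates `(t, v) ↦ exp_y (t n_y)`, `y = exp^{∂M}_x (L v)`, at `x ∈ ∂M`. -/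
def boundaryNormalCoord (M : Set X) (x : X) (L : Eucl n →ₗ[ℝ] TangentSpace (𝓡 (n + 1)) x)
    (y : Eucl (n + 1)) : X :=
  collar n M (y 0) (expMap n n (frontier M) x (L (tail y)))

/-- Inner normal coordinates `v ↦ exp_x (L v)` at `x`. -/
def innerNormalCoord (x : X) (L : Eucl (n + 1) →ₗ[ℝ] TangentSpace (𝓡 (n + 1)) x)
    (y : Eucl (n + 1)) : X :=
  expMap n (n + 1) univ x (L y)

/-- The components of the second fundamental form of `∂M` in a local parametrization `Ψ ∘ c` of `∂M`,
where `Ψ` is a local parametrization of `X`: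
`ℓ_{ab} = ⟨∇_{∂_a} ∂_b, n⟩`, with `(∇_{∂_a} ∂_b)^i = ∂_a ∂_b c^i + Γ^i_{jl}(c) ∂_a c^j ∂_b c^l`. -/
def secondFundForm (M : Set X) (Ψ : Eucl (n + 1) → X) (c : Eucl n → Eucl (n + 1))
    (w : Eucl n) (I : Fin 2 → Fin n) : ℝ :=
  inner ℝ
    (mfderiv (𝓡 (n + 1)) (𝓡 (n + 1)) Ψ (c w)
      (∑ i, (pd (I 0) (pd (I 1) fun z => c z i) w
        + ∑ j, ∑ l, christoffel (gram n Ψ) i j l (c w)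
            * pd (I 0) (fun z => c z j) w * pd (I 1) (fun z => c z l) w) • stdVec i))
    (inwardNormal n M (Ψ (c w)))

/-- The domain `M ⊆ X`, as a Riemannian manifold with boundary `∂M = frontier M`, is of bounded
geometry with constants `r₀` and `C_k`.

Geodesics, curvature and the distance to the boundary of `M` are those of `X`: a path in `X` from a
point of `M` to `∂M` has an initial piece in `M` that already reaches `∂M`. -/
structure HasBoundedGeometry [IsManifold (𝓡 (n + 1)) ∞ X]
    (M : Set X) (r₀ : ℝ) (C : ℕ → ℝ) : Prop where
  domain : IsSmoothDomain n M
  /-- The collar map is injective on `[0, r₀) × ∂M`. -/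
  collar_injOn : InjOn (fun q : ℝ × X => collar n M q.1 q.2) (Ico 0 r₀ ×ˢ frontier M)
  /-- The collar map is a diffeomorphism onto its image: it is one in each local parametrization
  of `∂M`. -/
  collar_diffeo : ∀ (ψ : Eucl n → X) (W : Set (Eucl n)), IsLocalParam n univ (frontier M) ψ W →
    IsLocalParam n (halfSpace n) M (fun y => collar n M (y 0) (ψ (tail y)))
      {y | y 0 ∈ Ico 0 r₀ ∧ tail y ∈ W}
  /-- The injectivity radius of `∂M` is at least `r₀`. -/
  injRad_boundary : ∀ x ∈ frontier M, ∀ L : Eucl n →ₗ[ℝ] TangentSpace (𝓡 (n + 1)) x,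
    IsFrame n (frontier M) x L →
    IsLocalParam n univ (frontier M) (fun v => expMap n n (frontier M) x (L v))
      (Metric.ball 0 r₀)
  /-- There are normal boundary coordinates at each point of `∂M`. -/
  boundary_coord : ∀ x ∈ frontier M, ∀ L : Eucl n →ₗ[ℝ] TangentSpace (𝓡 (n + 1)) x,
    IsFrame n (frontier M) x L →
    IsLocalParam n (halfSpace n) M (boundaryNormalCoord n M x L)
      {y | y 0 ∈ Ico 0 r₀ ∧ tail y ∈ Metric.ball 0 r₀}
  /-- The injectivity radius of `M` at points of distance at least `2 r₀ / 3` from `∂M` is at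
  least `r₀ / 3`. -/
  injRad_inner : ∀ x ∈ M, ENNReal.ofReal (2 * r₀ / 3) ≤ Metric.infEDist x (frontier M) →
    ∀ L : Eucl (n + 1) →ₗ[ℝ] TangentSpace (𝓡 (n + 1)) x, IsFrame n univ x L →
    IsLocalParam n univ M (innerNormalCoord n x L) (Metric.ball 0 (r₀ / 3))
  /-- `|∇^k R| ≤ C_k` on `M`. -/
  curvature_bound : ∀ (ψ : Eucl (n + 1) → X) (W : Set (Eucl (n + 1))),
    IsLocalParam n univ univ ψ W → ∀ k, ∀ w ∈ W, ψ w ∈ M →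
    tensorNorm (gram n ψ w) (iterCovDeriv (gram n ψ) (riemannTensor (gram n ψ)) k w) ≤ C k
  /-- `|∇^k ℓ| ≤ C_k` on `∂M`. -/
  secondFundForm_bound : ∀ (Ψ : Eucl (n + 1) → X) (O : Set (Eucl (n + 1)))
    (c : Eucl n → Eucl (n + 1)) (W : Set (Eucl n)),
    IsLocalParam n univ univ Ψ O → ContDiffOn ℝ ∞ c W → MapsTo c W O →
    IsLocalParam n univ (frontier M) (Ψ ∘ c) W → ∀ k, ∀ w ∈ W,
    tensorNorm (gram n (Ψ ∘ c) w)
      (iterCovDeriv (gram n (Ψ ∘ c)) (secondFundForm n M Ψ c) k w) ≤ C k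

end Geometry

/-! ## Atlases and local Sobolev spaces -/

section Atlases

variable (n : ℕ) {X : Type*} [EMetricSpace X] [ChartedSpace (Eucl (n + 1)) X]

/-- An atlas `{φ_α, χ_α}` of `S ⊆ X` modelled on `Q` (`ℝ^d`, or the half-space if `S` has a boundary):
parametrizations `φ_α : V_α → U_α` onto relatively open subsets `U_α` covering `S`, with smooth
coordinate changes, and smooth functions `χ_α` with compact support in `U_α` and
`∑_α χ_α² = 1` on `S`. Only the values of `φ_α` on `V_α` and of `χ_α` on `S` matter. -/
structure ManifoldAtlas (Q : Set (Eucl (n + 1))) (S : Set X) (ι : Type*) where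
  dom : ι → Set (Eucl (n + 1))
  chart : ι → Eucl (n + 1) → X
  cutoff : ι → X → ℝ
  model_closed : IsClosed Q
  param : ∀ α, IsLocalParam n Q S (chart α) (dom α)
  cover : ⋃ α, chart α '' dom α = S
  transition_smooth : ∀ α β, ContDiffOn ℝ ∞
    (fun y => Function.invFunOn (chart α) (dom α) (chart β y))
    (dom β ∩ chart β ⁻¹' (chart α '' dom α))
  cutoff_smooth : ∀ α, ContDiffOn ℝ ∞ (fun y => cutoff α (chart α y)) (dom α)
  cutoff_support : ∀ α, ∃ K ⊆ chart α '' dom α, IsCompact K ∧ ∀ x ∈ S, x ∉ K → cutoff α x = 0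
  cutoff_sum : ∀ x ∈ S, ∑ᶠ α, cutoff α x ^ 2 = 1

namespace ManifoldAtlas

variable {n} {Q : Set (Eucl (n + 1))} {S : Set X} {ι : Type*} (A : ManifoldAtlas n Q S ι)

/-- The chart neighbourhood `U_α`. -/
def nbhd (α : ι) : Set X := A.chart α '' A.dom α

/-- The inverse `φ_α⁻¹ : U_α → V_α`. -/
def chartInv (α : ι) : X → Eucl (n + 1) := Function.invFunOn (A.chart α) (A.dom α)

/-- The domain `V_β ∩ φ_β⁻¹(U_α)` of the coordinate change `φ_α⁻¹ ∘ φ_β`. -/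
def overlap (α β : ι) : Set (Eucl (n + 1)) := A.dom β ∩ A.chart β ⁻¹' A.nbhd α

/-- The atlas is admissible with constants `N₀` and `Ĉ_k`. -/
structure Admissible (N₀ : ℕ) (Chat : ℕ → ℝ) : Prop where
  transition_bound : ∀ α β (k j : ℕ), j ≤ k → ∀ κ : Fin j → Fin (n + 1), ∀ y ∈ A.overlap α β,
    ‖partialWithin κ (fun z => A.chartInv α (A.chart β z)) (A.overlap α β) y‖ ≤ Chat k
  multiplicity : ∀ α, {β | (A.nbhd α ∩ A.nbhd β).Nonempty}.encard ≤ N₀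
  cutoff_bound : ∀ α (k j : ℕ), j ≤ k → ∀ κ : Fin j → Fin (n + 1), ∀ y ∈ A.dom α,
    ‖partialWithin κ (fun z => A.cutoff α (A.chart α z)) (A.dom α) y‖ ≤ Chat k

/-- The sum of the Lebesgue measures of all charts. It serves only to identify functions that agree
almost everywhere: a set is null iff it is null in all charts, i.e. iff it is null for the Riemannian
volume on `S`. -/
def chartMeasure [MeasurableSpace X] : Measure X :=
  Measure.sum fun α => (volume.restrict (A.dom α)).map (A.chart α)

theorem measurableSet_dom (α : ι) : MeasurableSet (A.dom α) := by
  obtain ⟨O, hO, h⟩ := (A.param α).dom_open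
  rw [h]
  exact hO.measurableSet.inter A.model_closed.measurableSet

variable [MeasurableSpace X] [BorelSpace X]

theorem ae_chart {p : X → Prop} (h : ∀ᵐ x ∂A.chartMeasure, p x) (α : ι) :
    ∀ᵐ y ∂volume.restrict (interior (A.dom α)), p (A.chart α y) := by
  have h1 : AEMeasurable (A.chart α) (volume.restrict (A.dom α)) :=
    (A.param α).smooth.continuousOn.aemeasurable (A.measurableSet_dom α)
  have h2 : ∀ᵐ x ∂(volume.restrict (A.dom α)).map (A.chart α), p x :=
    ae_mono (Measure.le_sum _ α) h
  exact ae_mono (Measure.restrict_mono interior_subset le_rfl) (ae_of_ae_map h1 h2)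

variable {𝕜 : Type*} [RCLike 𝕜]

/-- The localized function `χ_α u_α` with `u_α = u ∘ φ_α`. -/
def localized (α : ι) (u : X → 𝕜) (y : Eucl (n + 1)) : 𝕜 :=
  A.cutoff α (A.chart α y) • u (A.chart α y)

/-- The square of the local Sobolev norm, `∑_α ‖χ_α u_α‖²_{W^k(V_α)}`. -/
def normSq (k : ℕ) (u : X → 𝕜) : ℝ≥0∞ :=
  ∑' α, sobolevNormSq k (A.dom α) (A.localized α u)

theorem normSq_congr {k : ℕ} {u v : X → 𝕜} (h : u =ᵐ[A.chartMeasure] v) :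
    A.normSq k u = A.normSq k v := by
  refine tsum_congr fun α => sobolevNormSq_congr ?_
  filter_upwards [A.ae_chart h α] with y hy
  simp only [localized, hy]

variable (𝕜) in
/-- The local Sobolev space `W^k(S, A)` of (classes of) functions with finite local Sobolev norm. -/
def Sobolev (k : ℕ) : Submodule 𝕜 (X →ₘ[A.chartMeasure] 𝕜) where
  carrier := {u | A.normSq k u < ⊤}
  add_mem' {u v} hu hv := by
    simp only [mem_ofPred_eq] at *
    rw [A.normSq_congr (AEEqFun.coeFn_add u v)]
    have hle : A.normSq k (⇑u + ⇑v) ≤ 2 * A.normSq k u + 2 * A.normSq k v := by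
      simp only [normSq]
      rw [← ENNReal.tsum_mul_left, ← ENNReal.tsum_mul_left, ← ENNReal.tsum_add]
      refine ENNReal.tsum_le_tsum fun α => ?_
      have : A.localized α (⇑u + ⇑v) = A.localized α u + A.localized α v := by
        funext y
        simp [localized, smul_add]
      rw [this]
      exact sobolevNormSq_add_le
    exact hle.trans_lt (ENNReal.add_lt_top.2
      ⟨ENNReal.mul_lt_top (by simp) hu, ENNReal.mul_lt_top (by simp) hv⟩)
  zero_mem' := by
    simp only [mem_ofPred_eq]
    rw [A.normSq_congr AEEqFun.coeFn_zero]
    have : ∀ α, A.localized α (0 : X → 𝕜) = 0 := by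
      intro α
      funext y
      simp [localized]
    simp [normSq, this, sobolevNormSq_zero]
  smul_mem' c u hu := by
    simp only [mem_ofPred_eq] at *
    rw [A.normSq_congr (AEEqFun.coeFn_smul c u)]
    have hle : A.normSq k (c • ⇑u) ≤ ‖c‖ₑ ^ 2 * A.normSq k u := by
      simp only [normSq]
      rw [← ENNReal.tsum_mul_left]
      refine ENNReal.tsum_le_tsum fun α => ?_
      have : A.localized α (c • ⇑u) = c • A.localized α u := by
        funext y
        simp [localized]
      rw [this]
      exact sobolevNormSq_smul_le c
    exact hle.trans_lt (ENNReal.mul_lt_top (by simp) hu)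

/-- The norm of `W^k(S, A)`. -/
def sobolevNorm {k : ℕ} (u : A.Sobolev 𝕜 k) : ℝ≥0∞ :=
  A.normSq k (u : X →ₘ[A.chartMeasure] 𝕜) ^ (1 / 2 : ℝ)

end ManifoldAtlas

variable [RiemannianBundle (fun x : X => TangentSpace (𝓡 (n + 1)) x)]

/-- `φ` on `V` is (a restriction of, up to a translation of the coordinates) an inner normal chart of
the domain `M`, centred at a point of distance at least `2 r₀ / 3` from `∂M` and of radius `r₀ / 3`. -/
def IsInnerNormalChart (M : Set X) (r₀ : ℝ) (φ : Eucl (n + 1) → X) (V : Set (Eucl (n + 1))) :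
    Prop :=
  MapsTo φ V (interior M) ∧
  ∃ x ∈ M, ENNReal.ofReal (2 * r₀ / 3) ≤ Metric.infEDist x (frontier M) ∧
    ∃ L : Eucl (n + 1) →ₗ[ℝ] TangentSpace (𝓡 (n + 1)) x, IsFrame n univ x L ∧
    ∃ c : Eucl (n + 1), V ⊆ Metric.ball c (r₀ / 3) ∧
      EqOn φ (fun y => innerNormalCoord n x L (y - c)) V

/-- `φ` on `V` is (a restriction of) a normal boundary chart of `M`, extended to a two-sided collar
`(-r₀, r₀) × B(0, r₀)`. -/
def IsCollarNormalChart (M : Set X) (r₀ : ℝ) (φ : Eucl (n + 1) → X) (V : Set (Eucl (n + 1))) :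
    Prop :=
  ∃ x ∈ frontier M, ∃ L : Eucl n →ₗ[ℝ] TangentSpace (𝓡 (n + 1)) x, IsFrame n (frontier M) x L ∧
    V ⊆ {y | y 0 ∈ Ioo (-r₀) r₀ ∧ tail y ∈ Metric.ball 0 r₀} ∧
    EqOn φ (boundaryNormalCoord n M x L) V

/-- The normal atlas `A` of `M` (modelled on the half-space) and the atlas `A'` of `X` are associated:
the charts of `A` are the inner normal charts and the normal boundary charts of `M`, each being the
restriction to the half-space, i.e. to `M`, of a chart of `A'`, which is an extended collar chart in
the boundary case; the remaining charts of `A'` are inner normal charts of the complementary domain;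
and the functions of `A` are the restrictions of those of `A'`. -/
structure AssociatedAtlases {M : Set X} {ι ι' : Type*} (r₀ : ℝ)
    (A : ManifoldAtlas n (halfSpace n) M ι) (A' : ManifoldAtlas n univ (univ : Set X) ι')
    (e : ι ↪ ι') : Prop where
  dom_eq : ∀ α, A.dom α = A'.dom (e α) ∩ halfSpace n
  nbhd_eq : ∀ α, A.nbhd α = A'.nbhd (e α) ∩ M
  chart_eq : ∀ α, EqOn (A.chart α) (A'.chart (e α)) (A.dom α)
  cutoff_eq : ∀ α, EqOn (A.cutoff α) (A'.cutoff (e α)) M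
  normal : ∀ α,
    (A.dom α = A'.dom (e α) ∧ IsInnerNormalChart n M r₀ (A'.chart (e α)) (A'.dom (e α))) ∨
      IsCollarNormalChart n M r₀ (A'.chart (e α)) (A'.dom (e α))
  outer : ∀ β, β ∉ range e → IsInnerNormalChart n (interior M)ᶜ r₀ (A'.chart β) (A'.dom β)

end Atlases

end BoundedGeometry

end

open Set Filter Topology MeasureTheory Bundle
open scoped Manifold ContDiff ENNReal NNReal

/-! In the half-space the extension is by higher-order reflection: for `t < 0` one takes `∑ c_j
f(-λ_j t, v)`, with weights such that `∑ c_j (-λ_j)^l = 1` for all `l < k`, so that the normal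
derivatives of order below `k` match across the boundary. This is proved by duality, without
approximation by smooth functions. Integrating the reflected function against `φ` is integrating `f`
over the half-space against `reflDual φ`. For the normal derivative, the condition `l = 0` says that
the dual test function vanishes on the boundary (`WeakPD.refl`), and `WeakPD.halfSpace` allows
integration by parts against such functions. The derivative of a reflection is a reflection of the
derivative with weights that satisfy the same conditions with one order less, which gives the
induction in `exists_sobBound_refl`.

On the manifold, each summand of the extension restricts to `χ_α² u` on `M`, since `E₀` leaves `χ_α
u_α` unchanged there. The squares sum to one, so the sum is `u` (`AssociatedAtlases.glue_ae_eq`).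
For the norm, fix a chart `β` of `X`. In it, `χ_β` times the extension is a sum of at most `N₀`
terms. Each arises from some `E₀(χ_α u_α)` by multiplication with a cutoff, a change of coordinates,
multiplication with a second cutoff and extension by zero. All of these are bounded in terms of `d`,
`k` and `Ĉ_{k+1}` (`Admissible.sobBound_transfer`). Cauchy–Schwarz over these terms costs one factor
`N₀`; counting how many `β` see a given `α` costs another (`Admissible.normSq_glue_le`).

The estimates are made for `SobBound`, which iterates first weak derivatives. Every operation then
needs only a first-order rule and an induction on `k`: the product rule `WeakPD.smul`, the chain
rule `IsDiffeo.weakPD_comp` and extension by zero `WeakPD.indicator`. `sobBound_of_sobolevNormSq_le`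
and `SobBound.sobolevNormSq_le` translate to and from the Sobolev norm. -/

namespace BoundedGeometry

/-! ### Test functions and first weak derivatives. -/

section TestFunctions

variable {m : ℕ} {𝕜 : Type*} [RCLike 𝕜] {Ω Ω' : Set (Eucl m)}

/-- `φ` is a smooth function with compact support in `Ω`. -/
structure IsTest (Ω : Set (Eucl m)) (φ : Eucl m → ℝ) : Prop where
  smooth : ContDiff ℝ ∞ φ
  compact : HasCompactSupport φ
  supp : tsupport φ ⊆ Ω

theorem IsTest.mono {φ : Eucl m → ℝ} (h : IsTest Ω φ) (hΩ : Ω ⊆ Ω') : IsTest Ω' φ :=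
  ⟨h.1, h.2, h.3.trans hΩ⟩

theorem IsTest.eq_zero {φ : Eucl m → ℝ} (h : IsTest Ω φ) {y : Eucl m} (hy : y ∉ Ω) : φ y = 0 :=
  image_eq_zero_of_notMem_tsupport fun h' => hy (h.3 h')

theorem contDiffOn_pd (hΩ : IsOpen Ω) {f : Eucl m → ℝ} (hf : ContDiffOn ℝ ∞ f Ω) (i : Fin m) :
    ContDiffOn ℝ ∞ (pd i f) Ω := by
  have : ContDiffOn ℝ ∞ (fderiv ℝ f) Ω := hf.fderiv_of_isOpen hΩ (by simp)
  exact this.clm_apply contDiffOn_const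

theorem contDiff_pd {f : Eucl m → ℝ} (hf : ContDiff ℝ ∞ f) (i : Fin m) :
    ContDiff ℝ ∞ (pd i f) :=
  (hf.fderiv_right (by simp)).clm_apply contDiff_const

theorem tsupport_pd_subset (i : Fin m) (f : Eucl m → ℝ) : tsupport (pd i f) ⊆ tsupport f := by
  refine closure_minimal (fun y hy => support_fderiv_subset ℝ (f := f) ?_) (isClosed_tsupport f)
  intro h0
  exact hy (by simp [pd, h0])

theorem pd_eq_zero {i : Fin m} {f : Eucl m → ℝ} {y : Eucl m} (hy : y ∉ tsupport f) :
    pd i f y = 0 :=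
  image_eq_zero_of_notMem_tsupport fun h => hy (tsupport_pd_subset i f h)

theorem IsTest.pd {φ : Eucl m → ℝ} (h : IsTest Ω φ) (i : Fin m) : IsTest Ω (pd i φ) :=
  ⟨contDiff_pd h.1 i, h.2.of_isClosed_subset (isClosed_tsupport _) (tsupport_pd_subset i φ),
    (tsupport_pd_subset i φ).trans h.3⟩

/-- A function that is smooth on an open set and vanishes off a compact subset is a test
function. -/
theorem isTest_of_contDiffOn (hΩ : IsOpen Ω) {K : Set (Eucl m)} (hK : IsCompact K) (hKΩ : K ⊆ Ω)
    {g : Eucl m → ℝ} (hg : ContDiffOn ℝ ∞ g Ω) (h0 : ∀ y ∉ K, g y = 0) : IsTest Ω g := by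
  have hsub : tsupport g ⊆ K :=
    closure_minimal (fun y hy => by by_contra h; exact hy (h0 y h)) hK.isClosed
  refine ⟨contDiff_iff_contDiffAt.2 fun y => ?_,
    hK.of_isClosed_subset (isClosed_tsupport _) hsub, hsub.trans hKΩ⟩
  by_cases hy : y ∈ Ω
  · exact hg.contDiffAt (hΩ.mem_nhds hy)
  · have : g =ᶠ[𝓝 y] fun _ => 0 := by
      filter_upwards [hK.isClosed.isOpen_compl.mem_nhds fun h => hy (hKΩ h)] with z hz
      exact h0 z hz
    exact contDiffAt_const.congr_of_eventuallyEq this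

theorem IsTest.mul (hΩ : IsOpen Ω) {φ a : Eucl m → ℝ} (h : IsTest Ω φ)
    (ha : ContDiffOn ℝ ∞ a Ω) : IsTest Ω (fun y => φ y * a y) :=
  isTest_of_contDiffOn hΩ h.2 h.3 (h.1.contDiffOn.mul ha) fun y hy => by
    rw [image_eq_zero_of_notMem_tsupport hy, zero_mul]

theorem IsTest.integrable_smul (hΩ : IsOpen Ω) {φ : Eucl m → ℝ} (h : IsTest Ω φ) {f : Eucl m → 𝕜}
    (hf : LocallyIntegrableOn f Ω) : Integrable (fun y => φ y • f y) :=
  integrable_smul_of_locInt (Ω := Ω) h.1.continuous h.2 (by rw [hΩ.interior_eq]; exact h.3)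
    (by rwa [hΩ.interior_eq])

theorem pd_mul_apply {f g : Eucl m → ℝ} {y : Eucl m} (i : Fin m) (hf : DifferentiableAt ℝ f y)
    (hg : DifferentiableAt ℝ g y) :
    pd i (fun z => f z * g z) y = pd i f y * g y + f y * pd i g y := by
  simp only [pd]
  rw [fderiv_fun_mul hf hg]
  simp only [_root_.add_apply, _root_.smul_apply, smul_eq_mul]
  ring

/-- The factor `a` is smooth only on `Ω`, but elsewhere all terms vanish because `φ` is supported in
`Ω`. The identity can therefore be integrated over the whole space. -/
theorem IsTest.pd_mul (hΩ : IsOpen Ω) {φ a : Eucl m → ℝ} (h : IsTest Ω φ)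
    (ha : ContDiffOn ℝ ∞ a Ω) (i : Fin m) (y : Eucl m) :
    BoundedGeometry.pd i (fun z => φ z * a z) y =
      BoundedGeometry.pd i φ y * a y + φ y * BoundedGeometry.pd i a y := by
  by_cases hy : y ∈ Ω
  · exact pd_mul_apply i (h.1.differentiable (by simp) y)
      ((ha.contDiffAt (hΩ.mem_nhds hy)).differentiableAt (by simp))
  · have hy' : y ∉ tsupport φ := fun h' => hy (h.3 h')
    have h1 : y ∉ tsupport fun z => φ z * a z := fun h' => hy' (by
      refine closure_mono ?_ h'
      intro z hz hz'
      exact hz (by simp [hz']))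
    rw [pd_eq_zero h1, pd_eq_zero hy', image_eq_zero_of_notMem_tsupport hy']
    simp

theorem IsTest.integral_pd {φ : Eucl m → ℝ} (h : IsTest Ω φ) (i : Fin m) :
    ∫ y, BoundedGeometry.pd i φ y = 0 := by
  have hi := (h.pd i).1.continuous.integrable_of_hasCompactSupport (μ := volume) (h.pd i).2
  have := integral_mul_fderiv_eq_neg_fderiv_mul_of_integrable (μ := volume) (𝕜 := ℝ)
    (f := fun _ : Eucl m => (1 : ℝ)) (g := φ) (v := stdVec i) (by simp)
    (by simp only [one_mul]; exact hi)
    (by simpa using h.1.continuous.integrable_of_hasCompactSupport h.2)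
    (fun _ _ => differentiableAt_const _) (fun x _ => h.1.differentiable (by simp) x)
  simpa [BoundedGeometry.pd] using this

/-- A smooth cutoff function. -/
theorem exists_isTest_eq_one (hΩ : IsOpen Ω) {K : Set (Eucl m)} (hK : IsCompact K) (hKΩ : K ⊆ Ω) :
    ∃ η, IsTest Ω η ∧ ∀ᶠ y in 𝓝ˢ K, η y = 1 := by
  obtain ⟨T, hT, hKT, hTΩ⟩ := exists_compact_between hK hΩ hKΩ
  obtain ⟨η, h1, h2, -⟩ := exists_contMDiffMap_one_nhds_of_subset_interior (n := ⊤) (𝓘(ℝ, Eucl m))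
    hK.isClosed hKT
  exact ⟨η, isTest_of_contDiffOn hΩ hT hTΩ η.contMDiff.contDiff.contDiffOn h2, h1⟩

/-- `v` is the first weak derivative `∂_i f` on `Ω`. -/
def WeakPD (Ω : Set (Eucl m)) (i : Fin m) (f v : Eucl m → 𝕜) : Prop :=
  ∀ φ, IsTest Ω φ → ∫ y, pd i φ y • f y = -∫ y, φ y • v y

variable {i : Fin m} {f g v w : Eucl m → 𝕜}

theorem WeakPD.mono (h : WeakPD Ω i f v) (hΩ : Ω' ⊆ Ω) : WeakPD Ω' i f v :=
  fun φ hφ => h φ (hφ.mono hΩ)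

theorem WeakPD.congr (hΩ : IsOpen Ω) (h : WeakPD Ω i f v)
    (hf : f =ᵐ[volume.restrict Ω] g) (hv : v =ᵐ[volume.restrict Ω] w) : WeakPD Ω i g w := by
  intro φ hφ
  have key : ∀ {ψ : Eucl m → ℝ} {a b : Eucl m → 𝕜}, IsTest Ω ψ → a =ᵐ[volume.restrict Ω] b →
      ∫ y, ψ y • a y = ∫ y, ψ y • b y := by
    intro ψ a b hψ hab
    refine integral_congr_ae ?_
    filter_upwards [(ae_restrict_iff' hΩ.measurableSet).1 hab] with y hy
    by_cases h' : y ∈ Ω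
    · rw [hy h']
    · simp [hψ.eq_zero h']
  rw [← key (hφ.pd i) hf, ← key hφ hv, h φ hφ]

theorem WeakPD.add (hΩ : IsOpen Ω) (hf : LocallyIntegrableOn f Ω) (hv : LocallyIntegrableOn v Ω)
    (hg : LocallyIntegrableOn g Ω) (hw : LocallyIntegrableOn w Ω)
    (h : WeakPD Ω i f v) (h' : WeakPD Ω i g w) : WeakPD Ω i (f + g) (v + w) := by
  intro φ hφ
  simp only [Pi.add_apply, smul_add]
  rw [integral_add ((hφ.pd i).integrable_smul hΩ hf) ((hφ.pd i).integrable_smul hΩ hg),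
    integral_add (hφ.integrable_smul hΩ hv) (hφ.integrable_smul hΩ hw), h φ hφ, h' φ hφ, neg_add]

theorem weakPD_zero : WeakPD Ω i (0 : Eucl m → 𝕜) 0 := fun φ _ => by simp

/-- Since `φ a` is again a test function, the hypothesis applies to it, and the classical Leibniz
rule for `φ a` produces the extra term. -/
theorem WeakPD.smul (hΩ : IsOpen Ω) {a : Eucl m → ℝ} (ha : ContDiffOn ℝ ∞ a Ω)
    (hf : LocallyIntegrableOn f Ω) (hv : LocallyIntegrableOn v Ω) (h : WeakPD Ω i f v) :
    WeakPD Ω i (fun y => a y • f y) (fun y => a y • v y + pd i a y • f y) := by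
  intro φ hφ
  have h1 := (hφ.mul hΩ ha)
  have h2 : IsTest Ω fun y => φ y * pd i a y := hφ.mul hΩ (contDiffOn_pd hΩ ha i)
  have h3 := (hφ.pd i).mul hΩ ha
  have e := h _ h1
  simp only [hφ.pd_mul hΩ ha i, add_smul] at e
  rw [integral_add (h3.integrable_smul hΩ hf) (h2.integrable_smul hΩ hf)] at e
  simp only [smul_add, smul_smul]
  rw [integral_add (h1.integrable_smul hΩ hv) (h2.integrable_smul hΩ hf), neg_add, ← e]
  abel

/-- The fundamental lemma of the calculus of variations. -/
theorem ae_eq_of_integral_isTest (hΩ : IsOpen Ω) (hf : LocallyIntegrableOn f Ω)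
    (hg : LocallyIntegrableOn g Ω)
    (h : ∀ φ, IsTest Ω φ → ∫ y, φ y • f y = ∫ y, φ y • g y) : f =ᵐ[volume.restrict Ω] g := by
  have := hΩ.ae_eq_zero_of_integral_contDiff_smul_eq_zero (μ := volume) (f := f - g)
    (hf.sub hg) (fun φ h1 h2 h3 => by
      have hφ : IsTest Ω φ := ⟨h1, h2, h3⟩
      simp only [Pi.sub_apply, smul_sub]
      rw [integral_sub (hφ.integrable_smul hΩ hf) (hφ.integrable_smul hΩ hg), h φ hφ, sub_self])
  refine (ae_restrict_iff' hΩ.measurableSet).2 ?_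
  filter_upwards [this] with y hy hyΩ
  simpa [sub_eq_zero] using hy hyΩ

/-- Weak differentiation is local. This keeps all derivatives supported in the same closed set when
a function is extended by zero. -/
theorem WeakPD.ae_eq_zero (hΩ : IsOpen Ω) (hv : LocallyIntegrableOn v Ω) (h : WeakPD Ω i f v)
    (hf : f =ᵐ[volume.restrict Ω] 0) : v =ᵐ[volume.restrict Ω] 0 := by
  refine ae_eq_of_integral_isTest hΩ hv locallyIntegrableOn_zero fun φ hφ => ?_
  have := h.congr hΩ hf (Filter.EventuallyEq.refl _ v) φ hφ
  simpa [eq_comm] using this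

/-- Extension by zero from `Ω` to `Ω'` of a function that vanishes off `K`. -/
theorem WeakPD.indicator (hΩ : IsOpen Ω) {K : Set (Eucl m)} (hK : IsClosed K)
    (hKΩ : K ∩ Ω' ⊆ Ω) (h : WeakPD Ω i f v)
    (hf : f =ᵐ[volume.restrict (Ω \ K)] 0) (hv : v =ᵐ[volume.restrict (Ω \ K)] 0) :
    WeakPD Ω' i (Ω.indicator f) (Ω.indicator v) := by
  intro φ hφ
  -- On `K` the product `η φ` has the same value and first derivatives as `φ`, but it is supported
  -- in `Ω`. Off `K` the integrands vanish, so `φ` may be replaced by `η φ`.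
  obtain ⟨η, hη, h1⟩ := exists_isTest_eq_one hΩ (hφ.2.inter_left hK)
    ((inter_subset_inter_right K hφ.3).trans hKΩ)
  have h1' : ∀ y ∈ K ∩ tsupport φ, η =ᶠ[𝓝 y] fun _ => 1 := fun y hy =>
    (eventually_nhdsSet_iff_forall.1 h1) y hy
  have hm : IsTest Ω fun y => η y * φ y := hη.mul hΩ hφ.1.contDiffOn
  have key : ∀ {ψ ψ' : Eucl m → ℝ} {a : Eucl m → 𝕜}, (∀ y ∈ K, ψ y = ψ' y) → IsTest Ω ψ' →
      a =ᵐ[volume.restrict (Ω \ K)] 0 →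
      ∫ y, ψ y • Ω.indicator a y = ∫ y, ψ' y • a y := by
    intro ψ ψ' a hψ hψ' ha
    refine integral_congr_ae ?_
    filter_upwards [(ae_restrict_iff' (hΩ.measurableSet.diff hK.measurableSet)).1 ha] with y hy
    by_cases hy1 : y ∈ Ω
    · by_cases hy2 : y ∈ K
      · simp [hy1, hψ y hy2]
      · simp [hy1, hy ⟨hy1, hy2⟩]
    · simp [hy1, hψ'.eq_zero hy1]
  rw [key (ψ' := pd i fun y => η y * φ y) ?_ (hm.pd i) hf, key (ψ' := fun y => η y * φ y) ?_ hm hv]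
  · exact h _ hm
  · intro y hy
    by_cases hy' : y ∈ tsupport φ
    · rw [(h1' y ⟨hy, hy'⟩).self_of_nhds, one_mul]
    · rw [image_eq_zero_of_notMem_tsupport hy', mul_zero]
  · intro y hy
    rw [hη.pd_mul hΩ hφ.1.contDiffOn]
    by_cases hy' : y ∈ tsupport φ
    · have e := h1' y ⟨hy, hy'⟩
      have e' : pd i η y = 0 := by simp [pd, e.fderiv_eq]
      rw [e', e.self_of_nhds]; simp
    · rw [image_eq_zero_of_notMem_tsupport hy', pd_eq_zero hy']; simp

end TestFunctions


/-! ### Quantitative Sobolev bounds through iterated first weak derivatives. -/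

section SobolevBounds

variable {m : ℕ} {𝕜 : Type*} [RCLike 𝕜] {Ω Ω' : Set (Eucl m)} {f g v : Eucl m → 𝕜}

/-- `f` is measurable and its `L²`-norm on `Ω` is at most `R`. -/
def L2Bound (Ω : Set (Eucl m)) (f : Eucl m → 𝕜) (R : ℝ≥0) : Prop :=
  AEStronglyMeasurable f (volume.restrict Ω) ∧ eLpNorm f 2 (volume.restrict Ω) ≤ R

/-- `f` has iterated weak derivatives on `Ω` up to order `k`, with `L²`-norms at most `R`. -/
def SobBound (Ω : Set (Eucl m)) (R : ℝ≥0) : ℕ → (Eucl m → 𝕜) → Prop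
  | 0, f => L2Bound Ω f R
  | k + 1, f => L2Bound Ω f R ∧ ∀ i, ∃ v, WeakPD Ω i f v ∧ SobBound Ω R k v

/-- The iterated partial derivatives of `a` up to order `k` are bounded by `C` on `Ω`. -/
def DerivBound (Ω : Set (Eucl m)) (C : ℝ≥0) : ℕ → (Eucl m → ℝ) → Prop
  | 0, a => ∀ y ∈ Ω, |a y| ≤ C
  | k + 1, a => (∀ y ∈ Ω, |a y| ≤ C) ∧ ∀ i, DerivBound Ω C k (pd i a)

variable {R R' C : ℝ≥0} {k : ℕ}

theorem L2Bound.memLp (h : L2Bound Ω f R) : MemLp f 2 (volume.restrict Ω) :=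
  ⟨h.1, h.2.trans_lt ENNReal.coe_lt_top⟩

theorem L2Bound.locInt (h : L2Bound Ω f R) : LocallyIntegrableOn f Ω :=
  locallyIntegrableOn_of_locallyIntegrable_restrict (h.memLp.locallyIntegrable (by norm_num))

theorem L2Bound.mono (h : L2Bound Ω f R) (hΩ : Ω' ⊆ Ω) (hR : R ≤ R') : L2Bound Ω' f R' :=
  ⟨h.1.mono_set hΩ, (eLpNorm_mono_measure _ (Measure.restrict_mono hΩ le_rfl)).trans
    (h.2.trans (by exact_mod_cast hR))⟩

theorem L2Bound.congr (h : L2Bound Ω f R) (hfg : f =ᵐ[volume.restrict Ω] g) : L2Bound Ω g R :=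
  ⟨h.1.congr hfg, by rw [← eLpNorm_congr_ae hfg]; exact h.2⟩

theorem L2Bound.add (hf : L2Bound Ω f R) (hg : L2Bound Ω g R') : L2Bound Ω (f + g) (R + R') :=
  ⟨hf.1.add hg.1, (eLpNorm_add_le hf.1 hg.1 (by norm_num)).trans (by
    push_cast; exact add_le_add hf.2 hg.2)⟩

theorem L2Bound.smul (hΩ : IsOpen Ω) {a : Eucl m → ℝ} (ha : ContinuousOn a Ω)
    (hC : ∀ y ∈ Ω, |a y| ≤ C) (hf : L2Bound Ω f R) :
    L2Bound Ω (fun y => a y • f y) (C * R) := by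
  refine ⟨(ha.aestronglyMeasurable hΩ.measurableSet).smul hf.1, ?_⟩
  have := eLpNorm_le_nnreal_smul_eLpNorm_of_ae_le_mul (μ := volume.restrict Ω) (c := C)
    (f := fun y => a y • f y) (g := f) ?_ 2
  · refine this.trans ?_
    rw [ENNReal.smul_def, smul_eq_mul, ENNReal.coe_mul]
    gcongr
    exact hf.2
  · refine (ae_restrict_iff' hΩ.measurableSet).2 (Eventually.of_forall fun y hy => ?_)
    rw [nnnorm_smul]
    gcongr
    exact_mod_cast hC y hy

theorem SobBound.l2Bound (h : SobBound Ω R k f) : L2Bound Ω f R := by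
  cases k with
  | zero => exact h
  | succ k => exact h.1

theorem SobBound.locInt (h : SobBound Ω R k f) : LocallyIntegrableOn f Ω := h.l2Bound.locInt

theorem SobBound.mono (h : SobBound Ω R k f) (hΩ : Ω' ⊆ Ω) (hR : R ≤ R') :
    SobBound Ω' R' k f := by
  induction k generalizing f with
  | zero => exact L2Bound.mono h hΩ hR
  | succ k ih =>
    refine ⟨h.1.mono hΩ hR, fun i => ?_⟩
    obtain ⟨v, hv, hv'⟩ := h.2 i
    exact ⟨v, hv.mono hΩ, ih hv'⟩

theorem SobBound.of_succ (h : SobBound Ω R (k + 1) f) : SobBound Ω R k f := by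
  induction k generalizing f with
  | zero => exact h.1
  | succ k ih =>
    refine ⟨h.1, fun i => ?_⟩
    obtain ⟨v, hv, hv'⟩ := h.2 i
    exact ⟨v, hv, ih hv'⟩

theorem SobBound.congr (hΩ : IsOpen Ω) (h : SobBound Ω R k f)
    (hfg : f =ᵐ[volume.restrict Ω] g) : SobBound Ω R k g := by
  cases k with
  | zero => exact L2Bound.congr h hfg
  | succ k =>
    refine ⟨h.1.congr hfg, fun i => ?_⟩
    obtain ⟨v, hv, hv'⟩ := h.2 i
    exact ⟨v, hv.congr hΩ hfg (Filter.EventuallyEq.refl _ v), hv'⟩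

theorem SobBound.add (hΩ : IsOpen Ω) (hf : SobBound Ω R k f) (hg : SobBound Ω R' k g) :
    SobBound Ω (R + R') k (f + g) := by
  induction k generalizing f g with
  | zero => exact L2Bound.add hf hg
  | succ k ih =>
    refine ⟨hf.1.add hg.1, fun i => ?_⟩
    obtain ⟨v, hv, hv'⟩ := hf.2 i
    obtain ⟨w, hw, hw'⟩ := hg.2 i
    exact ⟨v + w, hv.add hΩ hf.locInt hv'.locInt hg.locInt hw'.locInt hw, ih hv' hw'⟩

theorem sobBound_zero : SobBound Ω R k (0 : Eucl m → 𝕜) := by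
  induction k with
  | zero => exact ⟨aestronglyMeasurable_zero, by simp⟩
  | succ k ih => exact ⟨⟨aestronglyMeasurable_zero, by simp⟩, fun i => ⟨0, weakPD_zero, ih⟩⟩

theorem SobBound.sum (hΩ : IsOpen Ω) {ι : Type*} (s : Finset ι) {F : ι → Eucl m → 𝕜}
    {r : ι → ℝ≥0} (h : ∀ i ∈ s, SobBound Ω (r i) k (F i)) :
    SobBound Ω (∑ i ∈ s, r i) k (∑ i ∈ s, F i) := by
  classical
  induction s using Finset.induction_on with
  | empty => simpa using sobBound_zero
  | insert a s ha ih =>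
    rw [Finset.sum_insert ha, Finset.sum_insert ha]
    exact (h a (Finset.mem_insert_self a s)).add hΩ
      (ih fun i hi => h i (Finset.mem_insert_of_mem hi))

theorem DerivBound.bound {a : Eucl m → ℝ} (h : DerivBound Ω C k a) : ∀ y ∈ Ω, |a y| ≤ C := by
  cases k with
  | zero => exact h
  | succ k => exact h.1

theorem DerivBound.of_succ {a : Eucl m → ℝ} (h : DerivBound Ω C (k + 1) a) :
    DerivBound Ω C k a := by
  induction k generalizing a with
  | zero => exact h.1
  | succ k ih => exact ⟨h.1, fun i => ih (h.2 i)⟩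

theorem DerivBound.mono {a : Eucl m → ℝ} (h : DerivBound Ω C k a) (hΩ : Ω' ⊆ Ω) :
    DerivBound Ω' C k a := by
  induction k generalizing a with
  | zero => exact fun y hy => h y (hΩ hy)
  | succ k ih => exact ⟨fun y hy => h.1 y (hΩ hy), fun i => ih (h.2 i)⟩

theorem SobBound.smul (hΩ : IsOpen Ω) {a : Eucl m → ℝ} (ha : ContDiffOn ℝ ∞ a Ω)
    (hC : DerivBound Ω C k a) (hf : SobBound Ω R k f) :
    SobBound Ω (2 ^ k * C * R) k (fun y => a y • f y) := by
  induction k generalizing a f with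
  | zero =>
    rw [pow_zero, one_mul]
    exact L2Bound.smul hΩ ha.continuousOn hC hf
  | succ k ih =>
    have hle : C * R ≤ 2 ^ (k + 1) * C * R := by
      rw [mul_assoc]
      exact le_mul_of_one_le_left zero_le (one_le_pow₀ one_le_two)
    refine ⟨(L2Bound.smul hΩ ha.continuousOn hC.1 hf.1).mono subset_rfl hle, fun i => ?_⟩
    obtain ⟨v, hv, hv'⟩ := hf.2 i
    refine ⟨_, hv.smul hΩ ha hf.locInt hv'.locInt, ?_⟩
    -- The two Leibniz terms obey the same bound, so each order of differentiation doubles the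
    -- constant.
    have := (ih ha hC.of_succ hv').add hΩ (ih (contDiffOn_pd hΩ ha i) (hC.2 i) hf.of_succ)
    rwa [← two_mul, ← mul_assoc, ← mul_assoc, ← pow_succ'] at this

theorem L2Bound.indicator (hΩ : MeasurableSet Ω) (hΩΩ' : Ω ⊆ Ω') (h : L2Bound Ω f R) :
    L2Bound Ω' (Ω.indicator f) R := by
  refine ⟨(aestronglyMeasurable_indicator_iff hΩ).2 ?_, ?_⟩
  · rw [Measure.restrict_restrict hΩ, inter_eq_left.2 hΩΩ']
    exact h.1
  · rw [eLpNorm_indicator_eq_eLpNorm_restrict hΩ, Measure.restrict_restrict hΩ,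
      inter_eq_left.2 hΩΩ']
    exact h.2

/-- Extension by zero. -/
theorem SobBound.indicator (hΩ : IsOpen Ω) (hΩΩ' : Ω ⊆ Ω') {K : Set (Eucl m)}
    (hK : IsClosed K) (hKΩ : K ∩ Ω' ⊆ Ω) (h : SobBound Ω R k f)
    (hf : f =ᵐ[volume.restrict (Ω \ K)] 0) : SobBound Ω' R k (Ω.indicator f) := by
  induction k generalizing f with
  | zero => exact L2Bound.indicator hΩ.measurableSet hΩΩ' h
  | succ k ih =>
    refine ⟨h.1.indicator hΩ.measurableSet hΩΩ', fun i => ?_⟩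
    obtain ⟨v, hv, hv'⟩ := h.2 i
    -- The derivative also vanishes off `K`, so the induction hypothesis applies to it.
    have hv0 : v =ᵐ[volume.restrict (Ω \ K)] 0 :=
      (hv.mono sdiff_subset).ae_eq_zero (hΩ.sdiff hK) (hv'.locInt.mono_set sdiff_subset) hf
    exact ⟨_, hv.indicator hΩ hK hKΩ hf hv0, ih hv' hv0⟩

end SobolevBounds


/-! ### Comparison with the Sobolev norm. -/

section Comparison

variable {m : ℕ} {𝕜 : Type*} [RCLike 𝕜] {Ω : Set (Eucl m)} {f v : Eucl m → 𝕜}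
  {R C : ℝ≥0} {k : ℕ}

theorem partialWithin_clm_comp {F G : Type*} [NormedAddCommGroup F] [NormedSpace ℝ F]
    [NormedAddCommGroup G] [NormedSpace ℝ G] (L : F →L[ℝ] G) (hΩ : IsOpen Ω) {g : Eucl m → F}
    (hg : ContDiffOn ℝ ∞ g Ω) {j : ℕ} (κ : Fin j → Fin m) {y : Eucl m} (hy : y ∈ Ω) :
    partialWithin κ (fun z => L (g z)) Ω y = L (partialWithin κ g Ω y) := by
  have := L.iteratedFDerivWithin_comp_left (hg y hy) hΩ.uniqueDiffOn hy
    (i := j) (by exact_mod_cast le_top)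
  simp only [partialWithin]
  rw [show (fun z => L (g z)) = L ∘ g from rfl, this]
  rfl

/-- An appended index is the innermost derivative, a prepended one (`partialWithin_cons`) the
outermost. Each direction of the comparison uses the convention that fits, so the symmetry of higher
derivatives is never needed. -/
theorem partialWithin_snoc (hΩ : IsOpen Ω) {a : Eucl m → ℝ} (ha : ContDiffOn ℝ ∞ a Ω) {j : ℕ}
    (κ : Fin j → Fin m) (i : Fin m) {y : Eucl m} (hy : y ∈ Ω) :
    partialWithin (Fin.snoc κ i : Fin (j + 1) → Fin m) a Ω y = partialWithin κ (pd i a) Ω y := by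
  have hd : ContDiffOn ℝ ∞ (fderiv ℝ a) Ω := ha.fderiv_of_isOpen hΩ (by simp)
  have h2 := partialWithin_clm_comp (ContinuousLinearMap.apply ℝ ℝ (stdVec i)) hΩ hd κ hy
  change _ = partialWithin κ (fun z => ContinuousLinearMap.apply ℝ ℝ (stdVec i) (fderiv ℝ a z)) Ω y
  rw [h2]
  simp only [partialWithin]
  rw [iteratedFDerivWithin_succ_apply_right hΩ.uniqueDiffOn hy]
  have e : iteratedFDerivWithin ℝ j (fun z => fderivWithin ℝ a Ω z) Ω y =
      iteratedFDerivWithin ℝ j (fderiv ℝ a) Ω y :=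
    iteratedFDerivWithin_congr (fun z hz => fderivWithin_of_isOpen hΩ hz) hy j
  rw [e]
  simp [Fin.init_def]

theorem partialWithin_cons {a : Eucl m → ℝ} (ha : ContDiff ℝ ∞ a) {j : ℕ}
    (κ : Fin j → Fin m) (i : Fin m) (y : Eucl m) :
    partialWithin (Fin.cons i κ : Fin (j + 1) → Fin m) a univ y =
      pd i (partialWithin κ a univ) y := by
  have hd : DifferentiableAt ℝ (iteratedFDeriv ℝ j a) y :=
    (ha.differentiable_iteratedFDeriv (by exact_mod_cast WithTop.coe_lt_top _)) y
  have e : partialWithin κ a univ = fun z => ContinuousMultilinearMap.apply ℝ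
      (fun _ : Fin j => Eucl m) ℝ (fun i => stdVec (κ i)) (iteratedFDeriv ℝ j a z) := by
    funext z
    simp [partialWithin, iteratedFDerivWithin_univ]
  rw [e]
  simp only [pd, partialWithin, iteratedFDerivWithin_univ]
  rw [iteratedFDeriv_succ_apply_left]
  have := ((ContinuousMultilinearMap.apply ℝ (fun _ : Fin j => Eucl m) ℝ
    (fun i => stdVec (κ i))).hasFDerivAt.comp y hd.hasFDerivAt).fderiv
  simp only [Function.comp_def] at this
  rw [this]
  simp [Fin.tail_def]

theorem partialWithin_elim0 (κ : Fin 0 → Fin m) (a : Eucl m → ℝ) (s : Set (Eucl m)) :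
    partialWithin κ a s = a := by
  funext y
  simp [partialWithin]

theorem IsTest.partialWithin {φ : Eucl m → ℝ} (h : IsTest Ω φ) {j : ℕ} (κ : Fin j → Fin m) :
    IsTest Ω (partialWithin κ φ univ) := by
  induction j with
  | zero => rwa [partialWithin_elim0]
  | succ j ih =>
    have : BoundedGeometry.partialWithin κ φ univ =
        BoundedGeometry.pd (κ 0) (BoundedGeometry.partialWithin (Fin.tail κ) φ univ) := by
      funext y
      rw [← partialWithin_cons h.1, Fin.cons_self_tail]
    rw [this]
    exact (ih _).pd _

theorem derivBound_of_partialWithin (hΩ : IsOpen Ω) {a : Eucl m → ℝ} (ha : ContDiffOn ℝ ∞ a Ω)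
    (h : ∀ j ≤ k, ∀ κ : Fin j → Fin m, ∀ y ∈ Ω, |partialWithin κ a Ω y| ≤ C) :
    DerivBound Ω C k a := by
  have h0 : ∀ y ∈ Ω, |a y| ≤ C := fun y hy => by
    simpa [partialWithin_elim0] using h 0 zero_le Fin.elim0 y hy
  induction k generalizing a with
  | zero => exact h0
  | succ k ih =>
    have h1 : ∀ i, ∀ j ≤ k, ∀ κ : Fin j → Fin m, ∀ y ∈ Ω, |partialWithin κ (pd i a) Ω y| ≤ C := by
      intro i j hj κ y hy
      rw [← partialWithin_snoc hΩ ha κ i hy]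
      exact h (j + 1) (by lia) _ y hy
    exact ⟨h0, fun i => ih (contDiffOn_pd hΩ ha i) (h1 i) fun y hy => by
      simpa [partialWithin_elim0] using h1 i 0 zero_le Fin.elim0 y hy⟩

theorem HasWeakPartial.ae_eq {j : ℕ} {κ : Fin j → Fin m} {w : Eucl m → 𝕜}
    (hv : HasWeakPartial Ω κ f v) (hw : HasWeakPartial Ω κ f w) :
    v =ᵐ[volume.restrict (interior Ω)] w := by
  refine ae_eq_of_integral_isTest isOpen_interior hv.2 hw.2 fun φ hφ => ?_
  have := (hv.3 φ hφ.1 hφ.2 hφ.3).symm.trans (hw.3 φ hφ.1 hφ.2 hφ.3)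
  rcases neg_one_pow_eq_or ℝ j with h | h <;> simpa [h] using this

/-- A finite sum has finite summands, so none of the infima is over an empty family. By uniqueness
all members of a family have the same norm, hence any of them realizes the infimum. -/
theorem exists_hasWeakPartial (h : sobolevNormSq k Ω f ≤ (R : ℝ≥0∞) ^ 2) {j : ℕ} (hj : j ≤ k)
    (κ : Fin j → Fin m) : ∃ v, HasWeakPartial Ω κ f v ∧ L2Bound (interior Ω) v R := by
  have h1 : ⨅ v : {v : Eucl m → 𝕜 // HasWeakPartial Ω κ f v},
      eLpNorm v.1 2 (volume.restrict (interior Ω)) ^ 2 ≤ (R : ℝ≥0∞) ^ 2 := by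
    refine le_trans ?_ h
    refine le_trans ?_ (Finset.single_le_sum (fun _ _ => zero_le)
      (Finset.mem_range.2 (Nat.lt_succ_of_le hj)))
    exact Finset.single_le_sum (f := fun κ : Fin j → Fin m =>
      ⨅ v : {v : Eucl m → 𝕜 // HasWeakPartial Ω κ f v},
        eLpNorm v.1 2 (volume.restrict (interior Ω)) ^ 2) (fun _ _ => zero_le) (Finset.mem_univ κ)
  obtain ⟨v, hv⟩ : ∃ v, HasWeakPartial Ω κ f v := by
    by_contra hne
    have : IsEmpty {v : Eucl m → 𝕜 // HasWeakPartial Ω κ f v} := ⟨fun v => hne ⟨v.1, v.2⟩⟩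
    rw [iInf_of_empty, top_le_iff] at h1
    exact ENNReal.pow_ne_top ENNReal.coe_ne_top h1
  refine ⟨v, hv, hv.2.aestronglyMeasurable, ?_⟩
  have h2 : eLpNorm v 2 (volume.restrict (interior Ω)) ^ 2 ≤ (R : ℝ≥0∞) ^ 2 := by
    refine le_trans (le_iInf fun w => ?_) h1
    rw [eLpNorm_congr_ae (hv.ae_eq w.2)]
  exact (ENNReal.pow_le_pow_left_iff two_ne_zero).1 h2

theorem sobBound_of_sobolevNormSq_le (h : sobolevNormSq k Ω f ≤ (R : ℝ≥0∞) ^ 2) :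
    SobBound (interior Ω) R k f := by
  have main : ∀ l j, j + l = k → ∀ (κ : Fin j → Fin m) v, HasWeakPartial Ω κ f v →
      L2Bound (interior Ω) v R → SobBound (interior Ω) R l v := by
    intro l
    induction l with
    | zero => exact fun j _ κ v _ hv => hv
    | succ l ih =>
      intro j hj κ v hv hv'
      refine ⟨hv', fun i => ?_⟩
      -- With `i` appended, the test function is differentiated as `∂_κ (∂_i φ)`. Comparison with
      -- the defining identity of `v` for the test function `∂_i φ` shows that `w` is the first weak
      -- derivative `∂_i v`.
      obtain ⟨w, hw, hw'⟩ := exists_hasWeakPartial h (j := j + 1) (by lia)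
        (Fin.snoc κ i : Fin (j + 1) → Fin m)
      refine ⟨w, fun φ hφ => ?_, ih (j + 1) (by lia) _ w hw hw'⟩
      have e1 := hv.3 _ (hφ.pd i).1 (hφ.pd i).2 (hφ.pd i).3
      have e2 := hw.3 _ hφ.1 hφ.2 hφ.3
      simp only [partialWithin_snoc isOpen_univ hφ.1.contDiffOn κ i (mem_univ _)] at e2
      rw [e2, pow_succ] at e1
      rcases neg_one_pow_eq_or ℝ j with h | h <;> simpa [h, eq_comm, neg_eq_iff_eq_neg] using e1
  -- The weak derivative of order zero equals `f` almost everywhere; it is the one that comes with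
  -- an `L²`-bound.
  obtain ⟨v, hv, hv'⟩ := exists_hasWeakPartial h zero_le (Fin.elim0 : Fin 0 → Fin m)
  refine (main k 0 (zero_add k) _ v hv hv').congr isOpen_interior ?_
  refine ae_eq_of_integral_isTest isOpen_interior hv.2 hv.1 fun φ hφ => ?_
  simpa [partialWithin_elim0, eq_comm] using hv.3 φ hφ.1 hφ.2 hφ.3

theorem SobBound.of_le {l : ℕ} (h : SobBound Ω R k f) (hl : l ≤ k) : SobBound Ω R l f := by
  induction hl with
  | refl => exact h
  | step _ ih => exact ih h.of_succ

theorem SobBound.exists_hasWeakPartial {j : ℕ} (h : SobBound (interior Ω) R j f)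
    (κ : Fin j → Fin m) : ∃ v, HasWeakPartial Ω κ f v ∧ L2Bound (interior Ω) v R := by
  induction j generalizing f with
  | zero =>
    exact ⟨f, ⟨h.locInt, h.locInt, fun φ _ _ _ => by simp [partialWithin_elim0]⟩, h⟩
  | succ j ih =>
    obtain ⟨w, hw, hw'⟩ := h.2 (κ 0)
    obtain ⟨v, hv, hv'⟩ := ih hw' (Fin.tail κ)
    refine ⟨v, ⟨h.locInt, hv.2, fun φ h1 h2 h3 => ?_⟩, hv'⟩
    have hφ : IsTest (interior Ω) φ := ⟨h1, h2, h3⟩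
    have e := hw _ (hφ.partialWithin (Fin.tail κ))
    simp only [← partialWithin_cons h1, Fin.cons_self_tail] at e
    rw [e, hv.3 φ h1 h2 h3, pow_succ]
    simp

/-- There are `m ^ j` index tuples of order `j`, and each derivative contributes at most `R ^ 2`. -/
theorem SobBound.sobolevNormSq_le (h : SobBound (interior Ω) R k f) :
    sobolevNormSq k Ω f ≤ (∑ j ∈ Finset.range (k + 1), (m : ℝ≥0∞) ^ j) * (R : ℝ≥0∞) ^ 2 := by
  have key : ∀ j ∈ Finset.range (k + 1), ∀ κ : Fin j → Fin m,
      ⨅ v : {v : Eucl m → 𝕜 // HasWeakPartial Ω κ f v},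
        eLpNorm v.1 2 (volume.restrict (interior Ω)) ^ 2 ≤ (R : ℝ≥0∞) ^ 2 := by
    intro j hj κ
    have hj' : j ≤ k := by rw [Finset.mem_range] at hj; lia
    obtain ⟨v, hv, hv'⟩ := (h.of_le hj').exists_hasWeakPartial κ
    refine (iInf_le _ ⟨v, hv⟩).trans ?_
    exact pow_le_pow_left' hv'.2 2
  rw [Finset.sum_mul]
  refine Finset.sum_le_sum fun j hj => ?_
  refine (Finset.sum_le_sum fun κ _ => key j hj κ).trans_eq ?_
  rw [Finset.sum_const, Finset.card_univ, Fintype.card_fun, Fintype.card_fin, Fintype.card_fin,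
    nsmul_eq_mul, Nat.cast_pow]

end Comparison


/-! ### Change of variables and the chain rule for weak derivatives. -/

section ChangeOfVariables

variable {m : ℕ} {𝕜 : Type*} [RCLike 𝕜]

/-- The Jacobian determinant. -/
noncomputable def jac (Θ : Eucl m → Eucl m) (z : Eucl m) : ℝ :=
  (Matrix.of fun i j => pd j (fun w => Θ w i) z).det

theorem fderiv_apply_coord {Θ : Eucl m → Eucl m} {z : Eucl m} (h : DifferentiableAt ℝ Θ z)
    (v : Eucl m) (i : Fin m) : fderiv ℝ (fun w => Θ w i) z v = fderiv ℝ Θ z v i := by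
  have := ((EuclideanSpace.proj (𝕜 := ℝ) i).hasFDerivAt.comp z h.hasFDerivAt).fderiv
  change fderiv ℝ (fun w => Θ w i) z = _ at this
  rw [this]
  rfl

theorem det_fderiv_eq_jac {Θ : Eucl m → Eucl m} {z : Eucl m} (h : DifferentiableAt ℝ Θ z) :
    (fderiv ℝ Θ z).det = jac Θ z := by
  rw [ContinuousLinearMap.det, ← LinearMap.det_toMatrix (EuclideanSpace.basisFun (Fin m) ℝ).toBasis,
    jac]
  congr 1
  ext i j
  rw [LinearMap.toMatrix_apply]
  simp [pd, fderiv_apply_coord h]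

theorem contDiffOn_coord {Ω : Set (Eucl m)} {Θ : Eucl m → Eucl m} (h : ContDiffOn ℝ ∞ Θ Ω)
    (i : Fin m) : ContDiffOn ℝ ∞ (fun w => Θ w i) Ω :=
  (EuclideanSpace.proj (𝕜 := ℝ) i).contDiff.comp_contDiffOn h

theorem contDiffOn_jac {Ω : Set (Eucl m)} (hΩ : IsOpen Ω) {Θ : Eucl m → Eucl m}
    (h : ContDiffOn ℝ ∞ Θ Ω) : ContDiffOn ℝ ∞ (jac Θ) Ω := by
  have : jac Θ = fun z => ∑ σ : Equiv.Perm (Fin m), ((Equiv.Perm.sign σ : ℤ) : ℝ) *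
      ∏ i, pd i (fun w => Θ w (σ i)) z := by
    funext z
    simp [jac, Matrix.det_apply']
  rw [this]
  refine ContDiffOn.sum fun σ _ => contDiffOn_const.mul ?_
  exact contDiffOn_prod fun i _ => contDiffOn_pd hΩ (contDiffOn_coord h _) i

/-- The determinant expands into `m!` products of `m` entries. This turns derivative bounds for
coordinate changes into volume bounds. -/
theorem abs_jac_le {Θ : Eucl m → Eucl m} {z : Eucl m} {C : ℝ}
    (h : ∀ i l, |pd i (fun w => Θ w l) z| ≤ C) : |jac Θ z| ≤ m.factorial * C ^ m := by
  have := Matrix.det_le (abv := AbsoluteValue.abs)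
    (A := Matrix.of fun i j => pd j (fun w => Θ w i) z) (x := C) (fun i j => h j i)
  simpa [jac, nsmul_eq_mul] using this

/-- `Ψ : Ω₁ → Ω₂` and `Θ : Ω₂ → Ω₁` are mutually inverse diffeomorphisms of open sets. -/
structure IsDiffeo (Ω₁ Ω₂ : Set (Eucl m)) (Ψ Θ : Eucl m → Eucl m) : Prop where
  open₁ : IsOpen Ω₁
  open₂ : IsOpen Ω₂
  smooth : ContDiffOn ℝ ∞ Ψ Ω₁
  smooth_inv : ContDiffOn ℝ ∞ Θ Ω₂
  mapsTo : MapsTo Ψ Ω₁ Ω₂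
  mapsTo_inv : MapsTo Θ Ω₂ Ω₁
  left_inv : ∀ y ∈ Ω₁, Θ (Ψ y) = y
  right_inv : ∀ z ∈ Ω₂, Ψ (Θ z) = z

namespace IsDiffeo

variable {Ω₁ Ω₂ : Set (Eucl m)} {Ψ Θ : Eucl m → Eucl m}

theorem symm (h : IsDiffeo Ω₁ Ω₂ Ψ Θ) : IsDiffeo Ω₂ Ω₁ Θ Ψ :=
  ⟨h.2, h.1, h.4, h.3, h.6, h.5, h.8, h.7⟩

theorem differentiableAt (h : IsDiffeo Ω₁ Ω₂ Ψ Θ) {y : Eucl m} (hy : y ∈ Ω₁) :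
    DifferentiableAt ℝ Ψ y :=
  (h.smooth.contDiffAt (h.open₁.mem_nhds hy)).differentiableAt (by simp)

theorem image_inv (h : IsDiffeo Ω₁ Ω₂ Ψ Θ) (s : Set (Eucl m)) :
    Θ '' (Ω₂ ∩ s) = Ω₁ ∩ Ψ ⁻¹' s := by
  ext y
  constructor
  · rintro ⟨z, ⟨hz, hzs⟩, rfl⟩
    exact ⟨h.mapsTo_inv hz, by rwa [mem_preimage, h.right_inv z hz]⟩
  · rintro ⟨hy, hys⟩
    exact ⟨Ψ y, ⟨h.mapsTo hy, hys⟩, h.left_inv y hy⟩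

/-- The Jacobians of mutually inverse maps have product one. Nonvanishing makes `|jac Θ|` smooth,
hence an admissible factor of test functions. -/
theorem jac_ne_zero (h : IsDiffeo Ω₁ Ω₂ Ψ Θ) {z : Eucl m} (hz : z ∈ Ω₂) : jac Θ z ≠ 0 := by
  rw [← det_fderiv_eq_jac (h.symm.differentiableAt hz)]
  have h1 := (h.differentiableAt (h.mapsTo_inv hz)).hasFDerivAt.comp z
    (h.symm.differentiableAt hz).hasFDerivAt
  have h2 : HasFDerivAt (Ψ ∘ Θ) (ContinuousLinearMap.id ℝ (Eucl m)) z := by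
    refine (hasFDerivAt_id z).congr_of_eventuallyEq ?_
    filter_upwards [h.open₂.mem_nhds hz] with w hw
    exact h.right_inv w hw
  have e := congrArg ContinuousLinearMap.det (h1.unique h2)
  rw [ContinuousLinearMap.det, ContinuousLinearMap.det, ContinuousLinearMap.toLinearMap_comp,
    LinearMap.det_comp, ContinuousLinearMap.coe_id, LinearMap.det_id] at e
  exact right_ne_zero_of_mul (e.trans_ne one_ne_zero)

theorem contDiffOn_abs_jac (h : IsDiffeo Ω₁ Ω₂ Ψ Θ) :
    ContDiffOn ℝ ∞ (fun z => |jac Θ z|) Ω₂ :=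
  (contDiffOn_jac h.open₂ h.smooth_inv).abs fun _ hz => h.jac_ne_zero hz

theorem integral_eq (h : IsDiffeo Ω₁ Ω₂ Ψ Θ) {g : Eucl m → 𝕜} {G : Eucl m → 𝕜}
    (hg : ∀ y ∉ Ω₁, g y = 0) (hG : ∀ z ∉ Ω₂, G z = 0)
    (hgG : ∀ z ∈ Ω₂, G z = |jac Θ z| • g (Θ z)) : ∫ y, g y = ∫ z, G z := by
  rw [← setIntegral_eq_integral_of_forall_compl_eq_zero hg,
    ← setIntegral_eq_integral_of_forall_compl_eq_zero hG]
  have := integral_image_eq_integral_abs_det_fderiv_smul volume h.open₂.measurableSet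
    (fun z hz => (h.symm.differentiableAt hz).hasFDerivAt.hasFDerivWithinAt)
    (fun a ha b hb hab => by rw [← h.right_inv a ha, hab, h.right_inv b hb]) g
  rw [← inter_univ Ω₂, h.image_inv, preimage_univ, inter_univ, inter_univ] at this
  rw [this]
  refine setIntegral_congr_fun h.open₂.measurableSet fun z hz => ?_
  simp only [hgG z hz, det_fderiv_eq_jac (h.symm.differentiableAt hz)]

theorem isTest_comp (h : IsDiffeo Ω₁ Ω₂ Ψ Θ) {φ : Eucl m → ℝ} (hφ : IsTest Ω₁ φ) :
    IsTest Ω₂ (Ω₂.indicator (φ ∘ Θ)) := by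
  refine isTest_of_contDiffOn h.open₂
    (hφ.2.image_of_continuousOn (h.smooth.continuousOn.mono hφ.3))
    ((image_mono hφ.3).trans h.mapsTo.image_subset) ?_ ?_
  · exact (hφ.1.comp_contDiffOn h.smooth_inv).congr fun z hz => indicator_of_mem hz _
  · intro z hz
    by_cases hzΩ : z ∈ Ω₂
    · rw [indicator_of_mem hzΩ, Function.comp_apply]
      refine image_eq_zero_of_notMem_tsupport fun h' => hz ⟨Θ z, h', h.right_inv z hzΩ⟩
    · rw [indicator_of_notMem hzΩ]

theorem pd_comp (h : IsDiffeo Ω₁ Ω₂ Ψ Θ) {φ : Eucl m → ℝ} (hφ : IsTest Ω₁ φ) (i : Fin m)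
    {z : Eucl m} (hz : z ∈ Ω₂) :
    pd i φ (Θ z) = ∑ l, pd l (Ω₂.indicator (φ ∘ Θ)) z * pd i (fun y => Ψ y l) (Θ z) := by
  have hy := h.mapsTo_inv hz
  have e : φ =ᶠ[𝓝 (Θ z)] Ω₂.indicator (φ ∘ Θ) ∘ Ψ := by
    filter_upwards [h.open₁.mem_nhds hy] with y hy
    simp [h.mapsTo hy, h.left_inv y hy]
  have hd := ((h.isTest_comp hφ).1.differentiable (by simp) (Ψ (Θ z))).hasFDerivAt.comp (Θ z)
    (h.differentiableAt hy).hasFDerivAt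
  rw [h.right_inv z hz] at hd
  simp only [pd]
  rw [e.fderiv_eq, hd.fderiv]
  simp only [fderiv_apply_coord (h.differentiableAt hy)]
  rw [ContinuousLinearMap.comp_apply]
  set v := fderiv ℝ Ψ (Θ z) (stdVec i)
  have hv : v = ∑ l, v l • (stdVec l : Eucl m) := by
    have := (EuclideanSpace.basisFun (Fin m) ℝ).sum_repr v
    simpa using this.symm
  conv_lhs => rw [hv]
  simp [mul_comm]

/-- The coefficients in the Piola transform of the vector field `∂_i`. -/
noncomputable def piola (Ψ Θ : Eucl m → Eucl m) (i l : Fin m) (z : Eucl m) : ℝ :=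
  pd i (fun y => Ψ y l) (Θ z) * |jac Θ z|

theorem contDiffOn_piola (h : IsDiffeo Ω₁ Ω₂ Ψ Θ) (i l : Fin m) :
    ContDiffOn ℝ ∞ (piola Ψ Θ i l) Ω₂ :=
  ((contDiffOn_pd h.open₁ (contDiffOn_coord h.smooth l) i).comp h.smooth_inv h.mapsTo_inv).mul
    h.contDiffOn_abs_jac

/-- After the change of variables, `∂_i φ` becomes `∑ P_l ∂_l ψ` with `ψ = φ ∘ Θ` and `P` the Piola
coefficients. Writing this as `div (ψ P) - ψ div P` exposes complete derivatives of the test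
functions `ψ P_l`. -/
theorem integral_pd_smul_comp (h : IsDiffeo Ω₁ Ω₂ Ψ Θ) {φ : Eucl m → ℝ} (hφ : IsTest Ω₁ φ)
    (i : Fin m) {f : Eucl m → 𝕜} (hf : LocallyIntegrableOn f Ω₂) :
    ∫ y, pd i φ y • f (Ψ y) =
      (∑ l, ∫ z, pd l (fun z => Ω₂.indicator (φ ∘ Θ) z * piola Ψ Θ i l z) z • f z)
      - ∫ z, Ω₂.indicator (φ ∘ Θ) z • (∑ l, pd l (piola Ψ Θ i l) z) • f z := by
  have hψ := h.isTest_comp hφ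
  set ψ := Ω₂.indicator (φ ∘ Θ) with hψdef
  have hp := fun l => h.contDiffOn_piola i l
  have I1 := fun l => ((hψ.mul h.open₂ (hp l)).pd l).integrable_smul h.open₂ hf
  have I2 := fun l => (hψ.mul h.open₂ (contDiffOn_pd h.open₂ (hp l) l)).integrable_smul h.open₂ hf
  rw [h.integral_eq (G := fun z => ∑ l, (pd l ψ z * piola Ψ Θ i l z) • f z)
    (fun y hy => by rw [(hφ.pd i).eq_zero hy, zero_smul])
    (fun z hz => Finset.sum_eq_zero fun l _ => by rw [(hψ.pd l).eq_zero hz]; simp)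
    (fun z hz => by
      rw [h.pd_comp hφ i hz, h.right_inv z hz, smul_smul, ← Finset.sum_smul, Finset.mul_sum]
      congr 1
      refine Finset.sum_congr rfl fun l _ => ?_
      rw [piola, hψdef]
      ring)]
  have e : ∀ z, ∑ l, (pd l ψ z * piola Ψ Θ i l z) • f z =
      (∑ l, pd l (fun z => ψ z * piola Ψ Θ i l z) z • f z) -
        ∑ l, (ψ z * pd l (piola Ψ Θ i l) z) • f z := by
    intro z
    rw [← Finset.sum_sub_distrib]
    refine Finset.sum_congr rfl fun l _ => ?_
    rw [hψ.pd_mul h.open₂ (hp l), add_smul, add_sub_cancel_right]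
  simp only [e]
  rw [integral_sub (integrable_finsetSum _ fun l _ => I1 l)
    (integrable_finsetSum _ fun l _ => I2 l), integral_finsetSum _ fun l _ => I1 l]
  congr 1
  refine integral_congr_ae (Eventually.of_forall fun z => ?_)
  simp only [Finset.sum_smul, Finset.smul_sum, smul_smul]

/-- This is the Piola identity, obtained without differentiating determinants. Put `f = 1` in the
transformation formula: derivatives of test functions integrate to zero on both sides, so `∫ ψ div P
= 0` for every test function `ψ`. -/
theorem div_piola (h : IsDiffeo Ω₁ Ω₂ Ψ Θ) (i : Fin m) :
    (fun z => ∑ l, pd l (piola Ψ Θ i l) z) =ᵐ[volume.restrict Ω₂] 0 := by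
  have hc : ContinuousOn (fun z => ∑ l, pd l (piola Ψ Θ i l) z) Ω₂ :=
    continuousOn_finsetSum _ fun l _ =>
      (contDiffOn_pd h.open₂ (h.contDiffOn_piola i l) l).continuousOn
  refine ae_eq_of_integral_isTest (𝕜 := ℝ) h.open₂
    (hc.locallyIntegrableOn h.open₂.measurableSet) locallyIntegrableOn_zero fun ψ hψ => ?_
  have hφ := h.symm.isTest_comp hψ
  have e := h.integral_pd_smul_comp hφ i (f := fun _ => (1 : ℝ))
    (continuousOn_const.locallyIntegrableOn h.open₂.measurableSet)
  have e1 : Ω₂.indicator (Ω₁.indicator (ψ ∘ Ψ) ∘ Θ) = ψ := by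
    funext z
    by_cases hz : z ∈ Ω₂
    · simp [hz, h.mapsTo_inv hz, h.right_inv z hz]
    · simp [hz, hψ.eq_zero hz]
  have e2 := hφ.integral_pd i
  have e3 := fun l => (hψ.mul h.open₂ (h.contDiffOn_piola i l)).integral_pd l
  simp only [smul_eq_mul, mul_one, e1, e2, e3, Finset.sum_const_zero, zero_sub] at e
  simpa using e.symm

/-- The chain rule for weak derivatives. -/
theorem weakPD_comp (h : IsDiffeo Ω₁ Ω₂ Ψ Θ) {f : Eucl m → 𝕜} {v : Fin m → Eucl m → 𝕜}
    (hf : LocallyIntegrableOn f Ω₂) (hv : ∀ l, LocallyIntegrableOn (v l) Ω₂)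
    (hfv : ∀ l, WeakPD Ω₂ l f (v l)) (i : Fin m) :
    WeakPD Ω₁ i (fun y => f (Ψ y)) (∑ l, fun y => pd i (fun w => Ψ w l) y • v l (Ψ y)) := by
  intro φ hφ
  have hψ := h.isTest_comp hφ
  rw [h.integral_pd_smul_comp hφ i hf]
  -- By the Piola identity only the terms with test functions `ψ P_l` remain. The weak derivatives
  -- of `f` apply to them, and the result is transformed back to `Ω₁`.
  have z0 : ∫ z, Ω₂.indicator (φ ∘ Θ) z • (∑ l, pd l (piola Ψ Θ i l) z) • f z = 0 := by
    rw [← integral_zero (Eucl m) 𝕜]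
    refine integral_congr_ae ?_
    filter_upwards [(ae_restrict_iff' h.open₂.measurableSet).1 (h.div_piola i)] with z hz
    by_cases hzΩ : z ∈ Ω₂
    · have := hz hzΩ
      simp only [Pi.zero_apply] at this
      rw [this]; simp
    · simp [hzΩ]
  rw [z0, sub_zero, Finset.sum_congr rfl fun l _ =>
    hfv l _ (hψ.mul h.open₂ (h.contDiffOn_piola i l)), Finset.sum_neg_distrib, ← integral_finsetSum]
  · congr 1
    refine (h.integral_eq (fun y hy => ?_) (fun z hz => ?_) fun z hz => ?_).symm
    · rw [hφ.eq_zero hy, zero_smul]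
    · exact Finset.sum_eq_zero fun l _ => by rw [hψ.eq_zero hz]; simp
    · rw [Finset.sum_apply, Finset.smul_sum, Finset.smul_sum]
      refine Finset.sum_congr rfl fun l _ => ?_
      rw [indicator_of_mem hz, h.right_inv z hz, smul_smul, smul_smul, piola]
      congr 1
      simp only [Function.comp_apply]
      ring
  · exact fun l _ => (hψ.mul h.open₂ (h.contDiffOn_piola i l)).integrable_smul h.open₂ (hv l)

/-- The preimage of a set under `Ψ` is its image under `Θ`, whose volume is controlled by the
integral of `|jac Θ|`. -/
theorem map_restrict_le (h : IsDiffeo Ω₁ Ω₂ Ψ Θ) {C : ℝ≥0}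
    (hC : ∀ z ∈ Ω₂, |jac Θ z| ≤ C) :
    (volume.restrict Ω₁).map Ψ ≤ C • volume.restrict Ω₂ := by
  refine Measure.le_iff.2 fun s hs => ?_
  rw [Measure.map_apply_of_aemeasurable
    (h.smooth.continuousOn.aemeasurable h.open₁.measurableSet) hs,
    Measure.restrict_apply' h.open₁.measurableSet, inter_comm, ← h.image_inv]
  refine (addHaar_image_le_lintegral_abs_det_fderiv volume (h.open₂.measurableSet.inter hs)
    (fun z hz => (h.symm.differentiableAt hz.1).hasFDerivAt.hasFDerivWithinAt)).trans ?_
  refine (setLIntegral_mono measurable_const (g := fun _ => (C : ℝ≥0∞)) fun z hz => ?_).trans ?_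
  · rw [det_fderiv_eq_jac (h.symm.differentiableAt hz.1)]
    exact ENNReal.ofReal_le_of_le_toReal (by simpa using hC z hz.1)
  · rw [setLIntegral_const, Measure.smul_apply, Measure.restrict_apply hs, inter_comm]
    rfl

theorem l2Bound_comp (h : IsDiffeo Ω₁ Ω₂ Ψ Θ) {C R : ℝ≥0} (h1 : 1 ≤ C)
    (hC : ∀ z ∈ Ω₂, |jac Θ z| ≤ C) {f : Eucl m → 𝕜} (hf : L2Bound Ω₂ f R) :
    L2Bound Ω₁ (fun y => f (Ψ y)) (C * R) := by
  have hle := h.map_restrict_le hC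
  have hm : AEMeasurable Ψ (volume.restrict Ω₁) :=
    h.smooth.continuousOn.aemeasurable h.open₁.measurableSet
  have hf' : AEStronglyMeasurable f (C • volume.restrict Ω₂) := hf.1.smul_measure C
  have hs := hf'.mono_measure hle
  refine ⟨hs.comp_aemeasurable hm, ?_⟩
  have e := eLpNorm_map_measure (p := 2) hs hm
  rw [Function.comp_def] at e
  rw [← e]
  refine (eLpNorm_mono_measure f hle).trans ?_
  rw [eLpNorm_smul_measure_of_ne_top' (by norm_num)]
  rw [ENNReal.smul_def, smul_eq_mul, ENNReal.coe_mul]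
  refine mul_le_mul' (ENNReal.coe_le_coe.2 ?_) hf.2
  -- The `L²`-norm scales by `C ^ (1/2)`, which is at most `C` because `1 ≤ C`.
  exact (NNReal.rpow_le_rpow_of_exponent_le h1 (by norm_num)).trans_eq (NNReal.rpow_one C)

/-- Sobolev functions may be composed with diffeomorphisms. -/
theorem sobBound_comp (h : IsDiffeo Ω₁ Ω₂ Ψ Θ) {C D R : ℝ≥0} {k : ℕ} (h1 : 1 ≤ D)
    (hD : ∀ z ∈ Ω₂, |jac Θ z| ≤ D) (hC : ∀ l, DerivBound Ω₁ C (k + 1) fun y => Ψ y l)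
    {f : Eucl m → 𝕜} (hf : SobBound Ω₂ R k f) :
    SobBound Ω₁ ((1 + m * 2 ^ k * C) ^ k * (D * R)) k (fun y => f (Ψ y)) := by
  induction k generalizing f with
  | zero =>
    rw [pow_zero, one_mul]
    exact h.l2Bound_comp h1 hD hf
  | succ k ih =>
    choose v hv hv' using hf.2
    refine ⟨(h.l2Bound_comp h1 hD hf.1).mono subset_rfl ?_, fun i =>
      ⟨_, h.weakPD_comp hf.locInt (fun l => (hv' l).locInt) hv i, ?_⟩⟩
    · exact le_mul_of_one_le_left zero_le (one_le_pow₀ (le_add_of_nonneg_right zero_le))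
    -- The chain rule has `m` terms, each multiplied by a first derivative of `Ψ` at the cost of `2
    -- ^ k * C`. This is the additional factor absorbed into the next power.
    · have := SobBound.sum h.open₁ Finset.univ fun l _ =>
        (ih (fun l => (hC l).of_succ) (hv' l)).smul h.open₁
          (contDiffOn_pd h.open₁ (contDiffOn_coord h.smooth l) i) (((hC l).2 i).of_succ)
      refine this.mono subset_rfl ?_
      rw [Finset.sum_const, Finset.card_univ, Fintype.card_fin, nsmul_eq_mul, pow_succ]
      have e1 : (1 + m * 2 ^ k * C) ^ k ≤ (1 + (m : ℝ≥0) * 2 ^ (k + 1) * C) ^ k := by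
        gcongr <;> simp
      have e2 : (m : ℝ≥0) * 2 ^ k * C ≤ 1 + m * 2 ^ (k + 1) * C := by
        refine le_add_of_nonneg_of_le zero_le ?_
        gcongr <;> simp
      calc _ = (1 + (m : ℝ≥0) * 2 ^ k * C) ^ k * (m * 2 ^ k * C) * (D * R) := by ring
        _ ≤ _ := by gcongr

end IsDiffeo

end ChangeOfVariables


/-! ### Diagonal linear maps. -/

section Scaling

variable {m : ℕ}

/-- Multiplication of the coordinates by the factors `d i`. -/
noncomputable def scale (d : Fin m → ℝ) : Eucl m →L[ℝ] Eucl m :=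
  LinearMap.toContinuousLinearMap
    { toFun := fun y => WithLp.toLp 2 fun i => d i * y i
      map_add' := fun y z => by ext i; simp [mul_add]
      map_smul' := fun c y => by ext i; simp [mul_left_comm] }

@[simp]
theorem scale_apply (d : Fin m → ℝ) (y : Eucl m) (i : Fin m) : scale d y i = d i * y i := rfl

theorem pd_scale (d : Fin m → ℝ) (i j : Fin m) (z : Eucl m) :
    pd j (fun w => scale d w i) z = Matrix.diagonal d i j := by
  rw [pd, fderiv_apply_coord (scale d).differentiableAt, ContinuousLinearMap.fderiv, scale_apply,
    Matrix.diagonal_apply]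
  by_cases h : i = j <;> simp [h]

theorem jac_scale (d : Fin m → ℝ) (z : Eucl m) : jac (scale d) z = ∏ i, d i := by
  simp only [jac, pd_scale]
  exact Matrix.det_diagonal

theorem pd_comp_scale (d : Fin m → ℝ) {φ : Eucl m → ℝ} (hφ : ContDiff ℝ ∞ φ) (i : Fin m)
    (z : Eucl m) : pd i (fun w => φ (scale d w)) z = d i * pd i φ (scale d z) := by
  have h := ((hφ.differentiable (by simp) (scale d z)).hasFDerivAt.comp z
    (scale d).hasFDerivAt).fderiv
  rw [Function.comp_def] at h
  rw [pd, h, ContinuousLinearMap.comp_apply]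
  have : scale d (stdVec i) = d i • stdVec i := by
    ext j
    by_cases hj : j = i <;> simp [hj]
  rw [this, map_smul, pd, smul_eq_mul]

theorem isDiffeo_scale {d e : Fin m → ℝ} (h : ∀ i, d i * e i = 1) :
    IsDiffeo (univ : Set (Eucl m)) univ (scale d) (scale e) := by
  refine ⟨isOpen_univ, isOpen_univ, (scale d).contDiff.contDiffOn, (scale e).contDiff.contDiffOn,
    mapsTo_univ _ _, mapsTo_univ _ _, fun y _ => ?_, fun y _ => ?_⟩
  · ext i
    rw [scale_apply, scale_apply, ← mul_assoc, mul_comm (e i), h, one_mul]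
  · ext i
    rw [scale_apply, scale_apply, ← mul_assoc, h, one_mul]

end Scaling

/-! ### Integration by parts up to the boundary of the half-space. -/

section HalfSpace

variable {n : ℕ} {𝕜 : Type*} [RCLike 𝕜]

/-- The open half-space. -/
def openHalf (n : ℕ) : Set (Eucl (n + 1)) := {y | 0 < y 0}

theorem continuous_coord {m : ℕ} (i : Fin m) : Continuous fun y : Eucl m => y i :=
  (EuclideanSpace.proj (𝕜 := ℝ) i).continuous

theorem contDiff_coord {m : ℕ} (i : Fin m) : ContDiff ℝ ∞ fun y : Eucl m => y i :=
  (EuclideanSpace.proj (𝕜 := ℝ) i).contDiff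

theorem isOpen_openHalf : IsOpen (openHalf n) := isOpen_lt continuous_const (continuous_coord 0)

theorem interior_halfSpace : interior (halfSpace n) = openHalf n := by
  refine subset_antisymm (fun y hy => ?_)
    (interior_maximal (fun y (hy : 0 < y 0) => show 0 ≤ y 0 from hy.le) isOpen_openHalf)
  have hc : Continuous fun t : ℝ => y - t • (stdVec 0 : Eucl (n + 1)) := by fun_prop
  have h0 : ∀ᶠ t in 𝓝 (0 : ℝ), y - t • (stdVec 0 : Eucl (n + 1)) ∈ halfSpace n := by
    refine hc.continuousAt.eventually_mem ?_
    simpa using mem_interior_iff_mem_nhds.1 hy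
  obtain ⟨t, ht, ht0⟩ := ((h0.filter_mono nhdsWithin_le_nhds).and
    (self_mem_nhdsWithin : ∀ᶠ t in 𝓝[>] (0 : ℝ), t ∈ Ioi 0)).exists
  have ht' : 0 ≤ y 0 - t := by simpa [halfSpace] using ht
  exact lt_of_lt_of_le ht0 (by linarith)

/-- The boundary hyperplane is a proper subspace, hence null. Thus `M` and its interior need not be
distinguished in the charts. -/
theorem ae_coord_ne_zero : ∀ᵐ y : Eucl (n + 1), y 0 ≠ 0 := by
  have h : (LinearMap.ker (EuclideanSpace.proj (𝕜 := ℝ) (0 : Fin (n + 1))).toLinearMap) ≠ ⊤ := by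
    intro h
    have : stdVec 0 ∈ LinearMap.ker
      (EuclideanSpace.proj (𝕜 := ℝ) (0 : Fin (n + 1))).toLinearMap := h ▸ Submodule.mem_top
    simp at this
  have h0 := Measure.addHaar_submodule (volume : Measure (Eucl (n + 1))) _ h
  rw [ae_iff]
  convert h0 using 2
  ext y
  simp

/-- At `t = (N + 1) y₀ - 1` the weight `t + 1` is `(N + 1) y₀`. The bound therefore controls `y₀ ∂₀`
of the boundary cutoff uniformly in `N`, although the derivative itself grows like `N`. -/
theorem exists_bound_smoothTransition :
    ∃ B : ℝ, ∀ t, |(t + 1) * deriv Real.smoothTransition t| ≤ B := by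
  have hs : ContDiff ℝ ∞ Real.smoothTransition := Real.smoothTransition.contDiff
  have hd : Continuous (deriv Real.smoothTransition) := hs.continuous_deriv (by simp)
  have hc : Continuous fun t : ℝ => (t + 1) * deriv Real.smoothTransition t := by fun_prop
  obtain ⟨B, hB⟩ := (isCompact_Icc (a := (0 : ℝ)) (b := 1)).exists_bound_of_continuousOn
    hc.continuousOn
  refine ⟨max B 0, fun t => ?_⟩
  by_cases ht : t ∈ Icc (0 : ℝ) 1
  · exact (hB t ht).trans (le_max_left _ _)
  · have : deriv Real.smoothTransition t = 0 := by
      rw [mem_Icc, not_and_or, not_le, not_le] at ht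
      rcases ht with ht | ht
      · have : Real.smoothTransition =ᶠ[𝓝 t] fun _ => 0 := by
          filter_upwards [gt_mem_nhds ht] with s hs
          exact Real.smoothTransition.zero_of_nonpos hs.le
        rw [this.deriv_eq]; simp
      · have : Real.smoothTransition =ᶠ[𝓝 t] fun _ => 1 := by
          filter_upwards [lt_mem_nhds ht] with s hs
          exact Real.smoothTransition.one_of_one_le hs.le
        rw [this.deriv_eq]; simp
    simp [this]

/-- A cutoff function that vanishes for `y 0 ≤ 1 / (N + 1)` and is `1` for `y 0 ≥ 2 / (N + 1)`. -/
noncomputable def bdryCutoff (N : ℕ) (y : Eucl (n + 1)) : ℝ :=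
  Real.smoothTransition ((N + 1 : ℝ) * y 0 - 1)

theorem contDiff_bdryCutoff (N : ℕ) : ContDiff ℝ ∞ (bdryCutoff (n := n) N) :=
  Real.smoothTransition.contDiff.comp ((contDiff_const.mul (contDiff_coord 0)).sub contDiff_const)

theorem pd_bdryCutoff (N : ℕ) (i : Fin (n + 1)) (y : Eucl (n + 1)) :
    pd i (bdryCutoff N) y =
      if i = 0 then (N + 1 : ℝ) * deriv Real.smoothTransition ((N + 1 : ℝ) * y 0 - 1) else 0 := by
  have h1 : HasFDerivAt (fun y : Eucl (n + 1) => (N + 1 : ℝ) * y 0 - 1)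
      ((N + 1 : ℝ) • EuclideanSpace.proj (𝕜 := ℝ) (0 : Fin (n + 1))) y :=
    ((EuclideanSpace.proj (𝕜 := ℝ) (0 : Fin (n + 1))).hasFDerivAt.const_mul _).sub_const 1
  have h2 : HasDerivAt Real.smoothTransition
      (deriv Real.smoothTransition ((N + 1 : ℝ) * y 0 - 1)) ((N + 1 : ℝ) * y 0 - 1) :=
    (Real.smoothTransition.contDiff (n := 1)).differentiable (by simp) _ |>.hasDerivAt
  have h3 := (h2.comp_hasFDerivAt y h1).fderiv
  rw [pd, show bdryCutoff N = Real.smoothTransition ∘ fun y : Eucl (n + 1) => (N + 1 : ℝ) * y 0 - 1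
    from rfl, h3]
  by_cases hi : i = 0
  · simp [hi, mul_comm]
  · simp [hi, Ne.symm hi]

/-- Compare `y` with its orthogonal projection to the hyperplane, where `Φ` vanishes. -/
theorem abs_le_mul_coord {Φ : Eucl (n + 1) → ℝ} {L : ℝ≥0} (hL : LipschitzWith L Φ)
    (h0 : ∀ y : Eucl (n + 1), y 0 = 0 → Φ y = 0) (y : Eucl (n + 1)) : |Φ y| ≤ L * |y 0| := by
  have h1 := hL.dist_le_mul y (y - y 0 • stdVec 0)
  rw [h0 (y - y 0 • stdVec 0) (by simp), Real.dist_eq, sub_zero, dist_eq_norm, sub_sub_cancel,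
    norm_smul] at h1
  simpa using h1

/-- Integration by parts in the half-space, against test functions that need not vanish near the
boundary. -/
theorem WeakPD.halfSpace {i : Fin (n + 1)} {f v : Eucl (n + 1) → 𝕜}
    (h : WeakPD (openHalf n) i f v) {R R' : ℝ≥0} (hf : L2Bound (openHalf n) f R)
    (hv : L2Bound (openHalf n) v R') {Φ : Eucl (n + 1) → ℝ} (hΦ : IsTest univ Φ)
    (h0 : i = 0 → ∀ y : Eucl (n + 1), y 0 = 0 → Φ y = 0) :
    ∫ y, pd i Φ y • (openHalf n).indicator f y = -∫ y, Φ y • (openHalf n).indicator v y := by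
  have hfi := (hf.indicator isOpen_openHalf.measurableSet (subset_univ _)).locInt
  have hvi := (hv.indicator isOpen_openHalf.measurableSet (subset_univ _)).locInt
  have hη := contDiff_bdryCutoff (n := n)
  -- These products are admissible in the definition of the weak derivative. The claim follows as `N
  -- → ∞`, provided that both sides converge by domination.
  have htest : ∀ N, IsTest (openHalf n) fun y => Φ y * bdryCutoff N y := by
    intro N
    refine isTest_of_contDiffOn isOpen_openHalf (K := tsupport Φ ∩ {y | 1 / (N + 1 : ℝ) ≤ y 0})
      (hΦ.2.inter_right (isClosed_le continuous_const (continuous_coord 0))) ?_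
      (hΦ.1.mul (hη N)).contDiffOn ?_
    · rintro y ⟨-, hy⟩
      have hN : (0 : ℝ) < 1 / (N + 1 : ℝ) := by positivity
      exact hN.trans_le hy
    · intro y hy
      by_cases hy' : y ∈ tsupport Φ
      · have : ¬ (1 / (N + 1 : ℝ) ≤ y 0) := fun h => hy ⟨hy', h⟩
        rw [bdryCutoff, Real.smoothTransition.zero_of_nonpos, mul_zero]
        rw [not_le, lt_div_iff₀ (by positivity)] at this
        linarith
      · rw [image_eq_zero_of_notMem_tsupport hy', zero_mul]
  have hlarge : ∀ y : Eucl (n + 1), 0 < y 0 →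
      ∀ᶠ N : ℕ in atTop, 1 < (N + 1 : ℝ) * y 0 - 1 := by
    intro y hy
    have := (tendsto_natCast_atTop_atTop (R := ℝ)).eventually_gt_atTop (2 / y 0)
    filter_upwards [this] with N hN
    rw [div_lt_iff₀ hy] at hN
    linarith
  have hone : ∀ N : ℕ, ∀ y : Eucl (n + 1), 1 < (N + 1 : ℝ) * y 0 - 1 →
      bdryCutoff N y = 1 ∧ pd i (bdryCutoff N) y = 0 := by
    intro N y hy
    refine ⟨Real.smoothTransition.one_of_one_le hy.le, ?_⟩
    have : bdryCutoff N =ᶠ[𝓝 y] fun _ => 1 := by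
      have hc : Continuous fun z : Eucl (n + 1) => (N + 1 : ℝ) * z 0 - 1 :=
        (continuous_const.mul (continuous_coord 0)).sub continuous_const
      filter_upwards [(isOpen_lt continuous_const hc).mem_nhds hy] with z hz
      exact Real.smoothTransition.one_of_one_le (le_of_lt hz)
    rw [pd, this.fderiv_eq]
    simp
  have e : ∀ N, ∫ y, pd i (fun y => Φ y * bdryCutoff N y) y • (openHalf n).indicator f y =
      -∫ y, (Φ y * bdryCutoff N y) • (openHalf n).indicator v y := by
    intro N
    have key : ∀ {ψ : Eucl (n + 1) → ℝ} {a : Eucl (n + 1) → 𝕜}, IsTest (openHalf n) ψ →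
        ∫ y, ψ y • (openHalf n).indicator a y = ∫ y, ψ y • a y := by
      intro ψ a hψ
      congr 1
      funext y
      by_cases hy : y ∈ openHalf n
      · simp [hy]
      · simp [hψ.eq_zero hy]
    rw [key ((htest N).pd i), key (htest N)]
    exact h _ (htest N)
  have hle : ∀ N : ℕ, ∀ y : Eucl (n + 1), |bdryCutoff N y| ≤ 1 := fun N y => by
    rw [bdryCutoff, abs_of_nonneg (Real.smoothTransition.nonneg _)]
    exact Real.smoothTransition.le_one _
  have lim2 : Tendsto (fun N => ∫ y, (Φ y * bdryCutoff N y) • (openHalf n).indicator v y) atTop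
      (𝓝 (∫ y, Φ y • (openHalf n).indicator v y)) := by
    refine tendsto_integral_of_dominated_convergence
      (fun y => ‖Φ y • (openHalf n).indicator v y‖) (fun N => ?_)
      (hΦ.integrable_smul isOpen_univ hvi).norm (fun N => ?_) ?_
    · exact (((htest N).mono (subset_univ _)).integrable_smul isOpen_univ hvi).1
    · refine Eventually.of_forall fun y => ?_
      rw [norm_smul, norm_smul, norm_mul]
      gcongr
      exact mul_le_of_le_one_right (norm_nonneg _) (hle N y)
    · refine Eventually.of_forall fun y => ?_
      by_cases hy : y ∈ openHalf n
      · refine tendsto_const_nhds.congr' ?_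
        filter_upwards [hlarge y hy] with N hN
        rw [(hone N y hN).1, mul_one]
      · simp [hy]
  -- Since `ζ = 1` on the support of `Φ`, a multiple of `‖ζ f‖` can serve as an integrable majorant
  -- independent of `N`.
  obtain ⟨ζ, hζ, hζ1⟩ := exists_isTest_eq_one isOpen_univ hΦ.2 (subset_univ _)
  obtain ⟨B, hB⟩ := exists_bound_smoothTransition
  obtain ⟨L, hL⟩ := (hΦ.1.of_le (m := 1) (by simp)).lipschitzWith_of_hasCompactSupport hΦ.2
    (by simp)
  obtain ⟨D, hD⟩ := (hΦ.pd i).1.continuous.bounded_above_of_compact_support (hΦ.pd i).2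
  -- The critical term is `Φ ∂_i η_N`. It vanishes for tangential `i`. For `i = 0` the factor `|Φ| ≤
  -- L y₀` compensates the growth of `∂₀ η_N`, which leaves the bound `L * B`.
  have hpd : ∀ N : ℕ, ∀ y ∈ openHalf n,
      ‖pd i (fun y => Φ y * bdryCutoff N y) y‖ ≤ (D + L * B) * |ζ y| := by
    intro N y hy
    have hy0 : 0 < y 0 := hy
    by_cases hyt : y ∈ tsupport Φ
    · have : ζ y = 1 := hζ1.self_of_nhdsSet y hyt
      rw [this, abs_one, mul_one, hΦ.pd_mul isOpen_univ (hη N).contDiffOn]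
      refine (norm_add_le _ _).trans (add_le_add ?_ ?_)
      · rw [norm_mul]
        exact (mul_le_of_le_one_right (norm_nonneg _) (hle N y)).trans (hD y)
      · rw [pd_bdryCutoff]
        have hB' := hB ((N + 1 : ℝ) * y 0 - 1)
        have hB0 : 0 ≤ B := (abs_nonneg _).trans hB'
        by_cases hi : i = 0
        · rw [if_pos hi, norm_mul]
          have h1 := abs_le_mul_coord hL (h0 hi) y
          rw [sub_add_cancel, abs_mul, abs_mul, abs_of_pos hy0] at hB'
          rw [abs_of_pos hy0] at h1
          rw [Real.norm_eq_abs, Real.norm_eq_abs, abs_mul]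
          calc _ ≤ (L * y 0) * (|(N + 1 : ℝ)| *
                |deriv Real.smoothTransition ((N + 1 : ℝ) * y 0 - 1)|) := by gcongr
            _ = L * (|(N + 1 : ℝ)| * y 0 *
                |deriv Real.smoothTransition ((N + 1 : ℝ) * y 0 - 1)|) := by ring
            _ ≤ L * B := by gcongr
        · rw [if_neg hi, mul_zero, norm_zero]
          positivity
    · have : y ∉ tsupport fun y => Φ y * bdryCutoff N y := fun h' => hyt (by
        refine closure_mono ?_ h'
        intro z hz hz'
        exact hz (by simp [hz']))
      rw [pd_eq_zero this, norm_zero]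
      have hD0 : 0 ≤ D := (norm_nonneg _).trans (hD y)
      have hB0 : 0 ≤ B := (abs_nonneg _).trans (hB 0)
      positivity
  have lim1 : Tendsto (fun N => ∫ y, pd i (fun y => Φ y * bdryCutoff N y) y •
      (openHalf n).indicator f y) atTop (𝓝 (∫ y, pd i Φ y • (openHalf n).indicator f y)) := by
    refine tendsto_integral_of_dominated_convergence
      (fun y => (D + L * B) * ‖ζ y • (openHalf n).indicator f y‖) (fun N => ?_)
      ((hζ.integrable_smul isOpen_univ hfi).norm.const_mul _) (fun N => ?_) ?_
    · exact ((((htest N).pd i).mono (subset_univ _)).integrable_smul isOpen_univ hfi).1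
    · refine Eventually.of_forall fun y => ?_
      by_cases hy : y ∈ openHalf n
      · rw [norm_smul, norm_smul, ← mul_assoc]
        gcongr
        exact hpd N y hy
      · simp [hy]
    · refine Eventually.of_forall fun y => ?_
      by_cases hy : y ∈ openHalf n
      · refine tendsto_const_nhds.congr' ?_
        filter_upwards [hlarge y hy] with N hN
        rw [hΦ.pd_mul isOpen_univ (hη N).contDiffOn, (hone N y hN).1, (hone N y hN).2]
        simp
      · simp [hy]
  simp only [e] at lim1
  exact tendsto_nhds_unique lim1 lim2.neg

end HalfSpace


/-! ### Higher-order reflection across the boundary. -/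

section Reflection

variable {n N : ℕ} {𝕜 : Type*} [RCLike 𝕜]

/-- The factors of the dilation `(t, v) ↦ (a t, v)`. -/
noncomputable def dil (a : ℝ) : Fin (n + 1) → ℝ := Function.update (fun _ => 1) 0 a

theorem dil_zero (a : ℝ) : dil (n := n) a 0 = a := by simp [dil]

theorem dil_of_ne (a : ℝ) {i : Fin (n + 1)} (hi : i ≠ 0) : dil a i = 1 := by simp [dil, hi]

theorem isDiffeo_dil {a : ℝ} (ha : a ≠ 0) :
    IsDiffeo (univ : Set (Eucl (n + 1))) univ (scale (dil a)) (scale (dil a⁻¹)) := by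
  refine isDiffeo_scale fun i => ?_
  by_cases hi : i = 0
  · rw [hi, dil_zero, dil_zero, mul_inv_cancel₀ ha]
  · rw [dil_of_ne _ hi, dil_of_ne _ hi, one_mul]

theorem jac_dil (a : ℝ) (z : Eucl (n + 1)) : jac (scale (dil a)) z = a := by
  rw [jac_scale, Fin.prod_univ_succ, dil_zero,
    Finset.prod_eq_one fun i _ => dil_of_ne a (Fin.succ_ne_zero i), mul_one]

/-- The extension of `f` by reflections: `∑_j c_j f(-λ_j t, v)` for `t < 0`. -/
noncomputable def refl (lam c : Fin N → ℝ) (f : Eucl (n + 1) → 𝕜) : Eucl (n + 1) → 𝕜 :=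
  (openHalf n).indicator f +
    ∑ j, fun y => c j • (openHalf n).indicator f (scale (dil (-lam j)) y)

/-- The operation on test functions that is dual to the extension by reflections. -/
noncomputable def reflDual (lam c : Fin N → ℝ) (φ : Eucl (n + 1) → ℝ) (y : Eucl (n + 1)) : ℝ :=
  φ y + ∑ j, c j * (lam j)⁻¹ * φ (scale (dil (-lam j)⁻¹) y)

variable {lam c : Fin N → ℝ}

/-- For `t > 0` all reflected points lie in `t < 0`, where the zero extension of `f` vanishes. -/
theorem refl_of_mem (hlam : ∀ j, 0 < lam j) (f : Eucl (n + 1) → 𝕜) {y : Eucl (n + 1)}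
    (hy : y ∈ openHalf n) : refl lam c f y = f y := by
  have : ∀ j, scale (dil (-lam j)) y ∉ openHalf n := fun j h => by
    have hy' : 0 < y 0 := hy
    have h' : 0 < scale (dil (-lam j)) y 0 := h
    rw [scale_apply, dil_zero] at h'
    nlinarith [hlam j]
  simp [refl, hy, this]

theorem isTest_comp_dil {a : ℝ} (ha : a ≠ 0) {φ : Eucl (n + 1) → ℝ} (h : IsTest univ φ) :
    IsTest univ fun y => φ (scale (dil a⁻¹) y) := by
  have := (isDiffeo_dil ha).isTest_comp h
  rwa [indicator_univ] at this

theorem isTest_sum {m : ℕ} {Ω : Set (Eucl m)} (hΩ : IsOpen Ω) {ι : Type*} (s : Finset ι)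
    {φ : ι → Eucl m → ℝ} (h : ∀ i ∈ s, IsTest Ω (φ i)) : IsTest Ω fun y => ∑ i ∈ s, φ i y := by
  refine isTest_of_contDiffOn hΩ (K := ⋃ i ∈ s, tsupport (φ i))
    (s.isCompact_biUnion fun i hi => (h i hi).2) (iUnion₂_subset fun i hi => (h i hi).3)
    (ContDiff.contDiffOn (ContDiff.sum fun i hi => (h i hi).1)) fun y hy => ?_
  refine Finset.sum_eq_zero fun i hi => image_eq_zero_of_notMem_tsupport fun h' => hy ?_
  exact mem_iUnion₂.2 ⟨i, hi, h'⟩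

theorem IsTest.add {m : ℕ} {Ω : Set (Eucl m)} (hΩ : IsOpen Ω) {φ ψ : Eucl m → ℝ}
    (h : IsTest Ω φ) (h' : IsTest Ω ψ) : IsTest Ω fun y => φ y + ψ y := by
  have := isTest_sum hΩ Finset.univ (φ := ![φ, ψ]) (fun i _ => by fin_cases i <;> assumption)
  simpa [Fin.sum_univ_two] using this

theorem isTest_const_mul {m : ℕ} {Ω : Set (Eucl m)} (hΩ : IsOpen Ω) {φ : Eucl m → ℝ}
    (h : IsTest Ω φ) (a : ℝ) : IsTest Ω fun y => a * φ y := by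
  simpa only [mul_comm] using h.mul hΩ (contDiffOn_const (c := a))

theorem isTest_reflDual (hlam : ∀ j, 0 < lam j) {φ : Eucl (n + 1) → ℝ} (h : IsTest univ φ) :
    IsTest univ (reflDual lam c φ) :=
  h.add isOpen_univ (isTest_sum isOpen_univ _ fun j _ => isTest_const_mul isOpen_univ
    (isTest_comp_dil (neg_ne_zero.2 (hlam j).ne') h) _)

theorem integral_comp_dil {l : ℝ} (hl : 0 < l) (φ : Eucl (n + 1) → ℝ) (g : Eucl (n + 1) → 𝕜) :
    ∫ y, φ y • g (scale (dil (-l)) y) = ∫ z, (l⁻¹ * φ (scale (dil (-l)⁻¹) z)) • g z := by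
  have hd := isDiffeo_dil (n := n) (neg_ne_zero.2 hl.ne')
  refine hd.integral_eq (fun y hy => absurd (mem_univ y) hy) (fun y hy => absurd (mem_univ y) hy)
    fun z hz => ?_
  rw [hd.right_inv z hz, jac_dil, smul_smul, inv_neg, abs_neg, abs_of_pos (inv_pos.2 hl)]

theorem L2Bound.comp_dil {f : Eucl (n + 1) → 𝕜} {R : ℝ≥0} (hf : L2Bound univ f R) {a : ℝ}
    (ha : a ≠ 0) : L2Bound univ (fun y => f (scale (dil a) y)) ((1 + ‖a⁻¹‖₊) * R) := by
  refine (isDiffeo_dil ha).l2Bound_comp (le_add_of_nonneg_right zero_le) (fun z _ => ?_) hf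
  rw [jac_dil]
  simp

/-- Substituting in each reflected summand moves the dilation to the test function, with Jacobian
`λ_j⁻¹`. -/
theorem integral_smul_refl (hlam : ∀ j, 0 < lam j) {φ : Eucl (n + 1) → ℝ} (h : IsTest univ φ)
    {f : Eucl (n + 1) → 𝕜} {R : ℝ≥0} (hf : L2Bound (openHalf n) f R) :
    ∫ y, φ y • refl lam c f y = ∫ y, reflDual lam c φ y • (openHalf n).indicator f y := by
  have hb := hf.indicator isOpen_openHalf.measurableSet (subset_univ _)
  set g := (openHalf n).indicator f with hg
  have hne : ∀ j, -lam j ≠ 0 := fun j => neg_ne_zero.2 (hlam j).ne'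
  have i1 : ∀ j, Integrable fun y => (c j * φ y) • g (scale (dil (-lam j)) y) := fun j =>
    (isTest_const_mul isOpen_univ h (c j)).integrable_smul isOpen_univ (hb.comp_dil (hne j)).locInt
  have i2 : ∀ j, Integrable fun y => (c j * (lam j)⁻¹ * φ (scale (dil (-lam j)⁻¹) y)) • g y :=
    fun j => (isTest_const_mul isOpen_univ (isTest_comp_dil (hne j) h) _).integrable_smul
      isOpen_univ hb.locInt
  have i0 := h.integrable_smul isOpen_univ hb.locInt
  have e1 : ∀ y, φ y • refl lam c f y =
      φ y • g y + ∑ j, (c j * φ y) • g (scale (dil (-lam j)) y) := fun y => by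
    simp only [refl, Pi.add_apply, Finset.sum_apply, smul_add, Finset.smul_sum, smul_smul,
      mul_comm (φ y), ← hg]
  have e2 : ∀ y, reflDual lam c φ y • g y = φ y • g y +
      ∑ j, (c j * (lam j)⁻¹ * φ (scale (dil (-lam j)⁻¹) y)) • g y := fun y => by
    rw [reflDual, add_smul, Finset.sum_smul]
  simp only [e1, e2]
  rw [integral_add i0 (integrable_finsetSum _ fun j _ => i1 j),
    integral_add i0 (integrable_finsetSum _ fun j _ => i2 j),
    integral_finsetSum _ fun j _ => i1 j, integral_finsetSum _ fun j _ => i2 j]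
  congr 1
  refine Finset.sum_congr rfl fun j _ => ?_
  rw [integral_comp_dil (hlam j)]
  congr 1
  funext y
  congr 1
  ring

/-- The coefficients of the reflected `i`-th derivative. -/
noncomputable def reflCoeff (lam c : Fin N → ℝ) (i : Fin (n + 1)) : Fin N → ℝ :=
  if i = 0 then fun j => -lam j * c j else c

/-- Tangential derivatives commute with the dilations. A normal derivative produces the factor
`(-λ_j)⁻¹`, which the weights `-λ_j c_j` compensate. -/
theorem reflDual_pd (hlam : ∀ j, 0 < lam j) {φ : Eucl (n + 1) → ℝ} (h : IsTest univ φ)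
    (i : Fin (n + 1)) (y : Eucl (n + 1)) :
    reflDual lam c (pd i φ) y = pd i (reflDual lam (reflCoeff lam c i) φ) y := by
  have hd : ∀ j, Differentiable ℝ fun w => φ (scale (dil (-lam j)⁻¹) w) := fun j =>
    (isTest_comp_dil (neg_ne_zero.2 (hlam j).ne') h).1.differentiable (by simp)
  have hj : ∀ j, pd i (fun w => φ (scale (dil (-lam j)⁻¹) w)) y =
      dil (-lam j)⁻¹ i * pd i φ (scale (dil (-lam j)⁻¹) y) := fun j => pd_comp_scale _ h.1 i y
  have e : pd i (reflDual lam (reflCoeff lam c i) φ) y = pd i φ y +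
      ∑ j, reflCoeff lam c i j * (lam j)⁻¹ * pd i (fun w => φ (scale (dil (-lam j)⁻¹) w)) y := by
    have h1 := (h.1.differentiable (by simp) y).hasFDerivAt.add
      (HasFDerivAt.fun_sum (u := Finset.univ) fun j _ => ((hd j y).hasFDerivAt.const_mul
        (reflCoeff lam c i j * (lam j)⁻¹)))
    have h2 := h1.fderiv
    change fderiv ℝ (reflDual lam (reflCoeff lam c i) φ) y = _ at h2
    rw [pd, h2]
    simp [pd]
  rw [e, reflDual]
  congr 1
  refine Finset.sum_congr rfl fun j _ => ?_
  rw [hj]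
  have := (hlam j).ne'
  by_cases hi : i = 0
  · rw [reflCoeff, if_pos hi, hi, dil_zero]
    field_simp
  · rw [reflCoeff, if_neg hi, dil_of_ne _ hi, one_mul]

/-- For the normal derivative the dual test function on `t = 0` is `φ (1 - ∑ c_j) = 0`, since all
dilations fix this hyperplane. There is then no boundary term. Tangential derivatives require no
vanishing. -/
theorem WeakPD.refl (hlam : ∀ j, 0 < lam j) (hc : ∑ j, c j = 1) {i : Fin (n + 1)}
    {f v : Eucl (n + 1) → 𝕜} (h : WeakPD (openHalf n) i f v) {R R' : ℝ≥0}
    (hf : L2Bound (openHalf n) f R) (hv : L2Bound (openHalf n) v R') :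
    WeakPD univ i (refl lam c f) (refl lam (reflCoeff lam c i) v) := by
  intro φ hφ
  rw [integral_smul_refl hlam (hφ.pd i) hf, integral_smul_refl hlam hφ hv]
  simp only [reflDual_pd hlam hφ]
  refine h.halfSpace hf hv (isTest_reflDual hlam hφ) fun hi y hy => ?_
  have e : ∀ a : ℝ, scale (dil a) y = y := fun a => by
    ext l
    by_cases hl : l = 0
    · rw [hl, scale_apply, hy, mul_zero]
    · rw [scale_apply, dil_of_ne _ hl, one_mul]
  simp only [reflDual, e, reflCoeff, hi, if_true]
  rw [← Finset.sum_mul]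
  have : ∀ j, -lam j * c j * (lam j)⁻¹ = -c j := fun j => by
    have := (hlam j).ne'
    field_simp
  rw [Finset.sum_congr rfl fun j _ => this j, Finset.sum_neg_distrib, hc]
  ring

theorem L2Bound.refl (hlam : ∀ j, 0 < lam j) {f : Eucl (n + 1) → 𝕜} {R : ℝ≥0}
    (hf : L2Bound (openHalf n) f R) :
    L2Bound univ (refl lam c f) ((1 + ∑ j, ‖c j‖₊ * (1 + ‖(-lam j)⁻¹‖₊)) * R) := by
  have hb := hf.indicator isOpen_openHalf.measurableSet (subset_univ _)
  have h2 := SobBound.sum (k := 0) isOpen_univ Finset.univ fun j _ =>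
    L2Bound.smul (a := fun _ => c j) (C := ‖c j‖₊) isOpen_univ continuousOn_const (by simp)
      (hb.comp_dil (neg_ne_zero.2 (hlam j).ne'))
  have := hb.add h2
  rw [add_mul, one_mul, Finset.sum_mul]
  simp only [mul_assoc]
  exact this

/-- A normal derivative replaces `c_j` by `-λ_j c_j`, which shifts the moment conditions by one:
order `l` for the new weights is order `l + 1` for the old ones. Induction on `k` must therefore
allow all weights `c`. -/
theorem exists_sobBound_refl (hlam : ∀ j, 0 < lam j) (k : ℕ) (c : Fin N → ℝ)
    (hc : ∀ l < k, ∑ j, c j * (-lam j) ^ l = 1) :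
    ∃ D : ℝ≥0, ∀ (f : Eucl (n + 1) → 𝕜) (R : ℝ≥0), SobBound (openHalf n) R k f →
      SobBound univ (D * R) k (refl lam c f) := by
  induction k generalizing c with
  | zero => exact ⟨_, fun f R hf => L2Bound.refl hlam hf⟩
  | succ k ih =>
    have hcoeff : ∀ i : Fin (n + 1), ∀ l < k, ∑ j, reflCoeff lam c i j * (-lam j) ^ l = 1 := by
      intro i l hl
      by_cases hi : i = 0
      · rw [← hc (l + 1) (by lia)]
        refine Finset.sum_congr rfl fun j _ => ?_
        rw [reflCoeff, if_pos hi]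
        ring
      · rw [reflCoeff, if_neg hi, hc l (by lia)]
    choose D hD using fun i => ih _ (hcoeff i)
    refine ⟨(1 + ∑ j, ‖c j‖₊ * (1 + ‖(-lam j)⁻¹‖₊)) + ∑ i, D i, fun f R hf => ⟨?_, fun i => ?_⟩⟩
    · refine (hf.1.refl hlam).mono subset_rfl ?_
      exact mul_le_mul_left (le_add_of_nonneg_right zero_le) R
    · obtain ⟨v, hv, hv'⟩ := hf.2 i
      refine ⟨_, hv.refl hlam (by simpa using hc 0 (by lia)) hf.1 hv'.l2Bound,
        (hD i v R hv').mono subset_rfl ?_⟩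
      gcongr
      refine le_add_of_nonneg_of_le zero_le ?_
      exact Finset.single_le_sum (f := D) (fun _ _ => zero_le) (Finset.mem_univ i)

/-- Take the Lagrange basis polynomials of the nodes `-λ_j = -(j + 1)`, evaluated at `1`.
Interpolation reproduces each monomial `X ^ l` exactly, and its value at `1` is `1`. -/
theorem exists_reflection_coefficients (k : ℕ) :
    ∃ lam c : Fin (k + 1) → ℝ, (∀ j, 0 < lam j) ∧ ∀ l < k, ∑ j, c j * (-lam j) ^ l = 1 := by
  let x : Fin (k + 1) → ℝ := fun j => -((j : ℝ) + 1)
  have hx : InjOn x (Finset.univ : Finset (Fin (k + 1))) := fun a _ b _ hab => by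
    have : (a : ℝ) = b := by simpa [x] using hab
    exact Fin.ext (by exact_mod_cast this)
  refine ⟨fun j => (j : ℝ) + 1, fun j => (Lagrange.basis Finset.univ x j).eval 1,
    fun j => by positivity, fun l hl => ?_⟩
  have h := Lagrange.eq_interpolate (f := (Polynomial.X ^ l : Polynomial ℝ)) hx (by
    rw [Polynomial.degree_X_pow]
    simp only [Finset.card_univ, Fintype.card_fin]
    exact_mod_cast (by lia : l < k + 1))
  have h' := congrArg (Polynomial.eval 1) h
  rw [Lagrange.interpolate_apply, Polynomial.eval_finsetSum] at h'
  simp only [Polynomial.eval_pow, Polynomial.eval_X, one_pow, Polynomial.eval_mul,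
    Polynomial.eval_C] at h'
  refine Eq.trans (Finset.sum_congr rfl fun j _ => ?_) h'.symm
  rw [mul_comm]

end Reflection


/-! ### The extension operator `E₀` on Sobolev classes. -/

section EuclideanExtension

variable {𝕜 : Type*} [RCLike 𝕜]

/-- Differentiable maps between spaces of equal dimension send null sets to null sets; here `Θ` maps
the exceptional set in `Ω₂` onto the one in `Ω₁`. -/
theorem IsDiffeo.ae_comp {m : ℕ} {Ω₁ Ω₂ : Set (Eucl m)} {Ψ Θ : Eucl m → Eucl m}
    (h : IsDiffeo Ω₁ Ω₂ Ψ Θ) {p : Eucl m → Prop} (hp : ∀ᵐ z ∂volume.restrict Ω₂, p z) :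
    ∀ᵐ y ∂volume.restrict Ω₁, p (Ψ y) := by
  rw [ae_restrict_iff' h.open₂.measurableSet, ae_iff] at hp
  rw [ae_restrict_iff' h.open₁.measurableSet, ae_iff]
  have := addHaar_image_eq_zero_of_differentiableOn_of_addHaar_eq_zero volume
    (f := Θ) (s := Ω₂ ∩ {z | ¬ p z})
    (fun z hz => (h.symm.differentiableAt hz.1).differentiableWithinAt)
    (measure_mono_null (fun z hz => by simpa using hz) hp)
  rw [h.image_inv] at this
  refine measure_mono_null (fun y hy => ?_) this
  simpa using hy

theorem exists_nnreal_sq_eq {S : ℝ≥0∞} (hS : S ≠ ⊤) : ∃ R : ℝ≥0, (R : ℝ≥0∞) ^ 2 = S := by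
  refine ⟨NNReal.sqrt S.toNNReal, ?_⟩
  rw [← ENNReal.coe_pow, NNReal.sq_sqrt, ENNReal.coe_toNNReal hS]

theorem sqrt_le_mul_sqrt_iff {A B : ℝ≥0∞} {c : ℝ≥0} :
    A ^ (1 / 2 : ℝ) ≤ c * B ^ (1 / 2 : ℝ) ↔ A ≤ (c : ℝ≥0∞) ^ 2 * B := by
  have h : (c : ℝ≥0∞) * B ^ (1 / 2 : ℝ) = ((c : ℝ≥0∞) ^ 2 * B) ^ (1 / 2 : ℝ) := by
    rw [ENNReal.mul_rpow_of_nonneg _ _ (by norm_num), ← ENNReal.rpow_natCast, ← ENNReal.rpow_mul]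
    norm_num
  rw [h, ENNReal.rpow_le_rpow_iff (by norm_num)]

/-- A bound for the number of partial derivatives of order at most `k`. -/
noncomputable def derivCount (m k : ℕ) : ℝ≥0 := 1 + ∑ j ∈ Finset.range (k + 1), (m : ℝ≥0) ^ j

theorem SobBound.sobolevNormSq_le_sq {m k : ℕ} {Ω : Set (Eucl m)} {f : Eucl m → 𝕜} {R : ℝ≥0}
    (h : SobBound (interior Ω) R k f) :
    sobolevNormSq k Ω f ≤ ((derivCount m k * R : ℝ≥0) : ℝ≥0∞) ^ 2 := by
  refine h.sobolevNormSq_le.trans ?_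
  rw [ENNReal.coe_mul, mul_pow]
  gcongr
  rw [← ENNReal.coe_pow]
  have : ∑ j ∈ Finset.range (k + 1), (m : ℝ≥0) ^ j ≤ derivCount m k ^ 2 := by
    -- The summand `1` in `derivCount` makes it at least `1`, hence bounded by its square. This
    -- avoids a square root in the constants.
    refine le_trans (le_add_of_nonneg_left zero_le) (le_self_pow₀ ?_ two_ne_zero)
    exact le_add_of_nonneg_right zero_le
  exact_mod_cast this

theorem refl_congr {n N : ℕ} {lam c : Fin N → ℝ} (hlam : ∀ j, 0 < lam j)
    {f g : Eucl (n + 1) → 𝕜} (h : f =ᵐ[volume.restrict (openHalf n)] g) :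
    refl lam c f =ᵐ[volume] refl lam c g := by
  have h1 : (openHalf n).indicator f =ᵐ[volume] (openHalf n).indicator g :=
    by
      filter_upwards [(ae_restrict_iff' isOpen_openHalf.measurableSet).1 h] with y hy
      by_cases hy' : y ∈ openHalf n
      · rw [indicator_of_mem hy', indicator_of_mem hy', hy hy']
      · rw [indicator_of_notMem hy', indicator_of_notMem hy']
  have h2 : ∀ j, ∀ᵐ y : Eucl (n + 1), (openHalf n).indicator f (scale (dil (-lam j)) y) =
      (openHalf n).indicator g (scale (dil (-lam j)) y) := fun j => by
    have := (isDiffeo_dil (n := n) (neg_ne_zero.2 (hlam j).ne')).ae_comp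
      (p := fun z => (openHalf n).indicator f z = (openHalf n).indicator g z)
      (by rw [Measure.restrict_univ]; exact h1)
    rwa [Measure.restrict_univ] at this
  filter_upwards [h1, ae_all_iff.2 h2] with y hy1 hy2
  simp only [refl, Pi.add_apply, Finset.sum_apply, hy1, hy2]

theorem refl_add {n N : ℕ} (lam c : Fin N → ℝ) (f g : Eucl (n + 1) → 𝕜) :
    refl lam c (f + g) = refl lam c f + refl lam c g := by
  funext y
  simp only [refl, Pi.add_apply, Finset.sum_apply, indicator_add', smul_add,
    Finset.sum_add_distrib]
  abel

theorem refl_smul {n N : ℕ} (lam c : Fin N → ℝ) (a : 𝕜) (f : Eucl (n + 1) → 𝕜) :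
    refl lam c (a • f) = a • refl lam c f := by
  funext y
  simp only [refl, Pi.add_apply, Finset.sum_apply, Pi.smul_apply, indicator_const_smul_apply,
    smul_add, Finset.smul_sum, Pi.smul_def, indicator_const_smul, smul_comm a]

theorem stronglyMeasurable_refl {n N : ℕ} (lam c : Fin N → ℝ) {f : Eucl (n + 1) → 𝕜}
    (hf : StronglyMeasurable f) : StronglyMeasurable (refl lam c f) := by
  have h1 := hf.indicator (isOpen_openHalf (n := n)).measurableSet
  refine h1.add (Finset.stronglyMeasurable_sum _ fun j _ => ?_)
  exact (h1.comp_measurable (scale _).continuous.measurable).const_smul (c j)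

/-- Reflection is linear, respects equality almost everywhere and is bounded by
`exists_sobBound_refl`, so it descends to classes. -/
theorem exists_sobolevExtension (n k : ℕ) :
    ∃ E₀ : SobolevSpace 𝕜 k (halfSpace n) →ₗ[𝕜]
        SobolevSpace 𝕜 k (univ : Set (Eucl (n + 1))),
      (∀ f, ⇑(E₀ f).1 =ᵐ[volume.restrict (interior (halfSpace n))] ⇑f.1) ∧
      ∃ c : ℝ≥0, ∀ f, sobolevNorm (E₀ f) ≤ c * sobolevNorm f := by
  obtain ⟨lam, c, hlam, hc⟩ := exists_reflection_coefficients k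
  obtain ⟨D, hD⟩ := exists_sobBound_refl (n := n) (𝕜 := 𝕜) hlam k c hc
  have hbound' : ∀ f : Eucl (n + 1) → 𝕜, sobolevNormSq k (halfSpace n) f < ⊤ →
      sobolevNormSq k univ (refl lam c f) ≤
        ((derivCount (n + 1) k * D : ℝ≥0) : ℝ≥0∞) ^ 2 * sobolevNormSq k (halfSpace n) f := by
    intro f hf
    obtain ⟨R, hR⟩ := exists_nnreal_sq_eq hf.ne
    have h1 := sobBound_of_sobolevNormSq_le hR.ge
    rw [interior_halfSpace] at h1
    have h2 := hD _ _ h1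
    rw [← interior_univ] at h2
    refine h2.sobolevNormSq_le_sq.trans_eq ?_
    rw [← hR, ← mul_pow, ← ENNReal.coe_mul, mul_assoc]
  have hbound := fun f : SobolevSpace 𝕜 k (halfSpace n) => hbound' f.1 f.2
  have hm : ∀ f : SobolevSpace 𝕜 k (halfSpace n), AEStronglyMeasurable (refl lam c f.1)
      (volume.restrict (interior (univ : Set (Eucl (n + 1))))) := fun f =>
    (stronglyMeasurable_refl lam c f.1.stronglyMeasurable).aestronglyMeasurable
  have hcongr : ∀ {f g : Eucl (n + 1) → 𝕜},
      f =ᵐ[volume.restrict (interior (halfSpace n))] g →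
      refl lam c f =ᵐ[volume.restrict (interior (univ : Set (Eucl (n + 1))))] refl lam c g := by
    intro f g h
    rw [interior_univ, Measure.restrict_univ]
    rw [interior_halfSpace] at h
    exact refl_congr hlam h
  let E₀ : SobolevSpace 𝕜 k (halfSpace n) →ₗ[𝕜] SobolevSpace 𝕜 k (univ : Set (Eucl (n + 1))) :=
    { toFun := fun f => ⟨AEEqFun.mk _ (hm f), by
        change sobolevNormSq k univ (AEEqFun.mk _ (hm f)) < ⊤
        rw [sobolevNormSq_congr (AEEqFun.coeFn_mk _ (hm f))]
        exact (hbound f).trans_lt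
          (ENNReal.mul_lt_top (ENNReal.pow_lt_top ENNReal.coe_lt_top) f.2)⟩
      map_add' := fun f g => by
        refine Subtype.ext (AEEqFun.ext ?_)
        refine (AEEqFun.coeFn_mk _ _).trans ?_
        refine (hcongr (AEEqFun.coeFn_add f.1 g.1)).trans ?_
        rw [refl_add]
        exact ((AEEqFun.coeFn_add _ _).trans
          ((AEEqFun.coeFn_mk _ (hm f)).add (AEEqFun.coeFn_mk _ (hm g)))).symm
      map_smul' := fun a f => by
        refine Subtype.ext (AEEqFun.ext ?_)
        refine (AEEqFun.coeFn_mk _ _).trans ?_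
        refine (hcongr (AEEqFun.coeFn_smul a f.1)).trans ?_
        rw [refl_smul]
        exact ((AEEqFun.coeFn_smul _ _).trans
          ((AEEqFun.coeFn_mk _ (hm f)).const_smul a)).symm }
  have hE : ∀ f, ⇑(E₀ f).1 =ᵐ[volume.restrict (interior (univ : Set (Eucl (n + 1))))]
      refl lam c f.1 := fun f => AEEqFun.coeFn_mk _ (hm f)
  refine ⟨E₀, fun f => ?_, derivCount (n + 1) k * D, fun f => ?_⟩
  · have h1 := ae_mono (Measure.restrict_mono (interior_mono (subset_univ (halfSpace n))) le_rfl)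
      (hE f)
    filter_upwards [h1, ae_restrict_mem isOpen_interior.measurableSet] with y hy hy'
    rw [hy, refl_of_mem hlam _ (interior_halfSpace.subset hy')]
  · rw [sobolevNorm, sobolevNorm, sqrt_le_mul_sqrt_iff, sobolevNormSq_congr (hE f)]
    exact hbound f

end EuclideanExtension


/-! ### Charts, coordinate changes and null sets. -/

namespace ManifoldAtlas

section General

variable {n : ℕ} {X : Type*} [EMetricSpace X] [ChartedSpace (Eucl (n + 1)) X]
  {Q : Set (Eucl (n + 1))} {S : Set X} {ι : Type*} (A : ManifoldAtlas n Q S ι)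

theorem chartInv_mem {α : ι} {x : X} (hx : x ∈ A.nbhd α) : A.chartInv α x ∈ A.dom α :=
  Function.invFunOn_mem hx

theorem chart_chartInv {α : ι} {x : X} (hx : x ∈ A.nbhd α) : A.chart α (A.chartInv α x) = x :=
  Function.invFunOn_eq hx

theorem chart_mem {α : ι} {y : Eucl (n + 1)} (hy : y ∈ A.dom α) : A.chart α y ∈ A.nbhd α :=
  mem_image_of_mem _ hy

theorem chartInv_chart {α : ι} {y : Eucl (n + 1)} (hy : y ∈ A.dom α) :
    A.chartInv α (A.chart α y) = y :=
  (A.param α).injOn (A.chartInv_mem (A.chart_mem hy)) hy (A.chart_chartInv (A.chart_mem hy))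

theorem nbhd_subset (α : ι) : A.nbhd α ⊆ S := (A.param α).mapsTo.image_subset

theorem continuousOn_chart (α : ι) : ContinuousOn (A.chart α) (A.dom α) :=
  (A.param α).smooth.continuousOn

/-- This restates that the parametrization maps relatively open sets to relatively open sets. -/
theorem continuousOn_chartInv (α : ι) : ContinuousOn (A.chartInv α) (A.nbhd α) := by
  rw [continuousOn_iff']
  intro O hO
  obtain ⟨O', hO', h⟩ := (A.param α).openMap O hO
  refine ⟨O', hO', ?_⟩
  ext x
  constructor
  · rintro ⟨hxO, hx⟩
    have : x ∈ A.chart α '' (A.dom α ∩ O) :=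
      ⟨A.chartInv α x, ⟨A.chartInv_mem hx, hxO⟩, A.chart_chartInv hx⟩
    rw [h] at this
    exact ⟨this.2, hx⟩
  · rintro ⟨hxO, hx⟩
    have : x ∈ S ∩ O' := ⟨A.nbhd_subset α hx, hxO⟩
    rw [← h] at this
    obtain ⟨y, ⟨hy, hyO⟩, rfl⟩ := this
    exact ⟨by rwa [mem_preimage, A.chartInv_chart hy], hx⟩

/-- In the chart, the function `χ_α` vanishes off a compact set. -/
theorem exists_compact_cutoff (α : ι) : ∃ K ⊆ A.dom α, IsCompact K ∧
    ∀ y ∈ A.dom α, y ∉ K → A.cutoff α (A.chart α y) = 0 := by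
  obtain ⟨K, hK, hKc, h0⟩ := A.cutoff_support α
  refine ⟨A.chartInv α '' K, ?_, hKc.image_of_continuousOn ((A.continuousOn_chartInv α).mono hK),
    fun y hy hyK => ?_⟩
  · rintro _ ⟨x, hx, rfl⟩
    exact A.chartInv_mem (hK hx)
  · exact h0 _ ((A.param α).mapsTo hy) fun h => hyK ⟨_, h, A.chartInv_chart hy⟩

theorem cutoff_eq_zero {α : ι} {x : X} (hxS : x ∈ S) (hx : x ∉ A.nbhd α) : A.cutoff α x = 0 := by
  obtain ⟨K, hK, -, h0⟩ := A.cutoff_support α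
  exact h0 x hxS fun h => hx (hK h)

variable [MeasurableSpace X] [BorelSpace X]

theorem aemeasurable_chart (α : ι) : AEMeasurable (A.chart α) (volume.restrict (A.dom α)) :=
  (A.continuousOn_chart α).aemeasurable (A.measurableSet_dom α)

theorem ae_chartMeasure_of [Countable ι] {p : X → Prop} (hp : MeasurableSet {x | p x})
    (h : ∀ α, ∀ᵐ y ∂volume.restrict (A.dom α), p (A.chart α y)) :
    ∀ᵐ x ∂A.chartMeasure, p x := by
  rw [chartMeasure, Measure.ae_sum_iff]
  exact fun α => (ae_map_iff (A.aemeasurable_chart α) hp).2 (h α)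

variable {𝕜 : Type*} [RCLike 𝕜]

theorem aestronglyMeasurable_localized (α : ι) {u : X → 𝕜} (hu : StronglyMeasurable u) :
    AEStronglyMeasurable (A.localized α u) (volume.restrict (A.dom α)) :=
  ((A.cutoff_smooth α).continuousOn.aestronglyMeasurable (A.measurableSet_dom α)).smul
    (hu.aestronglyMeasurable.comp_aemeasurable (A.aemeasurable_chart α))

end General

section Boundaryless

variable {n : ℕ} {X : Type*} [EMetricSpace X] [ChartedSpace (Eucl (n + 1)) X]
  {ι : Type*} (A : ManifoldAtlas n univ (univ : Set X) ι)

theorem isOpen_dom (α : ι) : IsOpen (A.dom α) := by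
  obtain ⟨O, hO, h⟩ := (A.param α).dom_open
  rwa [h, inter_univ]

theorem isOpen_nbhd (α : ι) : IsOpen (A.nbhd α) := by
  obtain ⟨O, hO, h⟩ := (A.param α).openMap univ isOpen_univ
  rw [inter_univ, univ_inter] at h
  rwa [nbhd, h]

theorem isOpen_overlap (α β : ι) : IsOpen (A.overlap α β) :=
  (A.continuousOn_chart β).isOpen_inter_preimage (A.isOpen_dom β) (A.isOpen_nbhd α)

theorem isDiffeo_transition (α β : ι) : IsDiffeo (A.overlap α β) (A.overlap β α)
    (fun y => A.chartInv α (A.chart β y)) (fun y => A.chartInv β (A.chart α y)) := by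
  have h1 : ∀ α β : ι, ∀ y ∈ A.overlap α β, A.chartInv α (A.chart β y) ∈ A.overlap β α := by
    rintro α β y ⟨hy, hy'⟩
    refine ⟨A.chartInv_mem hy', ?_⟩
    rw [mem_preimage, A.chart_chartInv hy']
    exact A.chart_mem hy
  have h2 : ∀ α β : ι, ∀ y ∈ A.overlap α β,
      A.chartInv β (A.chart α (A.chartInv α (A.chart β y))) = y := by
    rintro α β y ⟨hy, hy'⟩
    rw [A.chart_chartInv hy', A.chartInv_chart hy]
  exact ⟨A.isOpen_overlap α β, A.isOpen_overlap β α, A.transition_smooth α β,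
    A.transition_smooth β α, h1 α β, h1 β α, h2 α β, h2 β α⟩

variable [MeasurableSpace X] [BorelSpace X]

theorem measurableSet_nbhd_inter_preimage (α : ι) {T : Set (Eucl (n + 1))}
    (hT : MeasurableSet T) : MeasurableSet (A.nbhd α ∩ A.chartInv α ⁻¹' T) := by
  have hc := (continuousOn_iff_continuous_domRestrict.1 (A.continuousOn_chartInv α)).measurable hT
  have := (A.isOpen_nbhd α).measurableSet.subtype_image hc
  convert this using 1
  ext x
  simp [and_comm]

/-- A null set in one chart is null in all others because coordinate changes preserve null sets.
Functions given almost everywhere in chart coordinates thus define classes on `X`. -/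
theorem ae_chartInv [Countable ι] {p : Eucl (n + 1) → Prop} (hp : ∀ᵐ z, p z) (α : ι) :
    ∀ᵐ x ∂A.chartMeasure, x ∈ A.nbhd α → p (A.chartInv α x) := by
  -- A measurable null hull of the exceptional set is needed to pass to the pushforward measures.
  set T := toMeasurable volume {z : Eucl (n + 1) | ¬ p z} with hT
  have hTm : MeasurableSet T := measurableSet_toMeasurable _ _
  have hT0 : ∀ᵐ z, z ∉ T := by
    rw [ae_iff] at hp ⊢
    simpa [hT, measure_toMeasurable] using hp
  have hsub : ∀ z, z ∉ T → p z := fun z hz => by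
    by_contra h
    exact hz (subset_toMeasurable _ _ h)
  have key : ∀ᵐ x ∂A.chartMeasure, x ∉ A.nbhd α ∩ A.chartInv α ⁻¹' T := by
    refine A.ae_chartMeasure_of (A.measurableSet_nbhd_inter_preimage α hTm).compl fun β => ?_
    have h := (A.isDiffeo_transition α β).ae_comp (ae_restrict_of_ae hT0)
    rw [ae_restrict_iff' (A.isOpen_overlap α β).measurableSet] at h
    rw [ae_restrict_iff' (A.measurableSet_dom β)]
    filter_upwards [h] with y hy hyd hmem
    exact hy ⟨hyd, hmem.1⟩ hmem.2
  filter_upwards [key] with x hx hxα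
  exact hsub _ fun h => hx ⟨hxα, h⟩

variable {𝕜 : Type*} [RCLike 𝕜]

/-- The inverse chart is arbitrary off `U_α`, but the cutoff vanishes there; on `U_α` both are
continuous. -/
theorem measurable_cutoff_smul (α : ι) {g : Eucl (n + 1) → 𝕜} (hg : StronglyMeasurable g) :
    StronglyMeasurable fun x => A.cutoff α x • g (A.chartInv α x) := by
  have hm : MeasurableSet (A.nbhd α) := (A.isOpen_nbhd α).measurableSet
  have hinv : Measurable ((A.nbhd α).domRestrict (A.chartInv α)) :=
    (continuousOn_iff_continuous_domRestrict.1 (A.continuousOn_chartInv α)).measurable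
  have hcut : ContinuousOn (A.cutoff α) (A.nbhd α) := by
    have := (A.cutoff_smooth α).continuousOn.comp (A.continuousOn_chartInv α)
      fun x hx => A.chartInv_mem hx
    refine this.congr fun x hx => ?_
    simp only [Function.comp_apply, A.chart_chartInv hx]
  have hcut' : Measurable ((A.nbhd α).domRestrict (A.cutoff α)) :=
    (continuousOn_iff_continuous_domRestrict.1 hcut).measurable
  refine Measurable.stronglyMeasurable (measurable_of_restrict_of_restrict_compl hm ?_ ?_)
  · exact hcut'.smul (hg.measurable.comp hinv)
  · convert measurable_const (a := (0 : 𝕜)) using 1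
    funext x
    simp [A.cutoff_eq_zero (mem_univ _) x.2]

end Boundaryless

end ManifoldAtlas


/-! ### Gluing functions given in the charts. -/

/-- The constant in the estimate of a localized function in another chart. -/
noncomputable def transferConst (m k : ℕ) (C : ℝ≥0) : ℝ≥0 :=
  2 ^ k * C * ((1 + m * 2 ^ k * C) ^ k * ((1 + m.factorial * C ^ m) * (2 ^ k * C)))

namespace ManifoldAtlas

section Glue

variable {n : ℕ} {X : Type*} [EMetricSpace X] [ChartedSpace (Eucl (n + 1)) X]
  {ι' : Type*} {A : ManifoldAtlas n univ (univ : Set X) ι'} {N₀ k : ℕ} {Chat : ℕ → ℝ}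
  {𝕜 : Type*} [RCLike 𝕜]

/-- The index `k + 1` lets one constant serve both the cutoffs and the coordinate changes, for which
`k + 1` derivatives are used. -/
theorem Admissible.derivBound_cutoff (h : A.Admissible N₀ Chat) (k : ℕ) (α : ι') :
    DerivBound (A.dom α) (Chat (k + 1)).toNNReal k fun y => A.cutoff α (A.chart α y) :=
  derivBound_of_partialWithin (A.isOpen_dom α) (A.cutoff_smooth α) fun j hj κ y hy =>
    (h.cutoff_bound α (k + 1) j (by lia) κ y hy).trans (Real.le_coe_toNNReal _)

theorem Admissible.derivBound_transition (h : A.Admissible N₀ Chat) (k : ℕ) (α β : ι')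
    (l : Fin (n + 1)) :
    DerivBound (A.overlap α β) (Chat k).toNNReal k fun y => A.chartInv α (A.chart β y) l := by
  have hs : ContDiffOn ℝ ∞ (fun y => A.chartInv α (A.chart β y)) (A.overlap α β) :=
    A.transition_smooth α β
  refine derivBound_of_partialWithin (A.isOpen_overlap α β) (contDiffOn_coord hs l)
    fun j hj κ y hy => ?_
  have e := partialWithin_clm_comp (EuclideanSpace.proj (𝕜 := ℝ) l) (A.isOpen_overlap α β) hs κ hy
  change |partialWithin κ (fun z => EuclideanSpace.proj (𝕜 := ℝ) l (A.chartInv α (A.chart β z)))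
    (A.overlap α β) y| ≤ _
  rw [e]
  exact (PiLp.norm_apply_le _ l).trans
    ((h.transition_bound α β k j hj κ y hy).trans (Real.le_coe_toNNReal _))

/-- The function `χ_β χ_α (g ∘ φ_α⁻¹)` in the chart `φ_β`. -/
theorem Admissible.sobBound_transfer (h : A.Admissible N₀ Chat) (α β : ι')
    {g : Eucl (n + 1) → 𝕜} {R : ℝ≥0} (hg : SobBound univ R k g) :
    SobBound (A.dom β) (transferConst (n + 1) k (Chat (k + 1)).toNNReal * R) k
      ((A.overlap α β).indicator fun y => A.cutoff β (A.chart β y) •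
        (A.cutoff α (A.chart β y) • g (A.chartInv α (A.chart β y)))) := by
  set C := (Chat (k + 1)).toNNReal with hC
  have hd := A.isDiffeo_transition α β
  have hsub : A.overlap β α ⊆ A.dom α := inter_subset_left
  have hsub' : A.overlap α β ⊆ A.dom β := inter_subset_left
  -- The three factors of `transferConst` arise in turn: multiplication by `χ_α`, the coordinate
  -- change (`h2`) and multiplication by `χ_β` (`h3`).
  have h1 : SobBound (A.overlap β α) (2 ^ k * C * R) k
      fun z => A.cutoff α (A.chart α z) • g z :=
    (hg.mono (subset_univ _) le_rfl).smul hd.open₂ ((A.cutoff_smooth α).mono hsub)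
      ((h.derivBound_cutoff k α).mono hsub)
  have hj : ∀ z ∈ A.overlap β α, |jac (fun y => A.chartInv β (A.chart α y)) z| ≤
      ((1 + (n + 1).factorial * C ^ (n + 1) : ℝ≥0) : ℝ) := by
    intro z hz
    refine (abs_jac_le (C := C) fun i l =>
      ((h.derivBound_transition (k + 1) β α l).2 i).bound z hz).trans ?_
    push_cast
    linarith
  have h2 := hd.sobBound_comp (le_add_of_nonneg_right zero_le) hj
    (fun l => h.derivBound_transition (k + 1) α β l) h1
  have h3 := h2.smul hd.open₁ ((A.cutoff_smooth β).mono hsub')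
    ((h.derivBound_cutoff k β).mono hsub')
  obtain ⟨K₁, hK₁, hKc₁, h01⟩ := A.cutoff_support α
  obtain ⟨K₂, hK₂, hKc₂, h02⟩ := A.cutoff_support β
  -- The product of both cutoffs is supported in a compact subset of the overlap, so extension by
  -- zero to the whole of `V_β` costs nothing. One cutoff alone would not suffice.
  have hKc : IsCompact (A.chartInv β '' (K₁ ∩ K₂)) :=
    (hKc₁.inter hKc₂).image_of_continuousOn
      ((A.continuousOn_chartInv β).mono (inter_subset_right.trans hK₂))
  have hKsub : A.chartInv β '' (K₁ ∩ K₂) ⊆ A.overlap α β := by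
    rintro _ ⟨x, ⟨hx1, hx2⟩, rfl⟩
    refine ⟨A.chartInv_mem (hK₂ hx2), ?_⟩
    rw [mem_preimage, A.chart_chartInv (hK₂ hx2)]
    exact hK₁ hx1
  have hcut : ∀ y ∈ A.overlap α β, A.cutoff α (A.chart α (A.chartInv α (A.chart β y))) =
      A.cutoff α (A.chart β y) := fun y hy => by rw [A.chart_chartInv hy.2]
  have h4 := h3.indicator hd.open₁ hsub' hKc.isClosed (inter_subset_left.trans hKsub) (by
    refine (ae_restrict_iff' (hd.open₁.measurableSet.diff hKc.isClosed.measurableSet)).2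
      (Eventually.of_forall fun y hy => ?_)
    simp only [Pi.zero_apply]
    rw [hcut y hy.1]
    have : A.chart β y ∉ K₁ ∩ K₂ := fun hm => hy.2 ⟨_, hm, A.chartInv_chart hy.1.1⟩
    rw [mem_inter_iff, not_and_or] at this
    rcases this with h' | h'
    · rw [h01 _ (mem_univ _) h', zero_smul, smul_zero]
    · rw [h02 _ (mem_univ _) h', zero_smul])
  have e : (A.overlap α β).indicator (fun y => A.cutoff β (A.chart β y) •
        (A.cutoff α (A.chart β y) • g (A.chartInv α (A.chart β y)))) =
      (A.overlap α β).indicator fun y => A.cutoff β (A.chart β y) •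
        (A.cutoff α (A.chart α (A.chartInv α (A.chart β y))) •
          g (A.chartInv α (A.chart β y))) :=
    indicator_congr fun y hy => by rw [hcut y hy]
  rw [e]
  convert h4 using 1
  rw [transferConst]
  ring

variable {ι : Type*} (A) (e : ι ↪ ι')

/-- The function `∑_α χ_α (g_α ∘ φ_α⁻¹)`. -/
noncomputable def glue (g : ι → Eucl (n + 1) → 𝕜) (x : X) : 𝕜 :=
  ∑ᶠ α, A.cutoff (e α) x • g α (A.chartInv (e α) x)

variable {A}

theorem Admissible.finite_meets (h : A.Admissible N₀ Chat) (β : ι') :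
    {α : ι | (A.nbhd β ∩ A.nbhd (e α)).Nonempty}.Finite :=
  Finite.preimage (f := e) (s := {γ | (A.nbhd β ∩ A.nbhd γ).Nonempty}) e.injective.injOn
    (finite_of_encard_le_coe (h.multiplicity β))

/-- The indices of the charts that meet `U_β`. -/
noncomputable def Admissible.meets (h : A.Admissible N₀ Chat) (β : ι') : Finset ι :=
  (h.finite_meets e β).toFinset

theorem Admissible.mem_meets (h : A.Admissible N₀ Chat) {β : ι'} {α : ι} :
    α ∈ h.meets e β ↔ (A.nbhd β ∩ A.nbhd (e α)).Nonempty := by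
  simp [Admissible.meets]

theorem Admissible.card_meets_le (h : A.Admissible N₀ Chat) (β : ι') :
    (h.meets e β).card ≤ N₀ := by
  have h1 : (h.meets e β : Set ι).encard ≤ N₀ := by
    refine le_trans ?_ (h.multiplicity β)
    rw [← e.injective.encard_image]
    refine encard_le_encard ?_
    rintro _ ⟨α, hα, rfl⟩
    exact (h.mem_meets e).1 hα
  rw [encard_coe_eq_coe_finsetCard] at h1
  exact_mod_cast h1

/-- On `U_β` only charts meeting `U_β` contribute. The index set is finite and the same for all
points of `U_β`. -/
theorem Admissible.glue_eq_sum (h : A.Admissible N₀ Chat) (g : ι → Eucl (n + 1) → 𝕜) {β : ι'}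
    {x : X} (hx : x ∈ A.nbhd β) :
    A.glue e g x = ∑ α ∈ h.meets e β, A.cutoff (e α) x • g α (A.chartInv (e α) x) := by
  refine finsum_eq_sum_of_support_subset _ fun α hα => ?_
  rw [Finset.mem_coe, h.mem_meets]
  by_contra hne
  refine hα ?_
  change A.cutoff (e α) x • _ = 0
  rw [A.cutoff_eq_zero (mem_univ _) fun h' => hne ⟨x, hx, h'⟩, zero_smul]

theorem exists_mem_nbhd (x : X) : ∃ β, x ∈ A.nbhd β := by
  have : x ∈ ⋃ β, A.chart β '' A.dom β := by rw [A.cover]; exact mem_univ x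
  exact mem_iUnion.1 this

theorem Admissible.glue_add (h : A.Admissible N₀ Chat) (g g' : ι → Eucl (n + 1) → 𝕜) :
    A.glue e (g + g') = A.glue e g + A.glue e g' := by
  funext x
  obtain ⟨β, hβ⟩ := A.exists_mem_nbhd x
  rw [Pi.add_apply, h.glue_eq_sum e _ hβ, h.glue_eq_sum e _ hβ, h.glue_eq_sum e _ hβ,
    ← Finset.sum_add_distrib]
  simp only [Pi.add_apply, smul_add]

theorem Admissible.glue_smul (h : A.Admissible N₀ Chat) (a : 𝕜) (g : ι → Eucl (n + 1) → 𝕜) :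
    A.glue e (a • g) = a • A.glue e g := by
  funext x
  obtain ⟨β, hβ⟩ := A.exists_mem_nbhd x
  rw [Pi.smul_apply, h.glue_eq_sum e _ hβ, h.glue_eq_sum e _ hβ, Finset.smul_sum]
  simp only [Pi.smul_apply, smul_comm a]

theorem Admissible.sobolevNormSq_glue_le (h : A.Admissible N₀ Chat)
    {g : ι → Eucl (n + 1) → 𝕜} {R : ι → ℝ≥0} (hg : ∀ α, SobBound univ (R α) k (g α)) (β : ι') :
    sobolevNormSq k (A.dom β) (A.localized β (A.glue e g)) ≤
      ∑ α ∈ h.meets e β, ((derivCount (n + 1) k *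
        transferConst (n + 1) k (Chat (k + 1)).toNNReal) ^ 2 * N₀ * R α ^ 2 : ℝ≥0) := by
  set c := transferConst (n + 1) k (Chat (k + 1)).toNNReal
  have h1 := SobBound.sum (A.isOpen_dom β) (h.meets e β) fun α _ =>
    h.sobBound_transfer (e α) β (hg α)
  have h2 : SobBound (A.dom β) (∑ α ∈ h.meets e β, c * R α) k (A.localized β (A.glue e g)) := by
    refine h1.congr (A.isOpen_dom β) ?_
    filter_upwards [ae_restrict_mem (A.measurableSet_dom β)] with y hy
    rw [localized, h.glue_eq_sum e _ (A.chart_mem hy), Finset.sum_apply, Finset.smul_sum]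
    refine Finset.sum_congr rfl fun α _ => ?_
    by_cases hy' : A.chart β y ∈ A.nbhd (e α)
    · rw [indicator_of_mem (show y ∈ A.overlap (e α) β from ⟨hy, hy'⟩)]
    · rw [indicator_of_notMem fun h' => hy' h'.2, A.cutoff_eq_zero (mem_univ _) hy', zero_smul,
        smul_zero]
  have e1 : interior (A.dom β) = A.dom β := (A.isOpen_dom β).interior_eq
  rw [← e1] at h2
  refine h2.sobolevNormSq_le_sq.trans ?_
  rw [← Finset.mul_sum, ← ENNReal.coe_pow, ENNReal.coe_le_coe,
    ← Finset.mul_sum, ← mul_assoc, mul_pow, mul_assoc _ (N₀ : ℝ≥0)]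
  -- Cauchy–Schwarz over at most `N₀` terms.
  refine mul_le_mul_right (sq_sum_le_card_mul_sum_sq.trans ?_) _
  refine mul_le_mul_left ?_ _
  exact_mod_cast h.card_meets_le e β

theorem Admissible.normSq_glue_le (h : A.Admissible N₀ Chat)
    {g : ι → Eucl (n + 1) → 𝕜} {R : ι → ℝ≥0} (hg : ∀ α, SobBound univ (R α) k (g α)) :
    A.normSq k (A.glue e g) ≤ ((N₀ * (derivCount (n + 1) k *
      transferConst (n + 1) k (Chat (k + 1)).toNNReal) : ℝ≥0) : ℝ≥0∞) ^ 2 *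
        ∑' α, (R α : ℝ≥0∞) ^ 2 := by
  set c := derivCount (n + 1) k * transferConst (n + 1) k (Chat (k + 1)).toNNReal
  have h1 : ∀ β, sobolevNormSq k (A.dom β) (A.localized β (A.glue e g)) ≤
      ∑' α, {β | (A.nbhd (e α) ∩ A.nbhd β).Nonempty}.indicator
        (fun _ => ((c ^ 2 * N₀ * R α ^ 2 : ℝ≥0) : ℝ≥0∞)) β := by
    intro β
    refine (h.sobolevNormSq_glue_le e hg β).trans ?_
    rw [ENNReal.ofNNReal_finsetSum]
    refine le_trans (Finset.sum_le_sum fun α hα => ?_) (ENNReal.sum_le_tsum (h.meets e β))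
    have hm : β ∈ {β | (A.nbhd (e α) ∩ A.nbhd β).Nonempty} := by
      have := (h.mem_meets e).1 hα
      rwa [inter_comm] at this
    rw [indicator_of_mem hm]
  refine (ENNReal.tsum_le_tsum h1).trans ?_
  -- After exchanging the sums, each `α` is counted once for every `β` whose chart meets its own,
  -- hence at most `N₀` times.
  rw [ENNReal.tsum_comm, ← ENNReal.tsum_mul_left]
  refine ENNReal.tsum_le_tsum fun α => ?_
  rw [← tsum_subtype, ENNReal.tsum_const]
  have h2 : ((ENat.card {β | (A.nbhd (e α) ∩ A.nbhd β).Nonempty} : ℕ∞) : ℝ≥0∞) ≤ N₀ := by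
    have := h.multiplicity (e α)
    exact_mod_cast this
  refine (mul_le_mul_left h2 _).trans_eq ?_
  push_cast
  ring

variable [MeasurableSpace X] [BorelSpace X]

theorem glue_congr [Countable ι] [Countable ι'] {g g' : ι → Eucl (n + 1) → 𝕜}
    (h : ∀ α, g α =ᵐ[volume] g' α) : A.glue e g =ᵐ[A.chartMeasure] A.glue e g' := by
  filter_upwards [ae_all_iff.2 fun α => A.ae_chartInv (h α) (e α)] with x hx
  refine finsum_congr fun α => ?_
  by_cases hxα : x ∈ A.nbhd (e α)
  · rw [hx α hxα]
  · rw [A.cutoff_eq_zero (mem_univ _) hxα, zero_smul, zero_smul]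

/-- The measure is a sum over the charts, and for each summand the glued function agrees almost
everywhere with a finite sum of measurable functions. -/
theorem Admissible.aestronglyMeasurable_glue [Countable ι'] (h : A.Admissible N₀ Chat)
    {g : ι → Eucl (n + 1) → 𝕜} (hg : ∀ α, StronglyMeasurable (g α)) :
    AEStronglyMeasurable (A.glue e g) A.chartMeasure := by
  refine aestronglyMeasurable_sum_measure_iff.2 fun β => ?_
  have h1 : StronglyMeasurable fun x => ∑ α ∈ h.meets e β,
      A.cutoff (e α) x • g α (A.chartInv (e α) x) :=
    Finset.stronglyMeasurable_fun_sum _ fun α _ => A.measurable_cutoff_smul (e α) (hg α)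
  refine h1.aestronglyMeasurable.congr ?_
  have h2 : ∀ᵐ x ∂(volume.restrict (A.dom β)).map (A.chart β), x ∈ A.nbhd β := by
    refine (ae_map_iff (A.aemeasurable_chart β) (A.isOpen_nbhd β).measurableSet).2 ?_
    filter_upwards [ae_restrict_mem (A.measurableSet_dom β)] with y hy
    exact A.chart_mem hy
  filter_upwards [h2] with x hx
  rw [h.glue_eq_sum e _ hx]

end Glue

end ManifoldAtlas


/-! ### Localization on `M` and the extension operator. -/

section Extension

variable {n k : ℕ} {X : Type*} [EMetricSpace X] [ChartedSpace (Eucl (n + 1)) X]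
  {𝕜 : Type*} [RCLike 𝕜] {M : Set X} {ι : Type*}

namespace ManifoldAtlas

variable (A : ManifoldAtlas n (halfSpace n) M ι)

theorem dom_subset_halfSpace (α : ι) : A.dom α ⊆ halfSpace n := by
  obtain ⟨O, -, h⟩ := (A.param α).dom_open
  rw [h]
  exact inter_subset_right

theorem mem_interior_dom {α : ι} {y : Eucl (n + 1)} (hy : y ∈ A.dom α)
    (hy' : y ∈ interior (halfSpace n)) : y ∈ interior (A.dom α) := by
  obtain ⟨O, hO, h⟩ := (A.param α).dom_open
  refine mem_interior.2 ⟨O ∩ interior (halfSpace n), ?_, hO.inter isOpen_interior, ?_, hy'⟩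
  · rw [h]
    exact inter_subset_inter_right O interior_subset
  · rw [h] at hy
    exact hy.1

/-- The compact support of `χ_α` may touch the boundary hyperplane. Its part in the open half-space
nevertheless lies in the interior of `V_α`, which is all that extension by zero within the
half-space requires. -/
theorem sobBound_indicator_localized (α : ι) {u : X → 𝕜} {R : ℝ≥0}
    (h : sobolevNormSq k (A.dom α) (A.localized α u) ≤ (R : ℝ≥0∞) ^ 2) :
    SobBound (interior (halfSpace n)) R k ((A.dom α).indicator (A.localized α u)) := by
  obtain ⟨K, hK, hKc, h0⟩ := A.exists_compact_cutoff α
  have h1 := (sobBound_of_sobolevNormSq_le h).indicator isOpen_interior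
    (interior_mono (A.dom_subset_halfSpace α)) hKc.isClosed
    (fun y hy => A.mem_interior_dom (hK hy.1) hy.2)
    ((ae_restrict_iff' (isOpen_interior.measurableSet.diff hKc.isClosed.measurableSet)).2
      (Eventually.of_forall fun y hy => by
        simp only [localized, h0 y (interior_subset hy.1) hy.2, zero_smul, Pi.zero_apply]))
  refine h1.congr isOpen_interior ?_
  filter_upwards [ae_restrict_mem isOpen_interior.measurableSet] with y hy
  by_cases hy' : y ∈ A.dom α
  · rw [indicator_of_mem hy', indicator_of_mem (A.mem_interior_dom hy' hy)]
  · rw [indicator_of_notMem hy', indicator_of_notMem fun h => hy' (interior_subset h)]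

variable [MeasurableSpace X] [BorelSpace X]

/-- The function `χ_α u_α`, extended by zero, is measurable. -/
theorem aestronglyMeasurable_indicator_localized (α : ι) {u : X → 𝕜} (hu : StronglyMeasurable u) :
    AEStronglyMeasurable ((A.dom α).indicator (A.localized α u))
      (volume.restrict (interior (halfSpace n))) :=
  ((aestronglyMeasurable_indicator_iff (A.measurableSet_dom α)).2
    (A.aestronglyMeasurable_localized α hu)).mono_measure Measure.restrict_le_self

theorem indicator_localized_congr (α : ι) {u v : X → 𝕜} (h : u =ᵐ[A.chartMeasure] v) :
    (A.dom α).indicator (A.localized α u) =ᵐ[volume.restrict (interior (halfSpace n))]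
      (A.dom α).indicator (A.localized α v) := by
  have h1 := (ae_restrict_iff' isOpen_interior.measurableSet).1 (A.ae_chart h α)
  filter_upwards [ae_restrict_of_ae h1, ae_restrict_mem isOpen_interior.measurableSet] with y hy hyH
  by_cases hy' : y ∈ A.dom α
  · rw [indicator_of_mem hy', indicator_of_mem hy', localized, localized,
      hy (A.mem_interior_dom hy' hyH)]
  · rw [indicator_of_notMem hy', indicator_of_notMem hy']

theorem sobolevNormSq_localized_lt_top (α : ι) (u : A.Sobolev 𝕜 k) :
    sobolevNormSq k (A.dom α) (A.localized α u.1) < ⊤ :=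
  (ENNReal.le_tsum α).trans_lt u.2

theorem sobolevNormSq_indicator_localized_le (α : ι) (u : A.Sobolev 𝕜 k) :
    sobolevNormSq k (halfSpace n) ((A.dom α).indicator (A.localized α u.1)) ≤
      (derivCount (n + 1) k : ℝ≥0∞) ^ 2 * sobolevNormSq k (A.dom α) (A.localized α u.1) := by
  obtain ⟨R, hR⟩ := exists_nnreal_sq_eq (A.sobolevNormSq_localized_lt_top α u).ne
  refine (A.sobBound_indicator_localized α hR.ge).sobolevNormSq_le_sq.trans_eq ?_
  rw [ENNReal.coe_mul, mul_pow, hR]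

/-- The localization `u ↦ χ_α u_α`, as a map into the Sobolev space of the half-space. -/
noncomputable def localize (k : ℕ) (α : ι) :
    A.Sobolev 𝕜 k →ₗ[𝕜] SobolevSpace 𝕜 k (halfSpace n) where
  toFun u := ⟨AEEqFun.mk _ (A.aestronglyMeasurable_indicator_localized α u.1.stronglyMeasurable), by
    change sobolevNormSq k (halfSpace n) (AEEqFun.mk _ _) < ⊤
    rw [sobolevNormSq_congr (AEEqFun.coeFn_mk _ _)]
    exact (A.sobolevNormSq_indicator_localized_le α u).trans_lt (ENNReal.mul_lt_top
      (ENNReal.pow_lt_top ENNReal.coe_lt_top) (A.sobolevNormSq_localized_lt_top α u))⟩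
  map_add' u v := by
    refine Subtype.ext (AEEqFun.ext ?_)
    refine (AEEqFun.coeFn_mk _ _).trans ?_
    refine (A.indicator_localized_congr α (AEEqFun.coeFn_add u.1 v.1)).trans ?_
    have e : A.localized α (⇑u.1 + ⇑v.1) = A.localized α u.1 + A.localized α v.1 := by
      funext y
      simp [localized, smul_add]
    rw [e, indicator_add']
    exact ((AEEqFun.coeFn_add _ _).trans
      ((AEEqFun.coeFn_mk _ _).add (AEEqFun.coeFn_mk _ _))).symm
  map_smul' a u := by
    refine Subtype.ext (AEEqFun.ext ?_)
    refine (AEEqFun.coeFn_mk _ _).trans ?_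
    refine (A.indicator_localized_congr α (AEEqFun.coeFn_smul a u.1)).trans ?_
    have e : (A.dom α).indicator (A.localized α (a • ⇑u.1)) =
        a • (A.dom α).indicator (A.localized α u.1) := by
      funext y
      by_cases hy : y ∈ A.dom α <;> simp [hy, localized]
    rw [e]
    exact ((AEEqFun.coeFn_smul _ _).trans ((AEEqFun.coeFn_mk _ _).const_smul a)).symm

theorem localize_ae_eq (α : ι) (u : A.Sobolev 𝕜 k) :
    ⇑(A.localize k α u).1 =ᵐ[volume.restrict (interior (halfSpace n))]
      (A.dom α).indicator (A.localized α u.1) :=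
  AEEqFun.coeFn_mk _ _

end ManifoldAtlas

variable [MeasurableSpace X] [BorelSpace X] {ι' : Type*} {r₀ : ℝ} {A : ManifoldAtlas n (halfSpace n) M ι}
  {A' : ManifoldAtlas n univ (univ : Set X) ι'} {e : ι ↪ ι'}
  [RiemannianBundle (fun x : X => TangentSpace (𝓡 (n + 1)) x)]

/-- If each `g_α` extends `χ_α u_α`, then `∑_α χ_α (g_α ∘ φ_α⁻¹)` extends `u`. -/
theorem AssociatedAtlases.glue_ae_eq [Countable ι] [Countable ι']
    (h : AssociatedAtlases n r₀ A A' e) {u : X → 𝕜} {g : ι → Eucl (n + 1) → 𝕜}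
    (hg : ∀ α, g α =ᵐ[volume.restrict (interior (halfSpace n))]
      (A.dom α).indicator (A.localized α u))
    {v : X → 𝕜} (hv : v =ᵐ[A'.chartMeasure] A'.glue e g)
    (huv : MeasurableSet {x | v x = u x}) : v =ᵐ[A.chartMeasure] u := by
  have hg' : ∀ α, ∀ᵐ z : Eucl (n + 1), z ∈ A.dom α → g α z = A.localized α u z := by
    intro α
    filter_upwards [(ae_restrict_iff' isOpen_interior.measurableSet).1 (hg α), ae_coord_ne_zero]
      with z hz hz0 hzd
    have h1 : z ∈ interior (halfSpace n) := by
      rw [interior_halfSpace]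
      exact lt_of_le_of_ne (A.dom_subset_halfSpace α hzd) hz0.symm
    rw [hz h1, indicator_of_mem hzd]
  refine A.ae_chartMeasure_of huv fun β => ?_
  have key : ∀ᵐ x ∂A'.chartMeasure, x ∈ M → v x = u x := by
    filter_upwards [hv, ae_all_iff.2 fun α => A'.ae_chartInv (hg' α) (e α)] with x hx hxα hxM
    -- At points of `M` the two inverse charts and the two cutoffs coincide. One factor `χ_α` comes
    -- from the localization, the other from the gluing.
    have hterm : ∀ α, A'.cutoff (e α) x • g α (A'.chartInv (e α) x) = A.cutoff α x ^ 2 • u x := by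
      intro α
      by_cases hxn : x ∈ A'.nbhd (e α)
      · have hxA : x ∈ A.nbhd α := by
          rw [h.nbhd_eq]
          exact ⟨hxn, hxM⟩
        have h1 := A.chartInv_mem hxA
        have h2 : A.chart α (A.chartInv α x) = x := A.chart_chartInv hxA
        have h3 : A'.chartInv (e α) x = A.chartInv α x := by
          have h4 : A.chartInv α x ∈ A'.dom (e α) := by
            rw [h.dom_eq] at h1
            exact h1.1
          conv_lhs => rw [← h2, h.chart_eq α h1]
          exact A'.chartInv_chart h4
        have h5 := hxα α hxn
        rw [h3] at h5 ⊢
        rw [h5 h1, ManifoldAtlas.localized, h2, h.cutoff_eq α hxM, smul_smul, pow_two]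
      · rw [h.cutoff_eq α hxM, A'.cutoff_eq_zero (mem_univ _) hxn, zero_smul, zero_pow two_ne_zero,
          zero_smul]
    rw [hx, ManifoldAtlas.glue, finsum_congr hterm, ← finsum_smul, A.cutoff_sum x hxM, one_smul]
  -- Each chart of `M` restricts a chart of `X`, so null sets for the measure on `X` remain null in
  -- it.
  have h1 : ∀ᵐ y ∂volume.restrict (A.dom β), A'.chart (e β) y ∈ M →
      v (A'.chart (e β) y) = u (A'.chart (e β) y) := by
    have h2 := A'.ae_chart key (e β)
    rw [(A'.isOpen_dom (e β)).interior_eq] at h2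
    refine ae_mono (Measure.restrict_mono ?_ le_rfl) h2
    rw [h.dom_eq]
    exact inter_subset_left
  filter_upwards [h1, ae_restrict_mem (A.measurableSet_dom β)] with y hy hyd
  rw [h.chart_eq β hyd]
  refine hy ?_
  rw [← h.chart_eq β hyd]
  exact (A.param β).mapsTo hyd

/-- The operator glues the functions `E₀(χ_α u_α)`. The factors of its bound come from the gluing
estimate, from `E₀` (`c`) and from the extension by zero to the half-space (the last `derivCount`).
-/
theorem AssociatedAtlases.exists_extension [Countable ι] [Countable ι']
    (h : AssociatedAtlases n r₀ A A' e) {N₀ : ℕ} {Chat : ℕ → ℝ} (hA' : A'.Admissible N₀ Chat)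
    (E₀ : SobolevSpace 𝕜 k (halfSpace n) →ₗ[𝕜] SobolevSpace 𝕜 k (univ : Set (Eucl (n + 1))))
    (hE₀ : ∀ f, ⇑(E₀ f).1 =ᵐ[volume.restrict (interior (halfSpace n))] ⇑f.1)
    {c : ℝ≥0} (hc : ∀ f, sobolevNorm (E₀ f) ≤ c * sobolevNorm f) :
    ∃ E : A.Sobolev 𝕜 k →ₗ[𝕜] A'.Sobolev 𝕜 k,
      (∀ u, ⇑(E u).1 =ᵐ[A.chartMeasure] ⇑u.1) ∧
      (∀ u, A'.sobolevNorm (E u) ≤ (N₀ * (derivCount (n + 1) k *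
        transferConst (n + 1) k (Chat (k + 1)).toNNReal) * (c * derivCount (n + 1) k) : ℝ≥0) *
          A.sobolevNorm u) ∧
      ∀ u, ⇑(E u).1 =ᵐ[A'.chartMeasure] A'.glue e fun α => ⇑(E₀ (A.localize k α u)).1 := by
  set g : A.Sobolev 𝕜 k → ι → Eucl (n + 1) → 𝕜 :=
    fun u α => ⇑(E₀ (A.localize k α u)).1 with hgdef
  have hm : ∀ u, AEStronglyMeasurable (A'.glue e (g u)) A'.chartMeasure := fun u =>
    hA'.aestronglyMeasurable_glue e fun α => (E₀ (A.localize k α u)).1.stronglyMeasurable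
  have hbound : ∀ u : A.Sobolev 𝕜 k, A'.normSq k (A'.glue e (g u)) ≤
      ((N₀ * (derivCount (n + 1) k * transferConst (n + 1) k (Chat (k + 1)).toNNReal) *
        (c * derivCount (n + 1) k) : ℝ≥0) : ℝ≥0∞) ^ 2 * A.normSq k u.1 := by
    intro u
    choose R hR using fun α => exists_nnreal_sq_eq (A.sobolevNormSq_localized_lt_top α u).ne
    have hgR : ∀ α, SobBound univ (c * derivCount (n + 1) k * R α) k (g u α) := by
      intro α
      rw [← interior_univ]
      refine sobBound_of_sobolevNormSq_le ?_
      refine (sqrt_le_mul_sqrt_iff.1 (hc (A.localize k α u))).trans ?_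
      rw [sobolevNormSq_congr (A.localize_ae_eq α u), mul_assoc, ENNReal.coe_mul, mul_pow]
      refine mul_le_mul_right ((A.sobolevNormSq_indicator_localized_le α u).trans_eq ?_) _
      rw [ENNReal.coe_mul, mul_pow, hR]
    have e1 : ∑' α, ((c * derivCount (n + 1) k * R α : ℝ≥0) : ℝ≥0∞) ^ 2 =
        ((c * derivCount (n + 1) k : ℝ≥0) : ℝ≥0∞) ^ 2 * A.normSq k u.1 := by
      rw [ManifoldAtlas.normSq, ← ENNReal.tsum_mul_left]
      exact tsum_congr fun α => by rw [ENNReal.coe_mul _ (R α), mul_pow, hR]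
    refine (hA'.normSq_glue_le e hgR).trans_eq ?_
    rw [e1, ENNReal.coe_mul _ (c * derivCount (n + 1) k), mul_pow, mul_assoc]
  have hadd : ∀ {f f' : SobolevSpace 𝕜 k (univ : Set (Eucl (n + 1)))},
      ⇑(f + f').1 =ᵐ[volume] ⇑f.1 + ⇑f'.1 := by
    intro f f'
    have := AEEqFun.coeFn_add f.1 f'.1
    simpa only [interior_univ, Measure.restrict_univ] using! this
  have hsmul : ∀ {a : 𝕜} {f : SobolevSpace 𝕜 k (univ : Set (Eucl (n + 1)))},
      ⇑(a • f).1 =ᵐ[volume] a • ⇑f.1 := by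
    intro a f
    have := AEEqFun.coeFn_smul a f.1
    simpa only [interior_univ, Measure.restrict_univ] using! this
  let E : A.Sobolev 𝕜 k →ₗ[𝕜] A'.Sobolev 𝕜 k :=
    { toFun := fun u => ⟨AEEqFun.mk _ (hm u), by
        change A'.normSq k (AEEqFun.mk _ (hm u)) < ⊤
        rw [A'.normSq_congr (AEEqFun.coeFn_mk _ (hm u))]
        exact (hbound u).trans_lt
          (ENNReal.mul_lt_top (ENNReal.pow_lt_top ENNReal.coe_lt_top) u.2)⟩
      map_add' := fun u v => by
        refine Subtype.ext (AEEqFun.ext ?_)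
        refine (AEEqFun.coeFn_mk _ _).trans ?_
        have h1 : A'.glue e (g (u + v)) =ᵐ[A'.chartMeasure] A'.glue e (g u + g v) :=
          ManifoldAtlas.glue_congr e fun α => by
            simp only [hgdef, map_add]
            exact hadd
        refine h1.trans ?_
        rw [hA'.glue_add]
        exact ((AEEqFun.coeFn_add _ _).trans
          ((AEEqFun.coeFn_mk _ (hm u)).add (AEEqFun.coeFn_mk _ (hm v)))).symm
      map_smul' := fun a u => by
        refine Subtype.ext (AEEqFun.ext ?_)
        refine (AEEqFun.coeFn_mk _ _).trans ?_
        have h1 : A'.glue e (g (a • u)) =ᵐ[A'.chartMeasure] A'.glue e (a • g u) :=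
          ManifoldAtlas.glue_congr e fun α => by
            simp only [hgdef, map_smul]
            exact hsmul
        refine h1.trans ?_
        rw [hA'.glue_smul]
        exact ((AEEqFun.coeFn_smul _ _).trans ((AEEqFun.coeFn_mk _ (hm u)).const_smul a)).symm }
  have hE : ∀ u, ⇑(E u).1 =ᵐ[A'.chartMeasure] A'.glue e (g u) := fun u =>
    AEEqFun.coeFn_mk _ (hm u)
  refine ⟨E, fun u => ?_, fun u => ?_, hE⟩
  · refine h.glue_ae_eq (g := g u) (fun α => (hE₀ _).trans (A.localize_ae_eq α u)) (hE u) ?_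
    exact (E u).1.stronglyMeasurable.measurableSet_eq_fun u.1.stronglyMeasurable
  · rw [ManifoldAtlas.sobolevNorm, ManifoldAtlas.sobolevNorm, sqrt_le_mul_sqrt_iff,
      A'.normSq_congr (hE u)]
    exact hbound u

end Extension

end BoundedGeometry

theorem mainTheorem11 {𝕜 : Type*} [RCLike 𝕜] (n k : ℕ) :
    ∃ E₀ : BoundedGeometry.SobolevSpace 𝕜 k (BoundedGeometry.halfSpace n) →ₗ[𝕜]
        BoundedGeometry.SobolevSpace 𝕜 k (univ : Set (BoundedGeometry.Eucl (n + 1))),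
      (∀ f, ⇑(E₀ f).1 =ᵐ[volume.restrict (interior (BoundedGeometry.halfSpace n))] ⇑f.1) ∧
      (∃ c : ℝ≥0, ∀ f, BoundedGeometry.sobolevNorm (E₀ f) ≤ c * BoundedGeometry.sobolevNorm f) ∧
      ∀ (N₀ : ℝ → (ℕ → ℝ) → ℕ) (Chat : ℝ → (ℕ → ℝ) → ℕ → ℝ),
      ∃ K : ℝ → (ℕ → ℝ) → ℝ≥0,
      ∀ (r₀ : ℝ) (C : ℕ → ℝ), 0 < r₀ → (∀ l, 0 < C l) →
      ∀ (X : Type*) [EMetricSpace X] [CompleteSpace X] [SecondCountableTopology X]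
        [MeasurableSpace X] [BorelSpace X]
        [ChartedSpace (BoundedGeometry.Eucl (n + 1)) X] [IsManifold (𝓡 (n + 1)) ∞ X]
        [RiemannianBundle (fun x : X => TangentSpace (𝓡 (n + 1)) x)]
        [IsContMDiffRiemannianBundle (𝓡 (n + 1)) ∞ (BoundedGeometry.Eucl (n + 1))
          (fun x : X => TangentSpace (𝓡 (n + 1)) x)]
        [IsRiemannianManifold (𝓡 (n + 1)) X] (M : Set X),
      BoundedGeometry.HasBoundedGeometry n M r₀ C →
      BoundedGeometry.HasBoundedGeometry n (interior M)ᶜ r₀ C →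
      ∀ (ι ι' : Type*) [Countable ι] [Countable ι']
        (A : BoundedGeometry.ManifoldAtlas n (BoundedGeometry.halfSpace n) M ι)
        (A' : BoundedGeometry.ManifoldAtlas n univ (univ : Set X) ι') (e : ι ↪ ι'),
      BoundedGeometry.AssociatedAtlases n r₀ A A' e →
      A'.Admissible (N₀ r₀ C) (Chat r₀ C) →
      ∃ E : A.Sobolev 𝕜 k →ₗ[𝕜] A'.Sobolev 𝕜 k,
        (∀ u, ⇑(E u).1 =ᵐ[A.chartMeasure] ⇑u.1) ∧
        (∀ u, A'.sobolevNorm (E u) ≤ K r₀ C * A.sobolevNorm u) ∧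
        ∀ u, ∃ w : ι → BoundedGeometry.SobolevSpace 𝕜 k (BoundedGeometry.halfSpace n),
          (∀ α, ⇑(w α).1 =ᵐ[volume.restrict (interior (BoundedGeometry.halfSpace n))]
            (A.dom α).indicator (A.localized α u.1)) ∧
          ⇑(E u).1 =ᵐ[A'.chartMeasure]
            fun x => ∑ᶠ α, A'.cutoff (e α) x • (E₀ (w α)).1 (A'.chartInv (e α) x) := by
  obtain ⟨E₀, hE₀, c, hc⟩ := BoundedGeometry.exists_sobolevExtension (𝕜 := 𝕜) n k
  -- `K` is the constant of `AssociatedAtlases.exists_extension`, built from `N₀(r₀, C)`,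
  -- `Ĉ_{k+1}(r₀, C)`, `k`, the dimension and the bound `c` of `E₀`. It is chosen before `X`, `M`
  -- and the atlases.
  refine ⟨E₀, hE₀, ⟨c, hc⟩, fun N₀ Chat => ⟨fun r₀ C => N₀ r₀ C *
    (BoundedGeometry.derivCount (n + 1) k *
      BoundedGeometry.transferConst (n + 1) k (Chat r₀ C (k + 1)).toNNReal) *
    (c * BoundedGeometry.derivCount (n + 1) k), ?_⟩⟩
  intro r₀ C _ _ X _ _ _ _ _ _ _ _ _ _ M _ _ ι ι' _ _ A A' e h hA'
  obtain ⟨E, h1, h2, h3⟩ := h.exists_extension hA' E₀ hE₀ hc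
  exact ⟨E, h1, h2, fun u => ⟨fun α => A.localize k α u, fun α => A.localize_ae_eq α u, h3 u⟩⟩
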